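/- **Notation.** For a real number $a\neq 0$ let $\mathrm{mag}(a)$ be the integer $b$ with $2^{b-1}\le |a|<2^b$. For a natural number $d$ and a real $x\ne0$ let $\circ_d(x)$ be $x$ rounded to $d$ bits, that is, the multiple of $2^{\mathrm{mag}(x)-d}$ nearest to $x$ (ties to the even multiple), and $\circ_d(0)=0$. For real $x,y$ put $x\oplus_d y=\circ_d(\circ_d(x)+\circ_d(y))$, $x\ominus_d y=\circ_d(\circ_d(x)-\circ_d(y))$, $x\otimes_d y=\circ_d(\circ_d(x)\circ_d(y))$, and for complex numbers $$(x+iy)\otimes_d(u+iv)=\bigl((x\otimes_d u)\ominus_d(y\otimes_d v)\bigr)+i\bigl((x\otimes_d v)\oplus_d(y\otimes_d u)\bigr).$$ Let $$\mathcal R(s)=\int_{0\swarrow1}\frac{x^{-s}e^{\pi i x^2}}{e^{\pi i x}-e^{-\pi i x}}\,dx ,$$ where the path is the straight line of slope $1$ through $x=\tfrac12$, traversed from upper right to lower left, and $x^{-s}$ is the principal power. Let $\vartheta(t)=\operatorname{Im}\log\Gamma(\tfrac14+\tfrac{it}2)-\tfrac t2\log\pi$ (the continuous branch with $\vartheta(0)=0$)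 and $Z(t)=e^{i\vartheta(t)}\zeta(\tfrac12+it)$. **Proposition.** Let $t>16\pi$ be real, let $w\ge1$ be a natural number (the initial working precision, `wpinitial`), and put $$d'=w+1+\mathrm{mag}\Bigl(3\bigl(\tfrac t{2\pi}\bigr)^{3/2}\log\tfrac t{2\pi}\Bigr),\qquad d=w+1+\mathrm{mag}\Bigl(12\,\tfrac t{2\pi}\log\tfrac t{2\pi}\Bigr)$$ (the precisions `wptheta` and `wpz`). Suppose that * $\vartheta(t)$ is computed at precision $d'$: $\theta\in\mathbb R$ with $|\theta-\vartheta(t)|\le 2^{-d'}|\vartheta(t)|$; * $\mathcal R(\tfrac12+it)$ is computed at precision $d$: $r\in\mathbb C$ with $|r-\mathcal R(\tfrac12+it)|\le 2^{-d}$; * $e^{i\theta}$ is computed at precision $d$: $E\in\mathbb C$ with $|E-e^{i\theta}|\le 2^{-d}$; * $z=E\otimes_d r$ is the floating point product at precision $d$. Then $$\Bigl|2\operatorname{Re}z-2\operatorname{Re}\bigl(e^{i\vartheta(t)}\mathcal R(\tfrac12+it)\bigr)\Bigr|<2^{-w}\qquad\text{and}\qquad |2\operatorname{Re}z-Z(t)|<2^{-w}.$$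 Consequently, if $2\operatorname{Re} z$ is finally rounded to $w$ bits, then $|\circ_w(2\operatorname{Re}z)-Z(t)|<2^{-w}\,(1+|2\operatorname{Re}z|)$. -/

import Mathlib

noncomputable section

/-- For `a ≠ 0` the unique integer `b` with `2 ^ (b - 1) ≤ |a| < 2 ^ b`. -/
def mag (a : ℝ) : ℤ := Int.log 2 |a| + 1

/-- Nearest integer; a half-integer goes to the even one of its two neighbours. -/
def roundHalfEven (y : ℝ) : ℤ :=
  if Int.fract y < 1 / 2 then ⌊y⌋
  else if 1 / 2 < Int.fract y then ⌊y⌋ + 1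
  else if Even ⌊y⌋ then ⌊y⌋
  else ⌊y⌋ + 1

/-- The rounded version of the real number `x` to `d` bits (round to nearest, ties to even):
with `2 ^ (e - 1) ≤ |x| < 2 ^ e`, the nearest multiple of `2 ^ (e - d)`. It is `0` at `x = 0`. -/
def fpRound (d : ℕ) (x : ℝ) : ℝ :=
  (roundHalfEven (x / (2 : ℝ) ^ (mag x - (d : ℤ))) : ℝ) * (2 : ℝ) ^ (mag x - (d : ℤ))

/-- Floating point addition at working precision `d`. -/
def fpAdd (d : ℕ) (x y : ℝ) : ℝ := fpRound d (fpRound d x + fpRound d y)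

/-- Floating point subtraction at working precision `d`. -/
def fpSub (d : ℕ) (x y : ℝ) : ℝ := fpRound d (fpRound d x - fpRound d y)

/-- Floating point multiplication at working precision `d`. -/
def fpMul (d : ℕ) (x y : ℝ) : ℝ := fpRound d (fpRound d x * fpRound d y)

/-- Floating point multiplication of complex numbers at working precision `d`, by four real
products, one difference and one sum. -/
def fpCMul (d : ℕ) (a b : ℂ) : ℂ :=
  ⟨fpSub d (fpMul d a.re b.re) (fpMul d a.im b.im),
   fpAdd d (fpMul d a.re b.im) (fpMul d a.im b.re)⟩

/-- The integrand `x ^ (-s) * e ^ (π i x ^ 2) / (e ^ (π i x) - e ^ (-π i x))` (principal power)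
of the Riemann-Siegel integral. -/
def rsIntegrand (s x : ℂ) : ℂ :=
  x ^ (-s) * Complex.exp (Real.pi * Complex.I * x ^ 2) /
    (Complex.exp (Real.pi * Complex.I * x) - Complex.exp (-(Real.pi * Complex.I * x)))

/-- Riemann's auxiliary function `ℛ(s)`: the integral of `rsIntegrand s` along the line of slope
`1` through `1 / 2`, traversed from upper right to lower left,
`x = 1 / 2 - e ^ (π i / 4) u` with `u` from `-∞` to `∞`. -/
def rsR (s : ℂ) : ℂ :=
  ∫ u : ℝ, rsIntegrand s (1 / 2 - Complex.exp (Real.pi * Complex.I / 4) * u) *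
    (-Complex.exp (Real.pi * Complex.I / 4))

/-- The Riemann-Siegel theta function `ϑ(t) = Im log Γ(1/4 + i t/2) - (t/2) log π`, where
`log Γ(1/4 + i t/2)` is the continuous branch that is real at `t = 0`; its imaginary part is
the integral over `0 ≤ u ≤ t` of its derivative `(1/2) Re (Γ'/Γ)(1/4 + i u/2)`. -/
def siegelTheta (t : ℝ) : ℝ :=
  (∫ u in (0 : ℝ)..t, (Complex.digamma (1 / 4 + Complex.I * u / 2)).re / 2) -
    t / 2 * Real.log Real.pi

/-- The Riemann-Siegel (Hardy) function `Z(t) = e ^ (i ϑ(t)) ζ(1/2 + i t)`. -/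
def hardyZ (t : ℝ) : ℂ :=
  Complex.exp (Complex.I * siegelTheta t) * riemannZeta (1 / 2 + Complex.I * t)

end

/-! ### Floating point arithmetic -/

/-! Write `τ = t/(2π)`, `L = log τ` and `ω = e^(πi/4)`. Three things are needed: an exact identity,
two size bounds and an error count.

The identity is `Z(t) = 2 Re(e^(iϑ) ℛ(1/2+it))` (`hardyZ_eq`). Mordell's integral, the integral of
`e^(-ωρx)` against the Riemann-Siegel kernel, has a closed form (`mordell_integral`): `1/(e^(ωρ)-1)`
minus a Gaussian term. Take Mellin transforms in `ρ`. The integral itself gives `Γ(s) ω^(-s) ℛ(s)`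
by Fubini, the first term gives `Γ(s) ω^(-s) ζ(s)`, and the Gaussian term is, up to scaling and
conjugation, the integrand of `ℛ(1 - conj s)` on the line through the origin. This is the
Riemann-Siegel formula for `Re s > 2`; analytic continuation carries it to the upper half-plane
(`riemann_siegel`). On the critical line `1 - conj s = s` and the gamma factor is `e^(2iϑ)`, which
yields the identity.

The size bounds are `|ϑ(t)| ≤ πτ(L-1) + 2/5` (`abs_siegelTheta_le`), obtained by comparing the
phases in Euler's product for `Γ` with an integral of `arctan`, and `|ℛ(1/2+it)| ≤ 2τ^(1/4) + 7/10`
(`norm_rsR_le`), obtained by moving the line past the first `⌊√τ⌋` integers: the residues form a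
partial sum of `n^(-s)` and the remaining line runs close to the saddle point `√τ`.

For the error, five roundings act on each term of `Re z`, so the product costs about `5ε|ℛ|` with `ε
= 2^(-d)`. Approximating the two factors costs about `ε(|ℛ|+1)`, and the error of `θ` costs
`2^(-d')|ϑ||ℛ|`. The precisions are chosen so that `2ε·12τL` and `2·2^(-d')·3τ^(3/2)L` are below
`2^(-w)`; `error_budget` checks that the shares add up to less than one. -/

theorem abs_roundHalfEven_sub_le (y : ℝ) : |(roundHalfEven y : ℝ) - y| ≤ 1 / 2 := by
  have h1 := Int.floor_add_fract y
  have h2 := Int.fract_nonneg y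
  have h3 := Int.fract_lt_one y
  unfold roundHalfEven
  rw [abs_le]
  split_ifs <;> push_cast <;> constructor <;> linarith

theorem two_zpow_mag_le {a : ℝ} (ha : a ≠ 0) : (2 : ℝ) ^ (mag a - 1) ≤ |a| := by
  have := Int.zpow_log_le_self (b := 2) (by norm_num) (abs_pos.2 ha)
  simpa [mag] using this

theorem lt_two_zpow_mag (a : ℝ) : |a| < (2 : ℝ) ^ mag a := by
  have := Int.lt_zpow_succ_log_self (b := 2) (by norm_num) |a|
  simpa [mag] using this

theorem abs_fpRound_sub_le (d : ℕ) (x : ℝ) :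
    |fpRound d x - x| ≤ (2 : ℝ) ^ (-(d : ℤ)) * |x| := by
  rcases eq_or_ne x 0 with rfl | hx
  · simp [fpRound, roundHalfEven]
  have hp : (0 : ℝ) < 2 ^ (mag x - (d : ℤ)) := by positivity
  have h1 : fpRound d x - x =
      ((roundHalfEven (x / (2 : ℝ) ^ (mag x - (d : ℤ))) : ℝ) - x / (2 : ℝ) ^ (mag x - (d : ℤ)))
        * (2 : ℝ) ^ (mag x - (d : ℤ)) := by
    rw [sub_mul, div_mul_cancel₀ _ hp.ne', fpRound]
  rw [h1, abs_mul, abs_of_pos hp]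
  calc _ ≤ 1 / 2 * (2 : ℝ) ^ (mag x - (d : ℤ)) := by
        gcongr; exact abs_roundHalfEven_sub_le _
    _ = (2 : ℝ) ^ (-(d : ℤ)) * 2 ^ (mag x - 1) := by
        rw [show mag x - (d : ℤ) = -(d : ℤ) + (mag x - 1) + 1 by ring,
          zpow_add₀ two_ne_zero, zpow_add₀ two_ne_zero]
        ring
    _ ≤ _ := by gcongr; exact two_zpow_mag_le hx

/-- Errors are tracked as `(e - 1) * B`, so that one more rounding just multiplies `e` by `1 +
2^(-d)`. Measuring against `B` instead of `|y|` keeps the estimate usable when `y` is a difference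
with cancellation. -/
theorem abs_fpRound_sub_le_of_abs_sub_le {d : ℕ} {x y B e : ℝ} (hy : |y| ≤ B)
    (h : |x - y| ≤ (e - 1) * B) :
    |fpRound d x - y| ≤ ((1 + (2 : ℝ) ^ (-(d : ℤ))) * e - 1) * B := by
  have h1 := abs_fpRound_sub_le d x
  have hp : (0 : ℝ) < 2 ^ (-(d : ℤ)) := by positivity
  have h2 : |x| ≤ e * B := by
    calc |x| = |(x - y) + y| := by ring_nf
      _ ≤ |x - y| + |y| := abs_add_le _ _
      _ ≤ _ := by linarith
  calc |fpRound d x - y| = |(fpRound d x - x) + (x - y)| := by ring_nf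
    _ ≤ |fpRound d x - x| + |x - y| := abs_add_le _ _
    _ ≤ 2 ^ (-(d : ℤ)) * (e * B) + (e - 1) * B := by gcongr; exact h1.trans (by gcongr)
    _ = _ := by ring

theorem abs_fpMul_sub_le (d : ℕ) (x y : ℝ) :
    |fpMul d x y - x * y| ≤ ((1 + (2 : ℝ) ^ (-(d : ℤ))) ^ 3 - 1) * |x * y| := by
  set ε : ℝ := (2 : ℝ) ^ (-(d : ℤ)) with hε
  have hp : 0 < ε := by positivity
  have hx := abs_fpRound_sub_le d x
  have hy := abs_fpRound_sub_le d y
  rw [← hε] at hx hy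
  have h1 : |fpRound d x| ≤ (1 + ε) * |x| := by
    calc |fpRound d x| = |(fpRound d x - x) + x| := by ring_nf
      _ ≤ |fpRound d x - x| + |x| := abs_add_le _ _
      _ ≤ _ := by linarith
  have h2 : |fpRound d x * fpRound d y - x * y| ≤ ((1 + ε) ^ 2 - 1) * |x * y| := by
    calc |fpRound d x * fpRound d y - x * y|
        = |fpRound d x * (fpRound d y - y) + (fpRound d x - x) * y| := by ring_nf
      _ ≤ |fpRound d x| * |fpRound d y - y| + |fpRound d x - x| * |y| := by
          rw [← abs_mul, ← abs_mul]; exact abs_add_le _ _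
      _ ≤ ((1 + ε) * |x|) * (ε * |y|) + (ε * |x|) * |y| := by gcongr
      _ = _ := by rw [abs_mul]; ring
  have := abs_fpRound_sub_le_of_abs_sub_le (d := d) le_rfl h2
  rw [← hε] at this
  calc _ ≤ _ := this
    _ = _ := by ring

/-- The exponent counts roundings along a path: two operands, their product, the operand of the
subtraction (rounded again, with no appeal to idempotence) and the difference. Cancellation is
harmless because Cauchy-Schwarz bounds the sum of the absolute values of the two products by `‖a‖ *
‖b‖`. -/
theorem abs_re_fpCMul_sub_le (d : ℕ) (a b : ℂ) :
    |(fpCMul d a b).re - (a * b).re| ≤ ((1 + (2 : ℝ) ^ (-(d : ℤ))) ^ 5 - 1) * (‖a‖ * ‖b‖) := by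
  have h1 := abs_fpMul_sub_le d a.re b.re
  have h2 := abs_fpMul_sub_le d a.im b.im
  have h3 := abs_fpRound_sub_le_of_abs_sub_le (d := d) le_rfl h1
  have h4 := abs_fpRound_sub_le_of_abs_sub_le (d := d) le_rfl h2
  set ε : ℝ := (2 : ℝ) ^ (-(d : ℤ)) with hε
  have hp : 0 < ε := by positivity
  have h5 : |fpRound d (fpMul d a.re b.re) - fpRound d (fpMul d a.im b.im) -
      (a.re * b.re - a.im * b.im)| ≤
      ((1 + ε) ^ 4 - 1) * (|a.re * b.re| + |a.im * b.im|) := by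
    calc _ = |(fpRound d (fpMul d a.re b.re) - a.re * b.re) -
          (fpRound d (fpMul d a.im b.im) - a.im * b.im)| := by ring_nf
      _ ≤ _ := (abs_sub _ _).trans (add_le_add h3 h4)
      _ = _ := by ring
  have h6 := abs_fpRound_sub_le_of_abs_sub_le (d := d) (abs_sub (a.re * b.re) (a.im * b.im)) h5
  have h7 : |a.re * b.re| + |a.im * b.im| ≤ ‖a‖ * ‖b‖ := by
    rw [abs_mul, abs_mul]
    refine le_of_sq_le_sq ?_ (by positivity)
    have e1 : ‖a‖ ^ 2 = |a.re| ^ 2 + |a.im| ^ 2 := by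
      rw [Complex.sq_norm, Complex.normSq_apply, sq_abs, sq_abs]; ring
    have e2 : ‖b‖ ^ 2 = |b.re| ^ 2 + |b.im| ^ 2 := by
      rw [Complex.sq_norm, Complex.normSq_apply, sq_abs, sq_abs]; ring
    rw [mul_pow, e1, e2]
    nlinarith [sq_nonneg (|a.re| * |b.im| - |a.im| * |b.re|)]
  have h8 : (0 : ℝ) ≤ (1 + ε) ^ 5 - 1 := by
    have : (1 : ℝ) ≤ (1 + ε) ^ 5 := one_le_pow₀ (by linarith)
    linarith
  rw [Complex.mul_re]
  calc _ ≤ _ := h6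
    _ = ((1 + ε) ^ 5 - 1) * (|a.re * b.re| + |a.im * b.im|) := by ring
    _ ≤ _ := by gcongr

open Complex MeasureTheory Set Filter Topology ComplexConjugate

/-! ### Integrals along lines of slope one -/

/-- The direction `e ^ (π i / 4)` of the lines of slope one. -/
noncomputable def diagDir : ℂ := Complex.exp (Real.pi * Complex.I / 4)

/-- The integral of `f` along the line of slope one through `c`, downwards. -/
noncomputable def diagInt (f : ℂ → ℂ) (c : ℝ) : ℂ :=
  ∫ u : ℝ, f (c - diagDir * u) * (-diagDir)

/-- The closed strip between the lines of slope one through `a` and `b`. -/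
def diagStrip (a b : ℝ) : Set ℂ := {x | a ≤ x.re - x.im ∧ x.re - x.im ≤ b}

theorem diagDir_eq : diagDir = ((√2 / 2 : ℝ) : ℂ) + ((√2 / 2 : ℝ) : ℂ) * I := by
  have : (Real.pi * I / 4 : ℂ) = ((Real.pi / 4 : ℝ) : ℂ) * I := by push_cast; ring
  rw [diagDir, this, exp_mul_I, ← ofReal_cos, ← ofReal_sin, Real.cos_pi_div_four,
    Real.sin_pi_div_four]

theorem diagDir_re : diagDir.re = √2 / 2 := by simp [diagDir_eq]
theorem diagDir_im : diagDir.im = √2 / 2 := by simp [diagDir_eq]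

theorem norm_diagDir : ‖diagDir‖ = 1 := by
  have : (Real.pi * I / 4 : ℂ) = ((Real.pi / 4 : ℝ) : ℂ) * I := by push_cast; ring
  rw [diagDir, this, norm_exp_ofReal_mul_I]

theorem diagDir_ne_zero : diagDir ≠ 0 := Complex.exp_ne_zero _

theorem diagDir_sq : diagDir ^ 2 = I := by
  refine Eq.trans ?_ Complex.exp_pi_div_two_mul_I
  rw [diagDir, ← Complex.exp_nat_mul]
  congr 1; push_cast; ring

theorem diagPoint_re (c u : ℝ) : ((c : ℂ) - diagDir * u).re = c - √2 / 2 * u := by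
  simp [diagDir_re]
theorem diagPoint_im (c u : ℝ) : ((c : ℂ) - diagDir * u).im = -(√2 / 2 * u) := by
  simp [diagDir_im]

theorem diagPoint_mem {a b c : ℝ} (hc : c ∈ Icc a b) (u : ℝ) :
    (c : ℂ) - diagDir * u ∈ diagStrip a b := by
  simp only [diagStrip, mem_ofPred_eq, diagPoint_re, diagPoint_im]
  constructor <;> linarith [hc.1, hc.2]

theorem isClosed_diagStrip (a b : ℝ) : IsClosed (diagStrip a b) := by
  have h : Continuous fun x : ℂ => x.re - x.im := by fun_prop
  exact (isClosed_Icc (a := a) (b := b)).preimage h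

/-- A continuous function on a strip that decays exponentially far out does so everywhere. -/
theorem exists_norm_le_exp_neg_norm {f : ℂ → ℂ} {S : Set ℂ} (hS : IsClosed S)
    (hf : ContinuousOn f S) {C M : ℝ}
    (hdec : ∀ x ∈ S, M ≤ ‖x‖ → ‖f x‖ ≤ C * Real.exp (-‖x‖)) :
    ∃ C' : ℝ, ∀ x ∈ S, ‖f x‖ ≤ C' * Real.exp (-‖x‖) := by
  have hK : IsCompact (S ∩ Metric.closedBall 0 M) := (isCompact_closedBall 0 M).inter_left hS
  obtain ⟨B, hB⟩ := hK.exists_bound_of_continuousOn (hf.mono inter_subset_left)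
  refine ⟨max C (B * Real.exp M), fun x hx => ?_⟩
  rcases le_total M ‖x‖ with h | h
  · exact (hdec x hx h).trans (by gcongr; exact le_max_left _ _)
  · have h1 := hB x ⟨hx, by simpa using h⟩
    have hB0 : 0 ≤ B := (norm_nonneg _).trans h1
    calc ‖f x‖ ≤ B := h1
      _ ≤ B * (Real.exp M * Real.exp (-‖x‖)) := by
        rw [← Real.exp_add]
        exact le_mul_of_one_le_right hB0 (Real.one_le_exp (by linarith))
      _ = (B * Real.exp M) * Real.exp (-‖x‖) := by ring
      _ ≤ _ := by gcongr; exact le_max_right _ _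

theorem integrable_exp_neg_abs : Integrable fun u : ℝ => Real.exp (-|u|) := by
  have h1 : IntegrableOn (fun u : ℝ => Real.exp (-|u|)) (Ioi 0) :=
    (integrableOn_exp_neg_Ioi 0).congr_fun
      (fun x hx => by simp only [abs_of_pos (mem_Ioi.1 hx)]) measurableSet_Ioi
  have h2 : IntegrableOn (fun u : ℝ => Real.exp (-|u|)) (Iic 0) :=
    (integrableOn_exp_Iic 0).congr_fun
      (fun x hx => by simp only [abs_of_nonpos (mem_Iic.1 hx), neg_neg]) measurableSet_Iic
  rw [← integrableOn_univ, ← Iic_union_Ioi (a := (0 : ℝ))]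
  exact h2.union h1

theorem norm_diagPoint_ge (c u : ℝ) : |u| - |c| ≤ ‖(c : ℂ) - diagDir * u‖ := by
  have := norm_sub_norm_le (diagDir * u) (c : ℂ)
  rw [norm_mul, norm_diagDir, one_mul, norm_real, norm_real, norm_sub_rev] at this
  simpa using this

theorem continuous_diagPoint (c : ℝ) : Continuous fun u : ℝ => (c : ℂ) - diagDir * u := by
  fun_prop

theorem integrable_diagPoint {f : ℂ → ℂ} {a b c : ℝ} (hc : c ∈ Icc a b)
    (hf : ContinuousOn f (diagStrip a b)) {C M : ℝ}
    (hdec : ∀ x ∈ diagStrip a b, M ≤ ‖x‖ → ‖f x‖ ≤ C * Real.exp (-‖x‖)) :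
    Integrable fun u : ℝ => f (c - diagDir * u) := by
  obtain ⟨C', hC'⟩ := exists_norm_le_exp_neg_norm (isClosed_diagStrip a b) hf hdec
  have hcont : Continuous fun u : ℝ => f (c - diagDir * u) :=
    hf.comp_continuous (continuous_diagPoint c) fun u => diagPoint_mem hc u
  have hC0 : 0 ≤ C' := by
    have := (norm_nonneg _).trans (hC' _ (diagPoint_mem hc 0))
    exact nonneg_of_mul_nonneg_left this (Real.exp_pos _)
  refine (integrable_exp_neg_abs.const_mul (C' * Real.exp |c|)).mono'
    hcont.aestronglyMeasurable (Eventually.of_forall fun u => ?_)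
  refine (hC' _ (diagPoint_mem hc u)).trans ?_
  rw [mul_assoc, ← Real.exp_add]
  gcongr
  linarith [norm_diagPoint_ge c u]

/-- **Cauchy's theorem** for the strip between two lines of slope one. -/
theorem diagInt_eq_of_differentiable {f : ℂ → ℂ} {a b : ℝ} (hab : a ≤ b) {s : Set ℂ}
    (hs : s.Countable) (hf : ContinuousOn f (diagStrip a b))
    (hd : ∀ x ∈ diagStrip a b, x ∉ s → DifferentiableAt ℂ f x) {C M : ℝ}
    (hdec : ∀ x ∈ diagStrip a b, M ≤ ‖x‖ → ‖f x‖ ≤ C * Real.exp (-‖x‖)) :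
    diagInt f a = diagInt f b := by
  have hr2 : √2 * √2 = 2 := Real.mul_self_sqrt (by norm_num)
  have hr0 : √2 ≠ 0 := by positivity
  obtain ⟨C', hC'⟩ := exists_norm_le_exp_neg_norm (isClosed_diagStrip a b) hf hdec
  -- The rotation turns the line of slope one through `c` into the horizontal line at height `c /
  -- √2`, so Cauchy's theorem for rectangles applies; the vertical sides vanish in the limit.
  set g : ℂ → ℂ := fun z => f (-diagDir * z) with hg
  have hpt : ∀ u c : ℝ, -diagDir * ((u : ℂ) + (c / √2 : ℝ) * I) =
      (c : ℂ) - diagDir * ((u + c / √2 : ℝ) : ℂ) := by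
    intro u c
    apply Complex.ext
    · simp [diagDir_re, diagDir_im]; field_simp; nlinarith
    · simp [diagDir_re, diagDir_im]; field_simp; ring
  have hmem : ∀ u y : ℝ, y ∈ Icc (a / √2) (b / √2) →
      -diagDir * ((u : ℂ) + y * I) ∈ diagStrip a b := by
    intro u y hy
    have := hpt u (√2 * y)
    rw [mul_div_cancel_left₀ _ hr0] at this
    rw [this]
    refine diagPoint_mem ⟨?_, ?_⟩ _
    · have := hy.1; rw [div_le_iff₀ (by positivity)] at this; linarith
    · have := hy.2; rw [le_div_iff₀ (by positivity)] at this; linarith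
  have hline : ∀ c ∈ Icc a b,
      Tendsto (fun T : ℝ => ∫ u in (-T)..T, g (u + (c / √2 : ℝ) * I)) atTop
        (𝓝 (∫ u : ℝ, f (c - diagDir * u))) := by
    intro c hc
    have hi := integrable_diagPoint hc hf hdec
    have h1 : (∫ u : ℝ, f (c - diagDir * u)) = ∫ u : ℝ, g (u + (c / √2 : ℝ) * I) := by
      simp only [hg, hpt]
      rw [integral_add_right_eq_self fun u : ℝ => f (c - diagDir * u)]
    rw [h1]
    refine intervalIntegral_tendsto_integral ?_ tendsto_neg_atTop_atBot tendsto_id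
    simp only [hg, hpt]
    exact hi.comp_add_right (c / √2)
  have hside : ∀ σ : ℝ, |σ| = 1 →
      Tendsto (fun T : ℝ => ∫ y in (a / √2)..(b / √2), g ((σ * T : ℝ) + y * I)) atTop (𝓝 0) := by
    intro σ hσ
    have hab' : a / √2 ≤ b / √2 := by gcongr
    have hC0 : 0 ≤ C' := by
      have := (norm_nonneg _).trans (hC' _ (diagPoint_mem ⟨le_rfl, hab⟩ 0))
      exact nonneg_of_mul_nonneg_left this (Real.exp_pos _)
    have hbd : ∀ T : ℝ, 0 ≤ T →
        ‖∫ y in (a / √2)..(b / √2), g ((σ * T : ℝ) + y * I)‖ ≤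
          C' * Real.exp (-T) * |b / √2 - a / √2| := by
      intro T hT
      refine intervalIntegral.norm_integral_le_of_norm_le_const fun y hy => ?_
      rw [uIoc_of_le hab'] at hy
      refine (hC' _ (hmem _ _ ⟨hy.1.le, hy.2⟩)).trans ?_
      gcongr
      rw [norm_mul, norm_neg, norm_diagDir, one_mul]
      calc T = |σ * T| := by rw [abs_mul, hσ, one_mul, abs_of_nonneg hT]
        _ = |((σ * T : ℝ) + y * I : ℂ).re| := by simp
        _ ≤ _ := abs_re_le_norm _
    refine squeeze_zero_norm' (a := fun T => C' * Real.exp (-T) * |b / √2 - a / √2|) ?_ ?_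
    · filter_upwards [eventually_ge_atTop 0] with T hT using hbd T hT
    · have := (Real.tendsto_exp_neg_atTop_nhds_zero.const_mul C').mul_const |b / √2 - a / √2|
      simpa using this
  have hrect : ∀ T : ℝ, 0 ≤ T →
      (∫ u in (-T)..T, g (u + (a / √2 : ℝ) * I)) - (∫ u in (-T)..T, g (u + (b / √2 : ℝ) * I)) +
      I • (∫ y in (a / √2)..(b / √2), g (((1 : ℝ) * T : ℝ) + y * I)) -
      I • (∫ y in (a / √2)..(b / √2), g (((-1 : ℝ) * T : ℝ) + y * I)) = 0 := by
    intro T hT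
    have hab' : a / √2 ≤ b / √2 := by gcongr
    have := integral_boundary_rect_eq_zero_of_differentiable_on_off_countable g
      (⟨-T, a / √2⟩ : ℂ) (⟨T, b / √2⟩ : ℂ) ((fun z => -diagDir * z) ⁻¹' s)
      (hs.preimage (mul_right_injective₀ (neg_ne_zero.2 diagDir_ne_zero))) ?_ ?_
    · simpa using this
    · refine hf.comp (by fun_prop) fun z hz => ?_
      rw [mem_reProdIm] at hz
      have := hmem z.re z.im (by simpa [uIcc_of_le hab'] using hz.2)
      rwa [re_add_im] at this
    · rintro z ⟨hz, hzs⟩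
      rw [mem_reProdIm] at hz
      have hz2 : z.im ∈ Icc (a / √2) (b / √2) := by
        have := hz.2
        simp only [min_eq_left hab', max_eq_right hab'] at this
        exact ⟨this.1.le, this.2.le⟩
      have := hmem z.re z.im hz2
      rw [re_add_im] at this
      exact (hd _ this hzs).comp z (by fun_prop)
  have hlim := (((hline a ⟨le_rfl, hab⟩).sub (hline b ⟨hab, le_rfl⟩)).add
    ((hside 1 (by simp)).const_smul I)).sub ((hside (-1) (by simp)).const_smul I)
  have hzero : Tendsto (fun _ : ℝ => (0 : ℂ)) atTop (𝓝 0) := tendsto_const_nhds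
  have := tendsto_nhds_unique (hlim.congr' (f₂ := fun _ => (0 : ℂ)) (by
    filter_upwards [eventually_ge_atTop 0] with T hT using hrect T hT)) hzero
  simp only [smul_zero, add_zero, sub_zero] at this
  rw [diagInt, diagInt, integral_mul_const, integral_mul_const, sub_eq_zero.1 this]

/-! ### The kernel of the Riemann-Siegel integral -/

/-- The denominator `e ^ (π i x) - e ^ (-π i x)` of the Riemann-Siegel kernel. -/
noncomputable def rsDenom (x : ℂ) : ℂ :=
  Complex.exp (Real.pi * I * x) - Complex.exp (-(Real.pi * I * x))

/-- The factor `e ^ (π i x ^ 2) / (e ^ (π i x) - e ^ (-π i x))` of the Riemann-Siegel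
integrand. -/
noncomputable def rsKernel (x : ℂ) : ℂ := Complex.exp (Real.pi * I * x ^ 2) / rsDenom x

theorem rsR_eq_diagInt (s : ℂ) : rsR s = diagInt (fun x => x ^ (-s) * rsKernel x) (1 / 2) := by
  simp only [rsR, diagInt, rsIntegrand, rsKernel, rsDenom, diagDir, mul_div_assoc]
  push_cast
  rfl

theorem rsDenom_eq_sin (x : ℂ) : rsDenom x = 2 * I * Complex.sin (Real.pi * x) := by
  rw [rsDenom, Complex.sin]
  ring_nf
  simp only [I_sq]
  ring_nf

theorem rsDenom_eq_zero_iff {x : ℂ} : rsDenom x = 0 ↔ ∃ n : ℤ, x = n := by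
  rw [rsDenom_eq_sin]
  simp only [mul_eq_zero, OfNat.ofNat_ne_zero, I_ne_zero, false_or, Complex.sin_eq_zero_iff]
  refine exists_congr fun n => ?_
  rw [mul_comm, mul_left_inj' (ofReal_ne_zero.2 Real.pi_ne_zero)]

theorem differentiable_rsDenom : Differentiable ℂ rsDenom := by
  unfold rsDenom; fun_prop

theorem rsDenom_intCast (n : ℤ) : rsDenom n = 0 := rsDenom_eq_zero_iff.2 ⟨n, rfl⟩

theorem deriv_rsDenom_intCast_ne_zero (n : ℤ) : deriv rsDenom n ≠ 0 := by
  have h : HasDerivAt rsDenom (2 * I * (Complex.cos (Real.pi * n) * (Real.pi * 1))) n := by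
    have : rsDenom = fun x => 2 * I * Complex.sin (Real.pi * x) := funext rsDenom_eq_sin
    rw [this]
    exact (((hasDerivAt_id (n : ℂ)).const_mul (Real.pi : ℂ)).csin).const_mul _
  rw [h.deriv]
  have hc : Complex.cos (Real.pi * n) ≠ 0 := by
    rw [mul_comm, ← ofReal_intCast, ← ofReal_mul, ← ofReal_cos, Real.cos_int_mul_pi]
    exact ofReal_ne_zero.2 (zpow_ne_zero _ (by norm_num))
  simp [hc, Real.pi_ne_zero]

theorem norm_rsDenom_ge {x : ℂ} (hx : 1 ≤ |x.im|) : 1 ≤ ‖rsDenom x‖ := by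
  have e1 : ‖Complex.exp (Real.pi * I * x)‖ = Real.exp (-(Real.pi * x.im)) := by
    rw [Complex.norm_exp]; simp
  have e2 : ‖Complex.exp (-(Real.pi * I * x))‖ = Real.exp (Real.pi * x.im) := by
    rw [Complex.norm_exp]; simp
  have h1 := norm_sub_norm_le (Complex.exp (Real.pi * I * x)) (Complex.exp (-(Real.pi * I * x)))
  have h2 := norm_sub_norm_le (Complex.exp (-(Real.pi * I * x))) (Complex.exp (Real.pi * I * x))
  rw [norm_sub_rev] at h2
  rw [e1, e2] at h1 h2
  have h3 := Real.pi_gt_three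
  unfold rsDenom
  rcases le_total 0 x.im with h | h
  · rw [abs_of_nonneg h] at hx
    have : Real.pi * x.im + 1 ≤ Real.exp (Real.pi * x.im) := Real.add_one_le_exp _
    have : Real.exp (-(Real.pi * x.im)) ≤ 1 := Real.exp_le_one_iff.2 (by nlinarith)
    nlinarith
  · rw [abs_of_nonpos h] at hx
    have : -(Real.pi * x.im) + 1 ≤ Real.exp (-(Real.pi * x.im)) := Real.add_one_le_exp _
    have : Real.exp (Real.pi * x.im) ≤ 1 := Real.exp_le_one_iff.2 (by nlinarith)
    nlinarith

theorem norm_exp_pi_sq (x : ℂ) :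
    ‖Complex.exp (Real.pi * I * x ^ 2)‖ = Real.exp (-(2 * Real.pi * x.re * x.im)) := by
  rw [Complex.norm_exp]
  congr 1
  simp [pow_two]
  ring

/-- In a strip of slope one the real and imaginary parts grow together, so decay in `|x.im|`, such
as that of `e^(πix²)`, is decay in `‖x‖`. -/
theorem norm_le_of_diag {x : ℂ} {c : ℝ} (hx : |x.re - x.im| ≤ c) : ‖x‖ ≤ 2 * |x.im| + c := by
  have h := Complex.norm_le_abs_re_add_abs_im x
  have : |x.re| ≤ |x.re - x.im| + |x.im| := by
    simpa using abs_add_le (x.re - x.im) x.im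
  linarith

/-- The Riemann-Siegel kernel beats every exponential in a strip of slope one. -/
theorem exists_norm_mul_rsKernel_le (A B c : ℝ) (hA : 0 ≤ A) (hB : 0 ≤ B) :
    ∃ C : ℝ, ∀ x y : ℂ, |x.re - x.im| ≤ c → 1 + 2 + c ≤ ‖x‖ → ‖y‖ ≤ A * Real.exp (B * ‖x‖) →
      ‖y * rsKernel x‖ ≤ C * Real.exp (-‖x‖) := by
  -- `K` collects all coefficients of `|x.im|` in the exponent; `K|x.im| ≤ K² + |x.im|²` is then
  -- absorbed by the Gaussian term `-2π|x.im|²`.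
  set K : ℝ := 2 * B + 2 + 2 * Real.pi * c with hK
  refine ⟨A * Real.exp ((B + 1) * c + K ^ 2), fun x y hx hxn hy => ?_⟩
  have hn := norm_le_of_diag hx
  have him : 1 ≤ |x.im| := by linarith
  have hpi := Real.pi_gt_three
  have hker : ‖rsKernel x‖ ≤ Real.exp (2 * Real.pi * c * |x.im| - 2 * Real.pi * |x.im| ^ 2) := by
    rw [rsKernel, norm_div, norm_exp_pi_sq]
    refine (div_le_self (Real.exp_pos _).le (norm_rsDenom_ge him)).trans ?_
    gcongr
    have h1 : -(x.re - x.im) * x.im ≤ c * |x.im| := by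
      calc _ ≤ |-(x.re - x.im) * x.im| := le_abs_self _
        _ = |x.re - x.im| * |x.im| := by rw [abs_mul, abs_neg]
        _ ≤ _ := by gcongr
    rw [sq_abs]
    nlinarith
  rw [norm_mul]
  calc ‖y‖ * ‖rsKernel x‖
      ≤ (A * Real.exp (B * ‖x‖)) *
        Real.exp (2 * Real.pi * c * |x.im| - 2 * Real.pi * |x.im| ^ 2) := by gcongr
    _ = A * Real.exp (B * ‖x‖ + (2 * Real.pi * c * |x.im| - 2 * Real.pi * |x.im| ^ 2)) := by
        rw [mul_assoc, ← Real.exp_add]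
    _ ≤ A * Real.exp ((B + 1) * c + K ^ 2 + -‖x‖) := by
        refine mul_le_mul_of_nonneg_left (Real.exp_le_exp.2 ?_) hA
        have h2 : (B + 1) * ‖x‖ ≤ (B + 1) * (2 * |x.im| + c) := by gcongr
        have h3 : K * |x.im| ≤ K ^ 2 + |x.im| ^ 2 := by
          nlinarith [sq_nonneg (K - |x.im|), sq_nonneg K, sq_nonneg |x.im|]
        have h4 : (B + 1) * (2 * |x.im| + c) + 2 * Real.pi * c * |x.im| =
          (B + 1) * c + K * |x.im| := by rw [hK]; ring
        nlinarith [sq_nonneg |x.im|]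
    _ = _ := by rw [Real.exp_add, mul_assoc]

theorem diagStrip_abs_le {a b : ℝ} {x : ℂ} (hx : x ∈ diagStrip a b) :
    |x.re - x.im| ≤ |a| + |b| := by
  rw [abs_le]
  constructor
  · linarith [hx.1, neg_abs_le a, abs_nonneg b]
  · linarith [hx.2, le_abs_self b, abs_nonneg a]

theorem exists_decay_mul_rsKernel {F : ℂ → ℂ} {a b A B : ℝ} (hA : 0 ≤ A) (hB : 0 ≤ B)
    {M : ℝ} (hF : ∀ x ∈ diagStrip a b, M ≤ ‖x‖ → ‖F x‖ ≤ A * Real.exp (B * ‖x‖)) :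
    ∃ C M' : ℝ, ∀ x ∈ diagStrip a b, M' ≤ ‖x‖ → ‖F x * rsKernel x‖ ≤ C * Real.exp (-‖x‖) := by
  obtain ⟨C, hC⟩ := exists_norm_mul_rsKernel_le A B (|a| + |b|) hA hB
  refine ⟨C, max M (1 + 2 + (|a| + |b|)), fun x hx hM => hC x (F x) (diagStrip_abs_le hx)
    ((le_max_right _ _).trans hM) (hF x hx ((le_max_left _ _).trans hM))⟩

theorem differentiableAt_rsKernel {x : ℂ} (hx : rsDenom x ≠ 0) :
    DifferentiableAt ℂ rsKernel x := by
  unfold rsKernel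
  exact DifferentiableAt.div (by fun_prop) (differentiable_rsDenom x) hx

theorem rsDenom_ne_zero_of_mem {n : ℤ} {a b : ℝ} (ha : (n : ℝ) < a) (hb : b < n + 1) {x : ℂ}
    (hx : x ∈ diagStrip a b) : rsDenom x ≠ 0 := by
  rw [Ne, rsDenom_eq_zero_iff]
  rintro ⟨m, rfl⟩
  have h1 := hx.1
  have h2 := hx.2
  simp only [intCast_re, intCast_im, sub_zero] at h1 h2
  have h3 : n < m := by exact_mod_cast ha.trans_le h1
  have h4 : m < n + 1 := by exact_mod_cast h2.trans_lt hb
  omega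

/-- Integrability of `F` times the Riemann-Siegel kernel along a line avoiding the integers. -/
theorem integrable_mul_rsKernel {F : ℂ → ℂ} {c A B : ℝ} {n : ℤ} (hn : (n : ℝ) < c)
    (hn' : c < n + 1) (hA : 0 ≤ A) (hB : 0 ≤ B) (hFc : ContinuousOn F (diagStrip c c))
    (hF : ∀ x ∈ diagStrip c c, ‖F x‖ ≤ A * Real.exp (B * ‖x‖)) :
    Integrable fun u : ℝ => F (c - diagDir * u) * rsKernel (c - diagDir * u) := by
  obtain ⟨C, M, h⟩ := exists_decay_mul_rsKernel (M := 0) hA hB fun x hx _ => hF x hx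
  exact integrable_diagPoint (f := fun x => F x * rsKernel x) ⟨le_rfl, le_rfl⟩
    (hFc.mul fun x hx => (differentiableAt_rsKernel
      (rsDenom_ne_zero_of_mem hn hn' hx)).continuousAt.continuousWithinAt) h

/-- Moving the line by one is the same as raising the parameter of the exponential by one. With
`exp_sub_one_mul_rsKernel`, where the denominator cancels and a pure Gaussian is left, this
determines Mordell's integral. -/
theorem rsKernel_add_one (x : ℂ) :
    rsKernel (x + 1) = Complex.exp (2 * Real.pi * I * x) * rsKernel x := by
  have h : rsDenom (x + 1) = -rsDenom x := by
    have e1 : Real.pi * I * (x + 1) = Real.pi * I * x + Real.pi * I := by ring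
    have e2 : -(Real.pi * I * x + Real.pi * I) = -(Real.pi * I * x) - Real.pi * I := by ring
    rw [rsDenom, rsDenom, e1, e2, Complex.exp_add, Complex.exp_sub, Complex.exp_pi_mul_I]
    ring
  have e3 : Real.pi * I * (x + 1) ^ 2 = (2 * Real.pi * I * x + Real.pi * I * x ^ 2) + Real.pi * I := by
    ring
  rw [rsKernel, h, e3, Complex.exp_add, Complex.exp_pi_mul_I, Complex.exp_add, rsKernel]
  rw [mul_neg_one, neg_div_neg_eq, mul_div_assoc]

theorem exp_sub_one_mul_rsKernel {x : ℂ} (hx : rsDenom x ≠ 0) :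
    (Complex.exp (2 * Real.pi * I * x) - 1) * rsKernel x =
      Complex.exp (Real.pi * I * (x ^ 2 + x)) := by
  have h : Complex.exp (2 * Real.pi * I * x) - 1 = Complex.exp (Real.pi * I * x) * rsDenom x := by
    rw [rsDenom, mul_sub, ← Complex.exp_add, ← Complex.exp_add]
    ring_nf
    rw [Complex.exp_zero]
    ring
  rw [h, rsKernel, mul_assoc, mul_div_cancel₀ _ hx, ← Complex.exp_add]
  ring_nf

/-! ### Gaussian integrals, residues and Mordell's integral. -/

theorem diagInt_gaussian (c : ℝ) (a : ℂ) :
    diagInt (fun x => Complex.exp (Real.pi * I * (x ^ 2 + 2 * a * x))) c =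
      -diagDir * Complex.exp (-(Real.pi * I * a ^ 2)) := by
  have h : ∀ u : ℝ, Complex.exp (Real.pi * I * (((c : ℂ) - diagDir * u) ^ 2 +
      2 * a * ((c : ℂ) - diagDir * u))) = Complex.exp ((-Real.pi : ℂ) * u ^ 2 +
      (-(2 * Real.pi * I * diagDir * (c + a))) * u + Real.pi * I * (c ^ 2 + 2 * a * c)) := by
    intro u
    congr 1
    linear_combination (Real.pi * I * u ^ 2) * diagDir_sq + (Real.pi * u ^ 2 : ℂ) * I_sq
  have hpi : (Real.pi : ℂ) ≠ 0 := ofReal_ne_zero.2 Real.pi_ne_zero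
  rw [diagInt, integral_mul_const]
  simp_rw [h]
  rw [integral_cexp_quadratic (by simpa using Real.pi_pos), neg_neg, div_self hpi, one_cpow,
    one_mul, mul_comm]
  congr 2
  field_simp
  linear_combination (4 * (c + a) ^ 2 * I : ℂ) * diagDir_sq + (4 * (c + a) ^ 2) * I_sq

theorem diagDir_mul_exp : diagDir * Complex.exp (-(Real.pi * I * (1 / 2) ^ 2)) = 1 := by
  refine Eq.trans ?_ Complex.exp_zero
  rw [diagDir, ← Complex.exp_add]
  congr 1
  ring

theorem diagInt_add_one (f : ℂ → ℂ) (c : ℝ) :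
    diagInt f (c + 1) = diagInt (fun x => f (x + 1)) c := by
  simp only [diagInt]
  congr 1
  ext u
  congr 2
  push_cast
  ring

theorem diagInt_sub {f g : ℂ → ℂ} {c : ℝ}
    (hf : Integrable fun u : ℝ => f (c - diagDir * u))
    (hg : Integrable fun u : ℝ => g (c - diagDir * u)) :
    diagInt (fun x => f x - g x) c = diagInt f c - diagInt g c := by
  simp only [diagInt, sub_mul]
  exact integral_sub (hf.mul_const _) (hg.mul_const _)

theorem diagInt_const_mul (f : ℂ → ℂ) (c : ℝ) (k : ℂ) :
    diagInt (fun x => k * f x) c = k * diagInt f c := by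
  simp only [diagInt, mul_assoc]
  rw [integral_const_mul]

theorem diagInt_congr {f g : ℂ → ℂ} {c : ℝ} (h : ∀ x ∈ diagStrip c c, f x = g x) :
    diagInt f c = diagInt g c := by
  simp only [diagInt]
  congr 1
  ext u
  rw [h _ (diagPoint_mem ⟨le_rfl, le_rfl⟩ u)]

theorem integrable_exp_mul_rsKernel (a : ℂ) {c : ℝ} {n : ℤ} (hn : (n : ℝ) < c)
    (hn' : c < n + 1) :
    Integrable fun u : ℝ => Complex.exp (a * (c - diagDir * u)) * rsKernel (c - diagDir * u) := by
  refine integrable_mul_rsKernel (F := fun x => Complex.exp (a * x)) (A := 1) (B := ‖a‖) hn hn'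
    zero_le_one (norm_nonneg _) (by fun_prop) fun x _ => ?_
  rw [one_mul]
  exact (Complex.norm_exp_le_exp_norm _).trans (by rw [norm_mul])

/-- Relation between the Mordell integrals with parameters `a + 1` and `a`. -/
theorem diagInt_exp_rsKernel_add_one (a : ℂ) {c : ℝ} {n : ℤ} (hn : (n : ℝ) < c)
    (hn' : c < n + 1) :
    diagInt (fun x => Complex.exp (2 * Real.pi * I * (a + 1) * x) * rsKernel x) c -
      diagInt (fun x => Complex.exp (2 * Real.pi * I * a * x) * rsKernel x) c =
      -Complex.exp (-(Real.pi * I * (a ^ 2 + a))) := by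
  rw [← diagInt_sub (integrable_exp_mul_rsKernel _ hn hn') (integrable_exp_mul_rsKernel _ hn hn')]
  have h : diagInt (fun x => Complex.exp (2 * Real.pi * I * (a + 1) * x) * rsKernel x -
      Complex.exp (2 * Real.pi * I * a * x) * rsKernel x) c =
      diagInt (fun x => Complex.exp (Real.pi * I * (x ^ 2 + 2 * (a + 1 / 2) * x))) c := by
    refine diagInt_congr fun x hx => ?_
    have e : Real.pi * I * (x ^ 2 + 2 * (a + 1 / 2) * x) =
      2 * Real.pi * I * a * x + Real.pi * I * (x ^ 2 + x) := by ring
    have e' : 2 * Real.pi * I * (a + 1) * x = 2 * Real.pi * I * a * x + 2 * Real.pi * I * x := by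
      ring
    rw [e, Complex.exp_add, ← exp_sub_one_mul_rsKernel (rsDenom_ne_zero_of_mem hn hn' hx), e',
      Complex.exp_add]
    ring
  rw [h, diagInt_gaussian]
  have e : -(Real.pi * I * (a + 1 / 2) ^ 2) =
    -(Real.pi * I * (1 / 2) ^ 2) + -(Real.pi * I * (a ^ 2 + a)) := by ring
  rw [e, Complex.exp_add, ← mul_assoc, neg_mul, diagDir_mul_exp, neg_one_mul]

/-- The residue contribution of one integer. Quasi-periodicity and the Gaussian relation at
parameter `0` give it without a residue theorem. -/
theorem diagInt_rsKernel_sub {c : ℝ} {n : ℤ} (hn : (n : ℝ) < c) (hn' : c < n + 1) :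
    diagInt rsKernel c - diagInt rsKernel (c + 1) = 1 := by
  have h := diagInt_exp_rsKernel_add_one 0 hn hn'
  rw [diagInt_add_one]
  simp only [rsKernel_add_one]
  simp only [zero_add, mul_one, mul_zero, zero_mul, Complex.exp_zero, one_mul, neg_zero,
    zero_pow two_ne_zero] at h
  rw [← neg_inj, neg_sub, h]

/-- Moving the line of integration across the integer `n`. -/
theorem diagInt_mul_rsKernel_shift {F : ℂ → ℂ} {n : ℤ} {A B : ℝ} (hA : 0 ≤ A) (hB : 0 ≤ B)
    (hd : ∀ x ∈ diagStrip (n - 1 / 2) (n + 1 / 2), DifferentiableAt ℂ F x)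
    (hF : ∀ x ∈ diagStrip (n - 1 / 2) (n + 1 / 2), ‖F x‖ ≤ A * Real.exp (B * ‖x‖)) :
    diagInt (fun x => F x * rsKernel x) (n - 1 / 2) =
      diagInt (fun x => F x * rsKernel x) (n + 1 / 2) + F n := by
  set S := diagStrip ((n : ℝ) - 1 / 2) (n + 1 / 2) with hS
  have hSn : S ∈ 𝓝 (n : ℂ) := by
    have h : Continuous fun x : ℂ => x.re - x.im := by fun_prop
    refine h.continuousAt.preimage_mem_nhds (Icc_mem_nhds ?_ ?_) <;> simp
  have hnS : (n : ℂ) ∈ S := mem_of_mem_nhds hSn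
  have hE0 : ∀ x ∈ S, dslope rsDenom n x ≠ 0 := by
    intro x hx
    rcases eq_or_ne x n with rfl | hne
    · rw [dslope_same]; exact deriv_rsDenom_intCast_ne_zero n
    · rw [dslope_of_ne _ hne, slope_def_field, rsDenom_intCast, sub_zero]
      refine div_ne_zero ?_ (sub_ne_zero.2 hne)
      rw [Ne, rsDenom_eq_zero_iff]
      rintro ⟨m, rfl⟩
      have h1 := hx.1
      have h2 := hx.2
      simp only [intCast_re, intCast_im, sub_zero] at h1 h2
      have h3 : n - 1 < m := by
        have : (n : ℝ) - 1 < m := by linarith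
        exact_mod_cast this
      have h4 : m < n + 1 := by
        have : (m : ℝ) < n + 1 := by linarith
        exact_mod_cast this
      exact hne (by rw [show m = n by omega])
  -- Off the point `n` this is `(F - F n)` times the kernel, written as a quotient of difference
  -- quotients so that the singularity at `n` is already removed. Cauchy's theorem handles `f`; the
  -- constant `F n` is left to `diagInt_rsKernel_sub`.
  set f : ℂ → ℂ := fun x =>
    dslope F n x * Complex.exp (Real.pi * I * x ^ 2) / dslope rsDenom n x with hf
  have hfeq : ∀ x : ℂ, x ≠ n → f x = F x * rsKernel x - F n * rsKernel x := by
    intro x hne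
    simp only [hf, dslope_of_ne _ hne, slope_def_field, rsDenom_intCast, sub_zero, rsKernel]
    rw [div_mul_eq_mul_div, div_div_div_cancel_right₀ (sub_ne_zero.2 hne)]
    ring
  have hcont : ContinuousOn f S := by
    refine ContinuousOn.div (ContinuousOn.mul ?_ (by fun_prop)) ?_ hE0
    · exact (continuousOn_dslope hSn).2
        ⟨fun x hx => (hd x hx).continuousAt.continuousWithinAt, hd n hnS⟩
    · exact (continuousOn_dslope hSn).2
        ⟨differentiable_rsDenom.continuous.continuousOn, differentiable_rsDenom n⟩
  have hdiff : ∀ x ∈ S, x ∉ ({(n : ℂ)} : Set ℂ) → DifferentiableAt ℂ f x := by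
    intro x hx hne
    have hne' : x ≠ n := by simpa using hne
    refine DifferentiableAt.div (DifferentiableAt.mul ?_ (by fun_prop)) ?_ (hE0 x hx)
    · exact (differentiableAt_dslope_of_ne hne').2 (hd x hx)
    · exact (differentiableAt_dslope_of_ne hne').2 (differentiable_rsDenom x)
  obtain ⟨C, M, hdec⟩ := exists_decay_mul_rsKernel (F := fun x => F x - F n)
    (a := (n : ℝ) - 1 / 2) (b := n + 1 / 2) (A := A + ‖F n‖) (B := B) (by positivity) hB
    (M := 0) (fun x hx _ => by
      have h1 : 1 ≤ Real.exp (B * ‖x‖) := Real.one_le_exp (by positivity)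
      calc ‖F x - F n‖ ≤ ‖F x‖ + ‖F n‖ := norm_sub_le _ _
        _ ≤ A * Real.exp (B * ‖x‖) + ‖F n‖ * Real.exp (B * ‖x‖) := by
            gcongr
            · exact hF x hx
            · exact le_mul_of_one_le_right (norm_nonneg _) h1
        _ = _ := by ring)
  have hmain := diagInt_eq_of_differentiable (f := f) (by linarith)
    (countable_singleton (n : ℂ)) hcont hdiff (C := C) (M := max M (‖(n : ℂ)‖ + 1))
    (fun x hx hM => by
      have hne : x ≠ n := by
        rintro rfl
        have := (le_max_right _ _).trans hM
        linarith
      rw [hfeq x hne, ← sub_mul]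
      exact hdec x hx ((le_max_left _ _).trans hM))
  have hsplit : ∀ (c : ℝ) (m : ℤ), (m : ℝ) < c → c < m + 1 → diagStrip c c ⊆ S →
      diagInt f c = diagInt (fun x => F x * rsKernel x) c - F n * diagInt rsKernel c := by
    intro c m hm hm' hcS
    rw [← diagInt_const_mul, ← diagInt_sub]
    · refine diagInt_congr fun x hx => hfeq x ?_
      rintro rfl
      exact rsDenom_ne_zero_of_mem hm hm' hx (rsDenom_intCast n)
    · exact integrable_mul_rsKernel hm hm' hA hB
        (fun x hx => (hd x (hcS hx)).continuousAt.continuousWithinAt) fun x hx => hF x (hcS hx)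
    · refine Integrable.const_mul ?_ _
      simpa using integrable_exp_mul_rsKernel 0 hm hm'
  rw [hsplit _ (n - 1) (by push_cast; linarith) (by push_cast; linarith)
      fun x hx => ⟨hx.1, by linarith [hx.2]⟩,
    hsplit _ n (by linarith) (by linarith) fun x hx => ⟨by linarith [hx.1], hx.2⟩] at hmain
  have hk := diagInt_rsKernel_sub (c := (n : ℝ) - 1 / 2) (n := n - 1) (by push_cast; linarith)
    (by push_cast; linarith)
  rw [show (n : ℝ) - 1 / 2 + 1 = n + 1 / 2 by ring] at hk
  linear_combination hmain + F n * hk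

/-- **Mordell's integral** in closed form. -/
theorem mordell_integral (a : ℂ) :
    diagInt (fun x => Complex.exp (2 * Real.pi * I * a * x) * rsKernel x) (1 / 2) *
      (Complex.exp (-(2 * Real.pi * I * a)) - 1) =
      1 - Complex.exp (-(Real.pi * I * (a ^ 2 + a))) := by
  have h1 := diagInt_exp_rsKernel_add_one a (c := 1 / 2) (n := 0) (by norm_num) (by norm_num)
  have h2 := diagInt_mul_rsKernel_shift (F := fun x => Complex.exp (2 * Real.pi * I * a * x))
    (n := 1) (A := 1) (B := ‖2 * Real.pi * I * a‖) zero_le_one (norm_nonneg _)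
    (fun x _ => by fun_prop) (fun x _ => by
      rw [one_mul]
      exact (Complex.norm_exp_le_exp_norm _).trans (by rw [norm_mul]))
  rw [show ((1 : ℤ) : ℝ) - 1 / 2 = 1 / 2 by norm_num,
    show ((1 : ℤ) : ℝ) + 1 / 2 = 1 / 2 + 1 by norm_num, diagInt_add_one] at h2
  -- Crossing the integer `1` is thus a second linear relation between the integrals with parameters
  -- `a` and `a + 1`; eliminating the latter leaves the closed form.
  have h3 : diagInt (fun x => Complex.exp (2 * Real.pi * I * a * (x + 1)) * rsKernel (x + 1))
      (1 / 2) = Complex.exp (2 * Real.pi * I * a) *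
      diagInt (fun x => Complex.exp (2 * Real.pi * I * (a + 1) * x) * rsKernel x) (1 / 2) := by
    rw [← diagInt_const_mul]
    refine diagInt_congr fun x _ => ?_
    rw [rsKernel_add_one, ← mul_assoc, ← mul_assoc, ← Complex.exp_add, ← Complex.exp_add]
    congr 2
    ring
  rw [h3] at h2
  have h4 : Complex.exp (2 * Real.pi * I * a) * Complex.exp (-(2 * Real.pi * I * a)) = 1 := by
    rw [← Complex.exp_add, add_neg_cancel, Complex.exp_zero]
  simp only [Int.cast_one, mul_one] at h2
  set H := diagInt (fun x => Complex.exp (2 * Real.pi * I * a * x) * rsKernel x) (1 / 2)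
  set H' := diagInt (fun x => Complex.exp (2 * Real.pi * I * (a + 1) * x) * rsKernel x) (1 / 2)
  linear_combination Complex.exp (-(2 * Real.pi * I * a)) * h2 + (H' + 1) * h4 + h1

/-! ### Holomorphic dependence on a parameter -/

/-- An integral of holomorphic functions that is locally dominated is holomorphic. -/
theorem differentiableAt_integral_of_norm_le {α : Type*} [MeasurableSpace α] {μ : Measure α}
    {F : ℂ → α → ℂ} {z₀ : ℂ} {r : ℝ} (hr : 0 < r) {bound : α → ℝ}
    (hm : ∀ z ∈ Metric.ball z₀ r, AEStronglyMeasurable (F z) μ)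
    (hd : ∀ a, DifferentiableOn ℂ (F · a) (Metric.ball z₀ r))
    (hb : ∀ᵐ a ∂μ, ∀ z ∈ Metric.ball z₀ r, ‖F z a‖ ≤ bound a) (hbi : Integrable bound μ) :
    DifferentiableAt ℂ (fun z => ∫ a, F z a ∂μ) z₀ := by
  have hz₀ : z₀ ∈ Metric.ball z₀ r := Metric.mem_ball_self hr
  have hdz : ∀ a, ∀ z ∈ Metric.ball z₀ r, HasDerivAt (F · a) (deriv (F · a) z) z :=
    fun a z hz => ((hd a).differentiableAt (Metric.isOpen_ball.mem_nhds hz)).hasDerivAt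
  -- The derivative is a pointwise limit of difference quotients along a sequence of steps inside
  -- the ball, each of them measurable.
  have hmeas : AEStronglyMeasurable (fun a => deriv (F · a) z₀) μ := by
    set h : ℕ → ℂ := fun n => ((r / 2 / ((n : ℝ) + 1) : ℝ) : ℂ) with hh
    have hpos : ∀ n : ℕ, 0 < r / 2 / ((n : ℝ) + 1) := fun n => by positivity
    have hh0 : Tendsto h atTop (𝓝[≠] 0) := by
      refine tendsto_nhdsWithin_iff.2 ⟨?_, Eventually.of_forall fun n => ?_⟩
      · have : Tendsto (fun n : ℕ => r / 2 / ((n : ℝ) + 1)) atTop (𝓝 0) :=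
          tendsto_const_nhds.div_atTop
            (tendsto_natCast_atTop_atTop.atTop_add tendsto_const_nhds)
        simpa only [hh, ofReal_zero, Function.comp_def] using (continuous_ofReal.tendsto 0).comp this
      · exact ofReal_ne_zero.2 (hpos n).ne'
    refine aestronglyMeasurable_of_tendsto_ae (u := atTop)
      (f := fun n a => (h n)⁻¹ • (F (z₀ + h n) a - F z₀ a)) (fun n => ?_)
      (Eventually.of_forall fun a => ?_)
    · refine AEStronglyMeasurable.const_smul
        (f := fun a => F (z₀ + h n) a - F z₀ a) ((hm _ ?_).sub (hm _ hz₀)) ((h n)⁻¹)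
      rw [Metric.mem_ball, dist_self_add_left, hh, norm_real, Real.norm_of_nonneg (hpos n).le]
      calc r / 2 / ((n : ℝ) + 1) ≤ r / 2 := div_le_self (by positivity) (by simp)
        _ < r := by linarith
    · exact (hasDerivAt_iff_tendsto_slope_zero.1 (hdz a z₀ hz₀)).comp hh0
  refine (hasDerivAt_integral_of_dominated_loc_of_deriv_le (F' := fun z a => deriv (F · a) z)
    (bound := fun a => bound a / (r / 2)) (Metric.ball_mem_nhds z₀ (half_pos hr))
    ?_ ?_ hmeas ?_ (hbi.div_const _) ?_).2.differentiableAt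
  · filter_upwards [Metric.ball_mem_nhds z₀ hr] with z hz using hm z hz
  · exact hbi.mono' (hm _ hz₀) (hb.mono fun a ha => ha _ hz₀)
  -- Cauchy's estimate on circles of radius `r / 2` bounds the derivative, so domination of `F`
  -- alone suffices.
  · filter_upwards [hb] with a ha z hz
    have hsub : ∀ w ∈ Metric.closedBall z (r / 2), w ∈ Metric.ball z₀ r := by
      intro w hw
      rw [Metric.mem_ball] at hz ⊢
      rw [Metric.mem_closedBall] at hw
      linarith [dist_triangle w z z₀]
    refine norm_deriv_le_of_forall_mem_sphere_norm_le (half_pos hr) ?_ fun w hw =>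
      ha w (hsub w (Metric.sphere_subset_closedBall hw))
    refine DifferentiableOn.diffContOnCl ?_
    rw [closure_ball _ (half_pos hr).ne']
    exact (hd a).mono hsub
  · exact Eventually.of_forall fun a z hz =>
      hdz a z (Metric.ball_subset_ball (by linarith) hz)

theorem integrableOn_cpow_mul_exp_neg {a : ℂ} {r : ℝ} (ha : 0 < a.re) (hr : 0 < r) :
    IntegrableOn (fun t : ℝ => (t : ℂ) ^ (a - 1) * Complex.exp (-(r * t))) (Ioi 0) := by
  have h := Complex.GammaIntegral_convergent ha
  rw [← mul_zero r, ← integrableOn_Ioi_comp_mul_left_iff _ _ hr] at h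
  refine IntegrableOn.congr_fun (h.const_mul (1 / (r : ℂ) ^ (a - 1))) (fun t ht => ?_)
    measurableSet_Ioi
  have ht' : (0 : ℝ) < t := ht
  have hne : (r : ℂ) ^ (a - 1) ≠ 0 := by
    rw [Ne, cpow_eq_zero_iff, not_and_or]
    exact Or.inl (ofReal_ne_zero.2 hr.ne')
  change 1 / (r : ℂ) ^ (a - 1) * (((Real.exp (-(r * t)) : ℝ) : ℂ) * ((r * t : ℝ) : ℂ) ^ (a - 1)) = _
  rw [ofReal_mul, mul_cpow_ofReal_nonneg hr.le ht'.le]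
  push_cast
  field_simp

theorem cpow_inv_eq_neg {r : ℂ} (hr : 0 < r.re) (a : ℂ) : (1 / r) ^ a = r ^ (-a) := by
  rw [one_div, inv_cpow, cpow_neg]
  intro h
  have := abs_arg_lt_pi_div_two_iff.2 (Or.inl hr)
  rw [h, abs_of_pos Real.pi_pos] at this
  linarith [Real.pi_pos]

/-- Euler's integral with a complex rate. -/
theorem integral_cpow_mul_exp_neg_complex_mul {a r : ℂ} (ha : 0 < a.re) (hr : 0 < r.re) :
    ∫ t : ℝ in Ioi 0, (t : ℂ) ^ (a - 1) * Complex.exp (-(r * t)) = r ^ (-a) * Gamma a := by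
  set U : Set ℂ := {z | 0 < z.re} with hU
  have hUo : IsOpen U := isOpen_lt continuous_const continuous_re
  have hUc : IsPreconnected U := (convex_halfSpace_re_gt 0).isPreconnected
  have hf : DifferentiableOn ℂ (fun r : ℂ =>
      ∫ t : ℝ in Ioi 0, (t : ℂ) ^ (a - 1) * Complex.exp (-(r * t))) U := by
    intro z hz
    have hz' : 0 < z.re := hz
    refine (differentiableAt_integral_of_norm_le (r := z.re / 2) (half_pos hz')
      (bound := fun t : ℝ => ‖(t : ℂ) ^ (a - 1) * Complex.exp (-((z.re / 2 : ℝ) * t))‖)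
      (fun w _ => ?_) (fun t => ?_) ?_ ?_).differentiableWithinAt
    · refine AEStronglyMeasurable.mul ?_ (Continuous.aestronglyMeasurable (by fun_prop))
      refine ContinuousOn.aestronglyMeasurable (fun t ht => ?_) measurableSet_Ioi
      exact (continuousAt_ofReal_cpow_const t _ (Or.inr (ne_of_gt ht))).continuousWithinAt
    · fun_prop
    · rw [ae_restrict_iff' measurableSet_Ioi]
      refine Eventually.of_forall fun t ht w hw => ?_
      have ht' : (0 : ℝ) < t := ht
      rw [norm_mul, norm_mul, Complex.norm_exp, Complex.norm_exp]
      refine mul_le_mul_of_nonneg_left (Real.exp_le_exp.2 ?_) (norm_nonneg _)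
      rw [neg_re, neg_re, re_mul_ofReal, re_mul_ofReal, ofReal_re]
      rw [Metric.mem_ball, dist_eq_norm] at hw
      have h1 := (abs_re_le_norm (w - z)).trans hw.le
      rw [sub_re, abs_le] at h1
      nlinarith
    · exact (integrableOn_cpow_mul_exp_neg ha (half_pos hz')).norm
  have hg : DifferentiableOn ℂ (fun r : ℂ => r ^ (-a) * Gamma a) U := by
    intro z hz
    have hz' : z ∈ slitPlane := Or.inl hz
    exact (((differentiableAt_id).cpow_const hz').mul_const _).differentiableWithinAt
  -- For real rates the formula is the classical one. The points `1 + 1/(n+1)` accumulate at `1`, so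
  -- the identity theorem extends it to the right half-plane.
  have hfreq : ∃ᶠ z in 𝓝[≠] (1 : ℂ),
      (∫ t : ℝ in Ioi 0, (t : ℂ) ^ (a - 1) * Complex.exp (-(z * t))) = z ^ (-a) * Gamma a := by
    set h : ℕ → ℂ := fun n => ((1 + 1 / ((n : ℝ) + 1) : ℝ) : ℂ) with hh
    have hlim : Tendsto h atTop (𝓝[≠] 1) := by
      refine tendsto_nhdsWithin_iff.2 ⟨?_, Eventually.of_forall fun n => ?_⟩
      · have : Tendsto (fun n : ℕ => 1 + 1 / ((n : ℝ) + 1)) atTop (𝓝 (1 + 0)) :=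
          tendsto_one_div_add_atTop_nhds_zero_nat.const_add 1
        rw [add_zero] at this
        simpa only [hh, ofReal_one, Function.comp_def] using (continuous_ofReal.tendsto 1).comp this
      · have : (0 : ℝ) < 1 / ((n : ℝ) + 1) := by positivity
        simp only [mem_compl_iff, mem_singleton_iff, hh]
        rw [← ofReal_one, ofReal_inj]
        linarith
    refine hlim.frequently (Eventually.frequently (Eventually.of_forall fun n => ?_))
    have hpos : (0 : ℝ) < 1 + 1 / ((n : ℝ) + 1) := by positivity
    rw [hh]
    rw [integral_cpow_mul_exp_neg_mul_Ioi ha hpos, cpow_inv_eq_neg (by rw [ofReal_re]; exact hpos)]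
  exact (hf.analyticOnNhd hUo).eqOn_of_preconnected_of_frequently_eq (hg.analyticOnNhd hUo) hUc
    (show (1 : ℂ) ∈ U by simp [hU]) hfreq hr

/-! ### Powers on the strips -/

/-- The `8` is `4` for `-log ‖x‖`, using the distance `1/4` from the origin, plus `4 ≥ π` for the
argument. Such a crude bound is enough, since the kernel beats every exponential. -/
theorem norm_cpow_le_exp {x : ℂ} (hx : 1 / 4 ≤ ‖x‖) (w : ℂ) :
    ‖x ^ w‖ ≤ Real.exp (‖w‖ * (‖x‖ + 8)) := by
  have hx0 : x ≠ 0 := by rintro rfl; norm_num at hx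
  have hpos : 0 < ‖x‖ := norm_pos_iff.2 hx0
  rw [cpow_def_of_ne_zero hx0]
  refine (Complex.norm_exp_le_exp_norm _).trans (Real.exp_le_exp.2 ?_)
  rw [norm_mul, mul_comm]
  gcongr
  have h1 : ‖Complex.log x‖ ≤ |Real.log ‖x‖| + |x.arg| := by
    have := Complex.norm_le_abs_re_add_abs_im (Complex.log x)
    rwa [log_re, log_im] at this
  have h2 : |x.arg| ≤ 4 := (abs_arg_le_pi x).trans Real.pi_le_four
  have h3 : |Real.log ‖x‖| ≤ ‖x‖ + 4 := by
    rw [abs_le]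
    constructor
    · have : Real.log (‖x‖⁻¹) ≤ ‖x‖⁻¹ - 1 := Real.log_le_sub_one_of_pos (by positivity)
      rw [Real.log_inv] at this
      have h4 : ‖x‖⁻¹ ≤ 4 := by
        rw [inv_le_comm₀ hpos (by norm_num)]; linarith
      linarith
    · linarith [Real.log_le_sub_one_of_pos hpos]
  linarith

theorem mem_slitPlane_of_diag {x : ℂ} (hx : 0 < x.re - x.im) : x ∈ slitPlane := by
  rw [mem_slitPlane_iff]
  by_cases h : x.im = 0
  · left; linarith
  · exact Or.inr h

theorem norm_ge_of_diag {x : ℂ} (hx : 1 / 2 ≤ x.re - x.im) : 1 / 4 ≤ ‖x‖ := by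
  have h1 := abs_re_le_norm x
  have h2 := abs_im_le_norm x
  linarith [le_abs_self x.re, neg_abs_le x.im]

/-- Each integer crossed by the line contributes its residue `n^(-s)`. With `N` near `√(t/2π)` the
finite sum is the Riemann-Siegel main sum and the integral is small. -/
theorem rsR_eq_sum_add_diagInt (s : ℂ) (N : ℕ) :
    rsR s = ∑ n ∈ Finset.range N, ((n + 1 : ℕ) : ℂ) ^ (-s) +
      diagInt (fun x => x ^ (-s) * rsKernel x) (N + 1 / 2) := by
  induction N with
  | zero => simp [rsR_eq_diagInt]
  | succ N ih =>
    have hlow : ∀ x ∈ diagStrip (((N + 1 : ℕ) : ℤ) - 1 / 2) (((N + 1 : ℕ) : ℤ) + 1 / 2),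
        1 / 2 ≤ x.re - x.im := by
      intro x hx
      have := hx.1
      push_cast at this
      have : (0 : ℝ) ≤ N := Nat.cast_nonneg N
      linarith
    have h := diagInt_mul_rsKernel_shift (F := fun x => x ^ (-s)) (n := ((N + 1 : ℕ) : ℤ))
      (A := Real.exp (‖s‖ * 8)) (B := ‖s‖) (Real.exp_pos _).le (norm_nonneg _)
      (fun x hx => differentiableAt_id.cpow_const
        (mem_slitPlane_of_diag (lt_of_lt_of_le one_half_pos (hlow x hx))))
      (fun x hx => by
        refine (norm_cpow_le_exp (norm_ge_of_diag (hlow x hx)) _).trans_eq ?_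
        rw [← Real.exp_add, norm_neg]
        ring_nf)
    rw [ih, Finset.sum_range_succ]
    have e1 : (((N + 1 : ℕ) : ℤ) : ℝ) - 1 / 2 = N + 1 / 2 := by push_cast; ring
    have e2 : (((N + 1 : ℕ) : ℤ) : ℝ) + 1 / 2 = ((N + 1 : ℕ) : ℝ) + 1 / 2 := by push_cast; ring
    rw [e1, e2] at h
    rw [h]
    push_cast
    ring

theorem differentiable_rsR : Differentiable ℂ rsR := by
  intro s₀
  have hS : ∀ u : ℝ, (1 / 2 : ℝ) ≤ (((1 / 2 : ℝ) : ℂ) - diagDir * u).re -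
      (((1 / 2 : ℝ) : ℂ) - diagDir * u).im := fun u =>
    (diagPoint_mem (a := 1 / 2) (b := 1 / 2) ⟨le_rfl, le_rfl⟩ u).1
  have hfun : rsR = fun s => ∫ u : ℝ, (((1 / 2 : ℝ) : ℂ) - diagDir * u) ^ (-s) *
      rsKernel (((1 / 2 : ℝ) : ℂ) - diagDir * u) * (-diagDir) := by
    ext s
    rw [rsR_eq_diagInt, diagInt]
  rw [hfun]
  -- `B` bounds `‖s‖` on the unit ball about `s₀`, which gives a majorant independent of `s`.
  set B : ℝ := ‖s₀‖ + 1 with hB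
  have hint := integrable_mul_rsKernel (F := fun x => ((Real.exp (B * (‖x‖ + 8)) : ℝ) : ℂ))
    (c := 1 / 2) (n := 0) (A := Real.exp (B * 8)) (B := B) (by norm_num) (by norm_num)
    (Real.exp_pos _).le (by positivity) (by fun_prop) (fun x _ => by
      rw [norm_real, Real.norm_of_nonneg (Real.exp_pos _).le, ← Real.exp_add]
      ring_nf
      exact le_rfl)
  refine differentiableAt_integral_of_norm_le zero_lt_one
    (bound := fun u : ℝ => ‖((Real.exp (B * (‖((1 / 2 : ℝ) : ℂ) - diagDir * u‖ + 8)) : ℝ) : ℂ) *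
      rsKernel (((1 / 2 : ℝ) : ℂ) - diagDir * u)‖) (fun s _ => ?_) (fun u => ?_) ?_ hint.norm
  · refine Continuous.aestronglyMeasurable ?_
    refine Continuous.mul (Continuous.mul ?_ ?_) continuous_const
    · rw [continuous_iff_continuousAt]
      intro u
      exact ContinuousAt.cpow (continuous_diagPoint _).continuousAt continuousAt_const
        (mem_slitPlane_of_diag (by linarith [hS u]))
    · rw [continuous_iff_continuousAt]
      intro u
      refine ContinuousAt.comp (g := rsKernel) (differentiableAt_rsKernel
        (rsDenom_ne_zero_of_mem (n := 0) (a := 1 / 2) (b := 1 / 2) (by norm_num) (by norm_num)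
        (diagPoint_mem ⟨le_rfl, le_rfl⟩ u))).continuousAt (continuous_diagPoint _).continuousAt
  · have hx0 : ((1 / 2 : ℝ) : ℂ) - diagDir * u ≠ 0 :=
      slitPlane_ne_zero (mem_slitPlane_of_diag (by linarith [hS u]))
    refine Differentiable.differentiableOn ?_
    refine Differentiable.mul_const (Differentiable.mul_const ?_ _) _
    intro s
    exact (differentiableAt_id.neg).const_cpow (Or.inl hx0)
  · refine Eventually.of_forall fun u s hs => ?_
    rw [norm_mul, norm_neg, norm_diagDir, mul_one, norm_mul, norm_mul]
    gcongr
    refine (norm_cpow_le_exp (norm_ge_of_diag (hS u)) _).trans ?_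
    rw [norm_real, Real.norm_of_nonneg (Real.exp_pos _).le, norm_neg]
    gcongr
    rw [mem_ball_iff_norm] at hs
    linarith [norm_sub_norm_le s s₀]

/-! ### Mellin transform of Mordell's integral -/

theorem log_diagDir : Complex.log diagDir = Real.pi * I / 4 := by
  rw [diagDir, Complex.log_exp] <;> simp <;> linarith [Real.pi_pos]

theorem diagDir_cpow (w : ℂ) : diagDir ^ w = Complex.exp (Real.pi * I / 4 * w) := by
  rw [cpow_def_of_ne_zero diagDir_ne_zero, log_diagDir]

theorem arg_diagDir : diagDir.arg = Real.pi / 4 := by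
  rw [← log_im, log_diagDir]; simp

theorem log_neg_diagDir : Complex.log (-diagDir) = -(3 * Real.pi * I / 4) := by
  have : -diagDir = Complex.exp (-(3 * Real.pi * I / 4)) := by
    rw [diagDir, ← neg_one_mul, ← Complex.exp_neg_pi_mul_I, ← Complex.exp_add]
    congr 1; ring
  rw [this, Complex.log_exp] <;> simp <;> linarith [Real.pi_pos]

theorem ofReal_mul_cpow {r : ℝ} (hr : 0 < r) {z : ℂ} (hz : z ≠ 0) (w : ℂ) :
    ((r : ℂ) * z) ^ w = (r : ℂ) ^ w * z ^ w := by
  have hr' : (r : ℂ) ≠ 0 := ofReal_ne_zero.2 hr.ne'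
  rw [cpow_def_of_ne_zero (mul_ne_zero hr' hz), cpow_def_of_ne_zero hr', cpow_def_of_ne_zero hz,
    log_ofReal_mul hr hz, ← Complex.exp_add, add_mul, ofReal_log hr.le]

theorem arg_le_of_diag {x : ℂ} (hx : 0 < x.re - x.im) : x.arg ≤ Real.pi / 2 := by
  rw [arg_le_pi_div_two_iff]
  by_cases h : x.im < 0
  · exact Or.inr h
  · left; push Not at h; linarith

/-- In this half-plane `arg x` lies in `(-π, π/2]`, so adding `π/4` does not cross the branch cut.
-/
theorem diagDir_mul_cpow {x : ℂ} (hx : 0 < x.re - x.im) (w : ℂ) :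
    (diagDir * x) ^ w = diagDir ^ w * x ^ w := by
  have hx0 : x ≠ 0 := slitPlane_ne_zero (mem_slitPlane_of_diag hx)
  have h : Complex.log (diagDir * x) = Complex.log diagDir + Complex.log x := by
    rw [Complex.log_mul_eq_add_log_iff diagDir_ne_zero hx0, arg_diagDir]
    have := arg_le_of_diag hx
    have := neg_pi_lt_arg x
    constructor <;> linarith [Real.pi_pos]
  rw [cpow_def_of_ne_zero (mul_ne_zero diagDir_ne_zero hx0), h, add_mul, Complex.exp_add,
    ← cpow_def_of_ne_zero diagDir_ne_zero, ← cpow_def_of_ne_zero hx0]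

/-- Multiplication by `diagDir` makes the line vertical. This is why Mordell's parameter is taken
along the ray of direction `diagDir`: `e^(-diagDir ρ x)` then decays in `ρ` uniformly on the whole
line. -/
theorem diagDir_mul_diagPoint_re (c u : ℝ) : (diagDir * ((c : ℂ) - diagDir * u)).re = √2 / 2 * c := by
  rw [mul_re, diagPoint_re, diagPoint_im, diagDir_re, diagDir_im]
  ring

theorem mellin_mordell_integrable {s : ℂ} (hs : 0 < s.re) :
    Integrable (fun p : ℝ × ℝ => (p.1 : ℂ) ^ (s - 1) *
      (Complex.exp (-(diagDir * p.1) * (((1 / 2 : ℝ) : ℂ) - diagDir * p.2)) *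
        rsKernel (((1 / 2 : ℝ) : ℂ) - diagDir * p.2) * (-diagDir)))
      ((volume.restrict (Ioi 0)).prod volume) := by
  have h1 : Integrable (fun t : ℝ => (t : ℂ) ^ (s - 1) * Complex.exp (-((√2 / 4 : ℝ) * t)))
      (volume.restrict (Ioi 0)) := integrableOn_cpow_mul_exp_neg hs (by positivity)
  have h2 : Integrable fun u : ℝ => rsKernel (((1 / 2 : ℝ) : ℂ) - diagDir * u) * (-diagDir) := by
    refine Integrable.mul_const ?_ _
    simpa using integrable_exp_mul_rsKernel 0 (c := 1 / 2) (n := 0) (by norm_num) (by norm_num)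
  have h3 := h1.mul_prod h2
  -- Pulling out the decay `e^(-√2ρ/4)` leaves a factor of modulus one times a product of two
  -- one-variable integrable functions.
  refine (h3.bdd_mul (f := fun p : ℝ × ℝ => Complex.exp (-(diagDir * p.1) *
    (((1 / 2 : ℝ) : ℂ) - diagDir * p.2) + (√2 / 4 : ℝ) * p.1)) (c := 1)
    (Continuous.aestronglyMeasurable (by fun_prop)) (Eventually.of_forall fun p => ?_)).congr
    (Eventually.of_forall fun p => ?_)
  · rw [Complex.norm_exp, Real.exp_le_one_iff]
    have : (-(diagDir * p.1) * (((1 / 2 : ℝ) : ℂ) - diagDir * p.2)).re = -(√2 / 4 * p.1) := by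
      rw [show -(diagDir * (p.1 : ℂ)) * (((1 / 2 : ℝ) : ℂ) - diagDir * p.2) =
        ((-p.1 : ℝ) : ℂ) * (diagDir * (((1 / 2 : ℝ) : ℂ) - diagDir * p.2)) by push_cast; ring,
        re_ofReal_mul, diagDir_mul_diagPoint_re]
      ring
    rw [add_re, this, re_ofReal_mul, ofReal_re]
    linarith
  · simp only []
    rw [Complex.exp_add, Complex.exp_neg]
    have := Complex.exp_ne_zero (((√2 / 4 : ℝ) : ℂ) * p.1)
    field_simp

/-- The Mordell integral along the ray of parameters `e ^ (π i / 4) ρ`. -/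
noncomputable def mordellRay (ρ : ℝ) : ℂ :=
  diagInt (fun x => Complex.exp (-(diagDir * ρ) * x) * rsKernel x) (1 / 2)

theorem integrableOn_cpow_mul_mordellRay {s : ℂ} (hs : 0 < s.re) :
    IntegrableOn (fun ρ : ℝ => (ρ : ℂ) ^ (s - 1) * mordellRay ρ) (Ioi 0) := by
  refine (mellin_mordell_integrable hs).integral_prod_left.congr (Eventually.of_forall fun ρ => ?_)
  simp only [mordellRay, diagInt]
  rw [integral_const_mul]

/-- After Fubini the inner integral is Euler's integral with rate `diagDir * x`, which produces the
power `x^(-s)` of the definition of `ℛ`. -/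
theorem integral_cpow_mul_mordellRay {s : ℂ} (hs : 0 < s.re) :
    ∫ ρ in Ioi (0 : ℝ), (ρ : ℂ) ^ (s - 1) * mordellRay ρ = Gamma s * diagDir ^ (-s) * rsR s := by
  have h1 : ∫ ρ in Ioi (0 : ℝ), (ρ : ℂ) ^ (s - 1) * mordellRay ρ =
      ∫ ρ in Ioi (0 : ℝ), ∫ u : ℝ, (ρ : ℂ) ^ (s - 1) *
      (Complex.exp (-(diagDir * ρ) * (((1 / 2 : ℝ) : ℂ) - diagDir * u)) *
        rsKernel (((1 / 2 : ℝ) : ℂ) - diagDir * u) * (-diagDir)) := by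
    congr 1
    ext ρ
    simp only [mordellRay, diagInt]
    rw [integral_const_mul]
  rw [h1, integral_integral_swap (mellin_mordell_integrable hs), rsR_eq_diagInt, diagInt,
    ← integral_const_mul]
  congr 1
  ext u
  set x : ℂ := ((1 / 2 : ℝ) : ℂ) - diagDir * u with hx
  have hxd : 0 < x.re - x.im := by
    have := (diagPoint_mem (a := 1 / 2) (b := 1 / 2) ⟨le_rfl, le_rfl⟩ u).1
    rw [← hx] at this
    linarith
  have hre : 0 < (diagDir * x).re := by
    rw [hx, diagDir_mul_diagPoint_re]; positivity
  have h2 : ∀ ρ : ℝ, (ρ : ℂ) ^ (s - 1) *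
      (Complex.exp (-(diagDir * ρ) * x) * rsKernel x * (-diagDir)) =
      ((ρ : ℂ) ^ (s - 1) * Complex.exp (-((diagDir * x) * ρ))) * (rsKernel x * (-diagDir)) := by
    intro ρ
    rw [show -(diagDir * (ρ : ℂ)) * x = -((diagDir * x) * ρ) by ring]
    ring
  simp_rw [h2]
  rw [integral_mul_const, integral_cpow_mul_exp_neg_complex_mul hs hre, diagDir_mul_cpow hxd]
  ring

theorem norm_exp_diagDir_mul (ρ : ℝ) : ‖Complex.exp (diagDir * ρ)‖ = Real.exp (√2 / 2 * ρ) := by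
  rw [Complex.norm_exp, re_mul_ofReal, diagDir_re]

theorem exp_diagDir_mul_ne_one {ρ : ℝ} (hρ : 0 < ρ) : Complex.exp (diagDir * ρ) ≠ 1 := by
  intro h
  have h1 := norm_exp_diagDir_mul ρ
  rw [h, norm_one] at h1
  have : 1 < Real.exp (√2 / 2 * ρ) := Real.one_lt_exp_iff.2 (by positivity)
  linarith

/-- The Gaussian part of the Mordell integral along a ray. -/
noncomputable def rayGauss (ρ : ℝ) : ℂ :=
  Complex.exp (-(ρ ^ 2 / (4 * Real.pi))) /
    (Complex.exp (diagDir * ρ / 2) - Complex.exp (-(diagDir * ρ / 2)))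

/-- Mordell's closed form at `a = iωρ/(2π)`, chosen so that `2πia = -ωρ`. The first term has a zeta
function as Mellin transform; the second leads to the dual value of `ℛ`. -/
theorem mordellRay_eq {ρ : ℝ} (hρ : 0 < ρ) :
    mordellRay ρ = 1 / (Complex.exp (diagDir * ρ) - 1) - rayGauss ρ := by
  have hpi : (Real.pi : ℂ) ≠ 0 := ofReal_ne_zero.2 Real.pi_ne_zero
  have hne : Complex.exp (diagDir * ρ) - 1 ≠ 0 := sub_ne_zero.2 (exp_diagDir_mul_ne_one hρ)
  have h := mordell_integral (I * diagDir * ρ / (2 * Real.pi))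
  have e1 : 2 * Real.pi * I * (I * diagDir * ρ / (2 * Real.pi)) = -(diagDir * ρ) := by
    field_simp
    rw [I_sq]
    ring
  have e2 : -(Real.pi * I * ((I * diagDir * ρ / (2 * Real.pi)) ^ 2 +
      I * diagDir * ρ / (2 * Real.pi))) = diagDir * ρ / 2 + -(ρ ^ 2 / (4 * Real.pi)) := by
    have : diagDir ^ 2 = I := diagDir_sq
    field_simp
    linear_combination (-4 * (ρ : ℂ) ^ 2 * I ^ 3) * this +
      (-4 * (ρ : ℂ) ^ 2 * (I ^ 2 - 1) - 8 * Real.pi * diagDir * ρ) * I_sq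
  rw [e1, neg_neg, e2, Complex.exp_add] at h
  have h' : mordellRay ρ * (Complex.exp (diagDir * ρ) - 1) =
      1 - Complex.exp (diagDir * ρ / 2) * Complex.exp (-(ρ ^ 2 / (4 * Real.pi))) := h
  have e3 : Complex.exp (diagDir * ρ) - 1 = Complex.exp (diagDir * ρ / 2) *
      (Complex.exp (diagDir * ρ / 2) - Complex.exp (-(diagDir * ρ / 2))) := by
    rw [mul_sub, ← Complex.exp_add, ← Complex.exp_add, add_neg_cancel, Complex.exp_zero, add_halves]
  rw [eq_div_of_mul_eq hne h', sub_div, rayGauss]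
  congr 1
  rw [e3, mul_div_mul_left _ _ (Complex.exp_ne_zero _)]

/-- Expand in powers of `e^(-diagDir ρ)` and integrate termwise. Rotating the ray costs only the
factor `diagDir^(-s)`, and `Re s > 1` makes the sum of the absolute integrals converge. -/
theorem integral_cpow_div_exp_sub_one {s : ℂ} (hs : 1 < s.re) :
    ∫ ρ in Ioi (0 : ℝ), (ρ : ℂ) ^ (s - 1) * (1 / (Complex.exp (diagDir * ρ) - 1)) =
      Gamma s * diagDir ^ (-s) * riemannZeta s := by
  have hs0 : 0 < s.re := by linarith
  set F : ℕ → ℝ → ℂ := fun n ρ =>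
    (ρ : ℂ) ^ (s - 1) * Complex.exp (-((((n + 1 : ℝ) : ℂ) * diagDir) * ρ)) with hF
  have hre : ∀ n : ℕ, ((((n + 1 : ℝ) : ℂ) * diagDir)).re = (n + 1 : ℝ) * (√2 / 2) := by
    intro n; rw [re_ofReal_mul, diagDir_re]
  have hpos : ∀ n : ℕ, 0 < (n + 1 : ℝ) * (√2 / 2) := fun n => by positivity
  have hnorm : ∀ (n : ℕ) (ρ : ℝ), 0 < ρ →
      ‖F n ρ‖ = ρ ^ (s.re - 1) * Real.exp (-((n + 1 : ℝ) * (√2 / 2) * ρ)) := by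
    intro n ρ hρ
    rw [hF]
    simp only
    rw [norm_mul, norm_cpow_eq_rpow_re_of_pos hρ, Complex.norm_exp, neg_re, re_mul_ofReal, hre,
      sub_re, one_re]
  have hFi : ∀ n, Integrable (F n) (volume.restrict (Ioi 0)) := by
    intro n
    refine Integrable.mono (integrableOn_cpow_mul_exp_neg hs0 (hpos n)) ?_ ?_
    · refine ContinuousOn.aestronglyMeasurable (fun t ht => ?_) measurableSet_Ioi
      exact ((continuousAt_ofReal_cpow_const t _ (Or.inr (ne_of_gt ht))).mul
        (Continuous.continuousAt (by fun_prop))).continuousWithinAt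
    · rw [ae_restrict_iff' measurableSet_Ioi]
      refine Eventually.of_forall fun ρ hρ => ?_
      rw [hnorm n ρ hρ, norm_mul, norm_cpow_eq_rpow_re_of_pos hρ, Complex.norm_exp, neg_re,
        re_mul_ofReal, ofReal_re, sub_re, one_re]
  have hFsum : Summable fun n => ∫ ρ in Ioi (0 : ℝ), ‖F n ρ‖ := by
    have h1 : ∀ n : ℕ, ∫ ρ in Ioi (0 : ℝ), ‖F n ρ‖ =
        ((√2 / 2) ^ (-s.re) * Real.Gamma s.re) * (1 / ((n + 1 : ℕ) : ℝ) ^ s.re) := by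
      intro n
      rw [setIntegral_congr_fun measurableSet_Ioi (fun ρ hρ => hnorm n ρ hρ),
        Real.integral_rpow_mul_exp_neg_mul_Ioi hs0 (hpos n), one_div,
        Real.inv_rpow (hpos n).le, Real.mul_rpow (by positivity) (by positivity),
        Real.rpow_neg (by positivity)]
      push_cast
      rw [mul_inv]
      ring
    simp_rw [h1]
    exact ((summable_nat_add_iff 1).2 (Real.summable_one_div_nat_rpow.2 hs)).mul_left _
  have hmain := hasSum_integral_of_summable_integral_norm hFi hFsum
  have hterm : ∀ n : ℕ, ∫ ρ in Ioi (0 : ℝ), F n ρ =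
      (Gamma s * diagDir ^ (-s)) * (1 / ((n : ℂ) + 1) ^ s) := by
    intro n
    rw [hF]
    simp only
    rw [integral_cpow_mul_exp_neg_complex_mul hs0 (by rw [hre]; exact hpos n),
      ofReal_mul_cpow (by positivity) diagDir_ne_zero, cpow_neg]
    push_cast
    ring
  have hzeta := zeta_eq_tsum_one_div_nat_add_one_cpow hs
  rw [hzeta, ← tsum_mul_left]
  simp_rw [← hterm]
  rw [hmain.tsum_eq]
  refine setIntegral_congr_fun measurableSet_Ioi fun ρ hρ => ?_
  have hρ' : (0 : ℝ) < ρ := hρ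
  simp only [hF]
  rw [tsum_mul_left]
  congr 1
  have hq : ‖Complex.exp (-(diagDir * ρ))‖ < 1 := by
    rw [Complex.exp_neg, norm_inv, norm_exp_diagDir_mul]
    exact inv_lt_one_of_one_lt₀ (Real.one_lt_exp_iff.2 (by positivity))
  have h2 : ∀ n : ℕ, Complex.exp (-((((n + 1 : ℝ) : ℂ) * diagDir) * ρ)) =
      Complex.exp (-(diagDir * ρ)) * Complex.exp (-(diagDir * ρ)) ^ n := by
    intro n
    rw [← Complex.exp_nat_mul, ← Complex.exp_add]
    congr 1
    push_cast
    ring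
  simp_rw [h2]
  rw [tsum_mul_left, tsum_geometric_of_norm_lt_one hq, Complex.exp_neg]
  have h3 := Complex.exp_ne_zero (diagDir * ρ)
  have h4 : Complex.exp (diagDir * ρ) - 1 ≠ 0 := sub_ne_zero.2 (exp_diagDir_mul_ne_one hρ')
  field_simp

/-! ### The Riemann-Siegel formula -/

theorem rsDenom_neg (x : ℂ) : rsDenom (-x) = -rsDenom x := by
  simp only [rsDenom, mul_neg, neg_neg, neg_sub]

theorem rsKernel_neg (x : ℂ) : rsKernel (-x) = -rsKernel x := by
  simp only [rsKernel, rsDenom_neg, neg_sq, div_neg]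

/-- When the power vanishes to order more than one at the origin, the line of integration may be
moved to the line through the origin. -/
theorem diagInt_cpow_mul_rsKernel_zero {w : ℂ} (hw : 1 < w.re) :
    (Integrable fun u : ℝ => (((0 : ℝ) : ℂ) - diagDir * u) ^ w *
      rsKernel (((0 : ℝ) : ℂ) - diagDir * u)) ∧
    diagInt (fun x => x ^ w * rsKernel x) 0 = diagInt (fun x => x ^ w * rsKernel x) (1 / 2) := by
  have hw0 : w ≠ 0 := by rintro rfl; norm_num at hw
  have hw1 : w - 1 ≠ 0 := by
    intro h
    have := congrArg re h
    simp at this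
    linarith
  have hslit : ∀ x ∈ diagStrip 0 (1 / 2), x ≠ 0 → x ∈ slitPlane := by
    intro x hx hne
    rw [mem_slitPlane_iff]
    by_cases h : x.im = 0
    · left
      have h1 := hx.1
      rw [h, sub_zero] at h1
      rcases h1.lt_or_eq with h2 | h2
      · exact h2
      · exact absurd (Complex.ext h2.symm h) hne
    · exact Or.inr h
  have hE : ∀ x ∈ diagStrip 0 (1 / 2), dslope rsDenom 0 x ≠ 0 := by
    intro x hx
    rcases eq_or_ne x 0 with rfl | hne
    · rw [dslope_same]
      simpa using deriv_rsDenom_intCast_ne_zero 0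
    · have h0 : rsDenom 0 = 0 := by simpa using rsDenom_intCast 0
      rw [dslope_of_ne _ hne, slope_def_field, h0, sub_zero]
      refine div_ne_zero ?_ (sub_ne_zero.2 hne)
      rw [Ne, rsDenom_eq_zero_iff]
      rintro ⟨m, rfl⟩
      have h1 := hx.1
      have h2 := hx.2
      simp only [intCast_re, intCast_im, sub_zero] at h1 h2
      have h3 : 0 ≤ m := by exact_mod_cast h1
      have h4 : m < 1 := by
        have : (m : ℝ) < 1 := by linarith
        exact_mod_cast this
      exact hne (by rw [show m = 0 by omega]; simp)
  -- One factor `x` cancels the simple zero of the denominator. The remaining `x^(w-1)` is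
  -- continuous at the origin because `Re w > 1`, and both sides take the value `0` there.
  have hfeq : (fun x : ℂ => x ^ w * rsKernel x) = fun x : ℂ =>
      x ^ (w - 1) * Complex.exp (Real.pi * I * x ^ 2) / dslope rsDenom 0 x := by
    ext x
    rcases eq_or_ne x 0 with rfl | hne
    · rw [zero_cpow hw0, zero_cpow hw1]; simp
    · have h0 : rsDenom 0 = 0 := by simpa using rsDenom_intCast 0
      rw [dslope_of_ne _ hne, slope_def_field, h0, sub_zero, sub_zero, cpow_sub _ _ hne, cpow_one,
        rsKernel]
      field_simp
  have hcont : ContinuousOn (fun x : ℂ => x ^ w * rsKernel x) (diagStrip 0 (1 / 2)) := by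
    rw [hfeq]
    refine ContinuousOn.div (ContinuousOn.mul ?_ (by fun_prop)) ?_ hE
    · intro x hx
      refine ContinuousAt.continuousWithinAt ?_
      rcases eq_or_ne x 0 with rfl | hne
      · have h := continuousAt_cpow_zero_of_re_pos (z := w - 1) (by simp; linarith)
        exact ContinuousAt.comp (f := fun x : ℂ => (x, w - 1)) (x := 0) h (by fun_prop)
      · exact continuousAt_id.cpow continuousAt_const (hslit x hx hne)
    · exact ((continuousOn_dslope univ_mem).2
        ⟨differentiable_rsDenom.continuous.continuousOn, differentiable_rsDenom 0⟩).mono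
        (subset_univ _)
  have hdiff : ∀ x ∈ diagStrip 0 (1 / 2), x ∉ ({0} : Set ℂ) →
      DifferentiableAt ℂ (fun x : ℂ => x ^ w * rsKernel x) x := by
    intro x hx hne
    have hne' : x ≠ 0 := by simpa using hne
    refine (differentiableAt_id.cpow_const (hslit x hx hne')).mul (differentiableAt_rsKernel ?_)
    intro h
    have h0 : rsDenom 0 = 0 := by simpa using rsDenom_intCast 0
    refine hE x hx ?_
    rw [dslope_of_ne _ hne', slope_def_field, h0, h]
    simp
  obtain ⟨C, M, hdec⟩ := exists_decay_mul_rsKernel (F := fun x : ℂ => x ^ w)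
    (a := 0) (b := 1 / 2) (A := Real.exp (‖w‖ * 8)) (B := ‖w‖) (Real.exp_pos _).le
    (norm_nonneg _) (M := 1) (fun x _ hM => by
      refine (norm_cpow_le_exp (by linarith) _).trans_eq ?_
      rw [← Real.exp_add]
      ring_nf)
  exact ⟨integrable_diagPoint (f := fun x : ℂ => x ^ w * rsKernel x) ⟨le_rfl, by norm_num⟩ hcont
    hdec, diagInt_eq_of_differentiable (by norm_num) (countable_singleton 0) hcont hdiff hdec⟩

theorem diagPoint_zero_neg_cpow {v : ℝ} (hv : 0 < v) (w : ℂ) :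
    (((0 : ℝ) : ℂ) - diagDir * ((-v : ℝ) : ℂ)) ^ w * rsKernel (((0 : ℝ) : ℂ) - diagDir * ((-v : ℝ) : ℂ)) =
      diagDir ^ w * ((v : ℂ) ^ w * rsKernel (diagDir * v)) := by
  have : ((0 : ℝ) : ℂ) - diagDir * ((-v : ℝ) : ℂ) = v * diagDir := by push_cast; ring
  rw [this, ofReal_mul_cpow hv diagDir_ne_zero, mul_comm (v : ℂ) diagDir]
  ring

theorem diagPoint_zero_cpow {v : ℝ} (hv : 0 < v) (w : ℂ) :
    (((0 : ℝ) : ℂ) - diagDir * (v : ℂ)) ^ w * rsKernel (((0 : ℝ) : ℂ) - diagDir * (v : ℂ)) =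
      -(-diagDir) ^ w * ((v : ℂ) ^ w * rsKernel (diagDir * v)) := by
  have : ((0 : ℝ) : ℂ) - diagDir * (v : ℂ) = v * -diagDir := by push_cast; ring
  rw [this, ofReal_mul_cpow hv (neg_ne_zero.2 diagDir_ne_zero), mul_neg, rsKernel_neg,
    mul_comm (v : ℂ) diagDir]
  ring

/-- On the line through the origin the odd kernel lets both halves be folded onto one ray; only the
phases of the principal power on the two halves differ. -/
theorem rsR_eq_ray_integral {s : ℂ} (hs : s.re < -1) :
    IntegrableOn (fun v : ℝ => (v : ℂ) ^ (-s) * rsKernel (diagDir * v)) (Ioi 0) ∧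
    rsR s = -diagDir * (diagDir ^ (-s) - (-diagDir) ^ (-s)) *
      ∫ v in Ioi (0 : ℝ), (v : ℂ) ^ (-s) * rsKernel (diagDir * v) := by
  obtain ⟨hi, he⟩ := diagInt_cpow_mul_rsKernel_zero (w := -s) (by rw [neg_re]; linarith)
  have hIoi := hi.integrableOn (s := Ioi 0)
  have hne : -(-diagDir) ^ (-s) ≠ 0 := by
    refine neg_ne_zero.2 ?_
    rw [cpow_def_of_ne_zero (neg_ne_zero.2 diagDir_ne_zero)]
    exact Complex.exp_ne_zero _
  have hk : IntegrableOn (fun v : ℝ => (v : ℂ) ^ (-s) * rsKernel (diagDir * v)) (Ioi 0) := by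
    have h1 := hIoi.congr_fun (fun v hv => diagPoint_zero_cpow hv (-s)) measurableSet_Ioi
    refine IntegrableOn.congr_fun (h1.const_mul (-(-diagDir) ^ (-s))⁻¹) (fun v _ => ?_)
      measurableSet_Ioi
    rw [inv_mul_cancel_left₀ hne]
  refine ⟨hk, ?_⟩
  have hIic : ∫ u in Iic (0 : ℝ), (((0 : ℝ) : ℂ) - diagDir * (u : ℂ)) ^ (-s) *
      rsKernel (((0 : ℝ) : ℂ) - diagDir * (u : ℂ)) =
      ∫ v in Ioi (0 : ℝ), diagDir ^ (-s) * ((v : ℂ) ^ (-s) * rsKernel (diagDir * v)) := by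
    have h := integral_comp_neg_Ioi (0 : ℝ) (fun u : ℝ =>
      (((0 : ℝ) : ℂ) - diagDir * (u : ℂ)) ^ (-s) * rsKernel (((0 : ℝ) : ℂ) - diagDir * (u : ℂ)))
    rw [show Iic (-(0 : ℝ)) = Iic 0 by rw [neg_zero]] at h
    rw [← h]
    exact setIntegral_congr_fun measurableSet_Ioi (fun v hv => diagPoint_zero_neg_cpow hv (-s))
  rw [rsR_eq_diagInt, ← he, diagInt, integral_mul_const,
    ← intervalIntegral.integral_Iic_add_Ioi hi.integrableOn hIoi (b := 0), hIic,
    setIntegral_congr_fun measurableSet_Ioi (fun v hv => diagPoint_zero_cpow hv (-s)),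
    integral_const_mul, integral_const_mul]
  ring

theorem conj_diagDir_mul_I : conj diagDir * I = diagDir := by
  have h : conj diagDir = Complex.exp (-(Real.pi * I / 4)) := by
    rw [diagDir, ← exp_conj]
    simp only [map_mul, map_div₀, conj_ofReal, conj_I, map_ofNat]
    congr 1; ring
  have h' : I = diagDir * diagDir := by rw [← sq, diagDir_sq]
  have h1 : conj diagDir * diagDir = 1 := by
    rw [h, diagDir, ← Complex.exp_add, neg_add_cancel, Complex.exp_zero]
  calc conj diagDir * I = conj diagDir * (diagDir * diagDir) := by rw [← h']
    _ = diagDir := by rw [← mul_assoc, h1, one_mul]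

/-- The duality behind the Riemann-Siegel formula: on the ray `e^(πix²)` is the real Gaussian
`e^(-πv²)`, and conjugating the kernel gives the Gaussian part of Mordell's integral at `ρ = 2πv`.
-/
theorem conj_rsKernel_diagDir {v : ℝ} : conj (rsKernel (diagDir * v)) =
    -rayGauss (2 * Real.pi * v) := by
  have hpi : (Real.pi : ℂ) ≠ 0 := ofReal_ne_zero.2 Real.pi_ne_zero
  have e1 : conj (Real.pi * I * (diagDir * v)) = -(diagDir * ((2 * Real.pi * v : ℝ) : ℂ) / 2) := by
    simp only [map_mul, conj_ofReal, conj_I]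
    push_cast
    linear_combination (-(Real.pi * v : ℂ)) * conj_diagDir_mul_I
  have e2 : Real.pi * I * (diagDir * v) ^ 2 = ((-(Real.pi * v ^ 2) : ℝ) : ℂ) := by
    push_cast
    rw [mul_pow, diagDir_sq]
    linear_combination (Real.pi * v ^ 2 : ℂ) * I_sq
  rw [rsKernel, rsDenom, map_div₀, map_sub, ← exp_conj, ← exp_conj, ← exp_conj, map_neg, e1, e2,
    neg_neg, conj_ofReal, rayGauss, ← neg_sub, div_neg]
  congr 3
  push_cast
  field_simp
  ring

/-- The two phases come from `log diagDir = πi/4` and `log (-diagDir) = -3πi/4`; their difference is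
the cosine of the functional equation. -/
theorem conj_coeff (s : ℂ) :
    conj (-diagDir * (diagDir ^ (-(1 - conj s)) - (-diagDir) ^ (-(1 - conj s)))) =
      -(2 * Complex.cos (Real.pi * s / 2) * diagDir ^ s) := by
  rw [cpow_def_of_ne_zero (neg_ne_zero.2 diagDir_ne_zero), log_neg_diagDir, diagDir_cpow,
    diagDir_cpow, Complex.cos, diagDir]
  simp only [map_mul, map_neg, map_sub, ← exp_conj, map_div₀, conj_ofReal, conj_I, map_one,
    conj_conj, map_ofNat]
  have h : ∀ a b : ℂ, 2 * ((a + b) / 2) = a + b := fun a b => by ring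
  rw [h, neg_mul, neg_inj, mul_sub, add_mul, ← Complex.exp_add, ← Complex.exp_add,
    ← Complex.exp_add, ← Complex.exp_add, sub_eq_add_neg, add_comm]
  have h1 : ∀ z : ℂ, -Complex.exp z = Complex.exp (z + Real.pi * I) := fun z => by
    rw [Complex.exp_add, Complex.exp_pi_mul_I, mul_neg_one]
  rw [h1]
  congr 1 <;> congr 1 <;> ring

/-- Mellin transforms of `mordellRay_eq` express `Γ(s) ω^(-s) (ζ(s) - ℛ(s))` as the transform `K` of
the Gaussian part, and `K` is identified with the conjugate of `ℛ(1 - conj s)`. The condition `Re s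
> 2` puts `1 - conj s` where the line may pass through the origin. -/
theorem riemann_siegel_of_two_lt_re {s : ℂ} (hs : 2 < s.re) :
    Gammaℂ s * Complex.cos (Real.pi * s / 2) * (riemannZeta s - rsR s) =
      conj (rsR (1 - conj s)) := by
  have hs' : (1 - conj s).re < -1 := by simp; linarith
  obtain ⟨hi, he⟩ := rsR_eq_ray_integral hs'
  have h2pi : (0 : ℝ) < 2 * Real.pi := by positivity
  have hconj : ∀ v ∈ Ioi (0 : ℝ), conj ((v : ℂ) ^ (-(1 - conj s)) * rsKernel (diagDir * v)) =
      -((2 * Real.pi : ℝ) : ℂ) ^ (-(s - 1)) *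
        (((2 * Real.pi * v : ℝ) : ℂ) ^ (s - 1) * rayGauss (2 * Real.pi * v)) := by
    intro v hv
    have hv' : (0 : ℝ) < v := hv
    have harg : (v : ℂ).arg ≠ Real.pi := by
      rw [arg_ofReal_of_nonneg hv'.le]; exact Real.pi_pos.ne
    have h1 : conj ((v : ℂ) ^ (-(1 - conj s))) = (v : ℂ) ^ (s - 1) := by
      have := cpow_conj (v : ℂ) (s - 1) harg
      rw [conj_ofReal] at this
      rw [show -(1 - conj s) = conj (s - 1) by simp, this, conj_conj]
    have hne : ((2 * Real.pi : ℝ) : ℂ) ≠ 0 := ofReal_ne_zero.2 h2pi.ne'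
    have hne' : ((2 * Real.pi : ℝ) : ℂ) ^ (s - 1) ≠ 0 := by
      rw [cpow_def_of_ne_zero hne]; exact Complex.exp_ne_zero _
    rw [map_mul, h1, conj_rsKernel_diagDir, ofReal_mul (2 * Real.pi) v,
      mul_cpow_ofReal_nonneg h2pi.le hv'.le, cpow_neg]
    field_simp
  set K : ℂ := ∫ ρ in Ioi (0 : ℝ), (ρ : ℂ) ^ (s - 1) * rayGauss ρ with hK
  have hKint : IntegrableOn (fun ρ : ℝ => (ρ : ℂ) ^ (s - 1) * rayGauss ρ) (Ioi 0) := by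
    have h1 : IntegrableOn (fun v : ℝ => conj ((v : ℂ) ^ (-(1 - conj s)) *
        rsKernel (diagDir * v))) (Ioi 0) := by
      refine Integrable.mono hi ?_ (Eventually.of_forall fun v => ?_)
      · exact continuous_conj.comp_aestronglyMeasurable hi.aestronglyMeasurable
      · rw [RCLike.norm_conj]
    have h2 := h1.congr_fun hconj measurableSet_Ioi
    have hne : ((2 * Real.pi : ℝ) : ℂ) ≠ 0 := ofReal_ne_zero.2 h2pi.ne'
    have hne' : -((2 * Real.pi : ℝ) : ℂ) ^ (-(s - 1)) ≠ 0 := by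
      rw [cpow_def_of_ne_zero hne]; exact neg_ne_zero.2 (Complex.exp_ne_zero _)
    have h3 : IntegrableOn (fun v : ℝ => ((2 * Real.pi * v : ℝ) : ℂ) ^ (s - 1) *
        rayGauss (2 * Real.pi * v)) (Ioi 0) := by
      refine IntegrableOn.congr_fun (h2.const_mul (-((2 * Real.pi : ℝ) : ℂ) ^ (-(s - 1)))⁻¹)
        (fun v _ => ?_) measurableSet_Ioi
      rw [inv_mul_cancel_left₀ hne']
    have h4 := (integrableOn_Ioi_comp_mul_left_iff
      (fun ρ : ℝ => (ρ : ℂ) ^ (s - 1) * rayGauss ρ) 0 h2pi).1 h3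
    rwa [mul_zero] at h4
  have hKval : conj (∫ v in Ioi (0 : ℝ), (v : ℂ) ^ (-(1 - conj s)) * rsKernel (diagDir * v)) =
      -((2 * Real.pi : ℝ) : ℂ) ^ (-s) * K := by
    rw [← integral_conj, setIntegral_congr_fun measurableSet_Ioi hconj, integral_const_mul,
      integral_comp_mul_left_Ioi (fun ρ : ℝ => (ρ : ℂ) ^ (s - 1) * rayGauss ρ) 0 h2pi, mul_zero,
      ← hK, real_smul]
    have hne : ((2 * Real.pi : ℝ) : ℂ) ≠ 0 := ofReal_ne_zero.2 h2pi.ne'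
    rw [show -s = -(s - 1) - 1 by ring, cpow_sub _ _ hne, cpow_one, ofReal_inv]
    field_simp
  have hG := integral_cpow_mul_mordellRay (s := s) (by linarith)
  have hGi := integrableOn_cpow_mul_mordellRay (s := s) (by linarith)
  have hZ := integral_cpow_div_exp_sub_one (s := s) (by linarith)
  have hZ' : ∫ ρ in Ioi (0 : ℝ), (ρ : ℂ) ^ (s - 1) * (1 / (Complex.exp (diagDir * ρ) - 1)) =
      (∫ ρ in Ioi (0 : ℝ), (ρ : ℂ) ^ (s - 1) * mordellRay ρ) + K := by
    rw [hK, ← integral_add hGi hKint]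
    refine setIntegral_congr_fun measurableSet_Ioi fun ρ hρ => ?_
    rw [mordellRay_eq hρ]
    ring
  rw [hZ, hG] at hZ'
  have hd : diagDir ^ s * diagDir ^ (-s) = 1 := by
    rw [← cpow_add _ _ diagDir_ne_zero, add_neg_cancel, cpow_zero]
  rw [he, map_mul, conj_coeff, hKval, Gammaℂ_def]
  push_cast
  linear_combination (2 * Complex.cos (Real.pi * s / 2) * diagDir ^ s * (2 * Real.pi : ℂ) ^ (-s)) * hZ'
    - (2 * (2 * Real.pi : ℂ) ^ (-s) * Gamma s * Complex.cos (Real.pi * s / 2) *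
      (riemannZeta s - rsR s)) * hd

/-- The **Riemann-Siegel formula** in the upper half-plane. -/
theorem riemann_siegel {s : ℂ} (hs : 0 < s.im) :
    Gammaℂ s * Complex.cos (Real.pi * s / 2) * (riemannZeta s - rsR s) =
      conj (rsR (1 - conj s)) := by
  -- The upper half-plane is connected, avoids the poles of `Γ` and `ζ`, and contains `3 + I`, near
  -- which the formula is known.
  set U : Set ℂ := {z | 0 < z.im} with hU
  have hUo : IsOpen U := isOpen_lt continuous_const continuous_im
  have hUc : IsPreconnected U := (convex_halfSpace_im_gt 0).isPreconnected
  have hf : DifferentiableOn ℂ (fun s : ℂ =>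
      Gammaℂ s * Complex.cos (Real.pi * s / 2) * (riemannZeta s - rsR s)) U := by
    intro z hz
    have hz' : 0 < z.im := hz
    refine DifferentiableAt.differentiableWithinAt ?_
    refine DifferentiableAt.mul (DifferentiableAt.mul ?_ (by fun_prop))
      (DifferentiableAt.sub (differentiableAt_riemannZeta ?_) (differentiable_rsR z))
    · have h1 : DifferentiableAt ℂ Gamma z := by
        refine differentiableAt_Gamma z fun m h => ?_
        rw [h] at hz'
        simp at hz'
      have h2 : DifferentiableAt ℂ (fun s : ℂ => (2 * Real.pi : ℂ) ^ (-s)) z :=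
        (differentiableAt_id.neg).const_cpow (Or.inl (by simp [Real.pi_ne_zero]))
      have : Gammaℂ = fun s => 2 * (2 * Real.pi : ℂ) ^ (-s) * Gamma s := by
        ext s; rw [Gammaℂ_def]
      rw [this]
      exact (h2.const_mul 2).mul h1
    · rintro rfl
      simp at hz'
  have hg : DifferentiableOn ℂ (fun s : ℂ => conj (rsR (1 - conj s))) U := by
    have h1 : Differentiable ℂ fun s : ℂ => rsR (1 - s) :=
      differentiable_rsR.comp (by fun_prop)
    have h2 : Differentiable ℂ (conj ∘ (fun s : ℂ => rsR (1 - s)) ∘ conj) := by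
      intro z
      exact differentiableAt_conj_conj_iff.2 (h1 _)
    exact h2.differentiableOn
  have hV : {z : ℂ | 2 < z.re} ∈ 𝓝 (3 + I : ℂ) :=
    (isOpen_lt continuous_const continuous_re).mem_nhds (by simp; norm_num)
  exact (hf.analyticOnNhd hUo).eqOn_of_preconnected_of_eventuallyEq (hg.analyticOnNhd hUo) hUc
    (show (3 + I : ℂ) ∈ U by simp [hU])
    (by filter_upwards [hV] with z hz using riemann_siegel_of_two_lt_re hz) hs

/-! ### The phase of the Gamma function -/

theorem abs_arctan_sub_le (x : ℝ) : |Real.arctan x - x| ≤ |x| ^ 3 := by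
  have h : ‖(Real.arctan x - x) - (Real.arctan 0 - 0)‖ ≤ |x| ^ 2 * ‖x - 0‖ := by
    refine (convex_Icc (-|x|) |x|).norm_image_sub_le_of_norm_hasDerivWithin_le
      (f := fun z => Real.arctan z - z) (f' := fun z => 1 / (1 + z ^ 2) - 1) (fun z _ => ?_)
      (fun z hz => ?_) ⟨by simp, by simp⟩ ⟨neg_abs_le x, le_abs_self x⟩
    · exact ((Real.hasDerivAt_arctan z).sub (hasDerivAt_id z)).hasDerivWithinAt
    · have h1 : z ^ 2 ≤ |x| ^ 2 := by
        rw [sq_abs]; exact sq_le_sq.2 (abs_le.2 hz)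
      have h2 : 1 / (1 + z ^ 2) - 1 = -(z ^ 2 / (1 + z ^ 2)) := by field_simp; ring
      rw [h2, norm_neg, Real.norm_of_nonneg (by positivity)]
      refine (div_le_self (sq_nonneg z) ?_).trans h1
      linarith [sq_nonneg z]
  rw [Real.arctan_zero, sub_zero, sub_zero, sub_zero, Real.norm_eq_abs, Real.norm_eq_abs] at h
  calc _ ≤ _ := h
    _ = _ := by ring

/-- The phase of the `n`-th term of Euler's product for `Γ(1/4 + i t / 2)`. -/
noncomputable def eulerPhase (n : ℕ) (t : ℝ) : ℝ :=
  t / 2 * Real.log n - ∑ k ∈ Finset.range (n + 1), Real.arctan (t / 2 / (1 / 4 + k))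

theorem eq_norm_mul_exp_arctan {z : ℂ} (hz : 0 < z.re) :
    z = ‖z‖ * Complex.exp (Real.arctan (z.im / z.re) * I) := by
  have h1 : z.arg = Real.arctan (z.im / z.re) := by
    rw [← Complex.tan_arg, Real.arctan_tan]
    · have := (abs_lt.1 (abs_arg_lt_pi_div_two_iff.2 (Or.inl hz))).1
      exact this
    · exact (abs_lt.1 (abs_arg_lt_pi_div_two_iff.2 (Or.inl hz))).2
  rw [← h1, norm_mul_exp_arg_mul_I]

theorem GammaSeq_eq_norm_mul_exp (t : ℝ) {n : ℕ} (hn : n ≠ 0) :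
    GammaSeq (1 / 4 + I * t / 2) n =
      ‖GammaSeq (1 / 4 + I * t / 2) n‖ * Complex.exp (eulerPhase n t * I) := by
  have hprod : ∀ m : ℕ, (∏ j ∈ Finset.range m, ((1 / 4 + I * t / 2 : ℂ) + j)) =
      ‖∏ j ∈ Finset.range m, ((1 / 4 + I * t / 2 : ℂ) + j)‖ *
      Complex.exp ((∑ k ∈ Finset.range m, Real.arctan (t / 2 / (1 / 4 + k)) : ℝ) * I) := by
    intro m
    induction m with
    | zero => simp
    | succ m ih =>
      have hre : ((1 / 4 + I * t / 2 : ℂ) + m).re = 1 / 4 + m := by simp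
      have him : ((1 / 4 + I * t / 2 : ℂ) + m).im = t / 2 := by simp
      have h1 := eq_norm_mul_exp_arctan (z := (1 / 4 + I * t / 2 : ℂ) + m) (by rw [hre]; positivity)
      rw [hre, him] at h1
      rw [Finset.prod_range_succ, Finset.sum_range_succ, norm_mul]
      push_cast at ih h1 ⊢
      rw [add_mul, Complex.exp_add]
      conv_lhs => rw [ih, h1]
      ring
  have hn' : (0 : ℝ) < n := by positivity
  have hnC : (n : ℂ) ≠ 0 := by exact_mod_cast hn
  have hpow : (n : ℂ) ^ (1 / 4 + I * t / 2 : ℂ) = ‖(n : ℂ) ^ (1 / 4 + I * t / 2 : ℂ)‖ *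
      Complex.exp ((t / 2 * Real.log n : ℝ) * I) := by
    have h1 : ‖(n : ℂ) ^ (1 / 4 + I * t / 2 : ℂ)‖ = Real.exp (Real.log n * (1 / 4)) := by
      rw [← ofReal_natCast, norm_cpow_eq_rpow_re_of_pos hn', Real.rpow_def_of_pos hn']
      simp
    rw [h1, cpow_def_of_ne_zero hnC, ofReal_exp, ← Complex.exp_add, ← ofReal_natCast,
      ← ofReal_log hn'.le]
    congr 1
    push_cast
    ring
  have hp := hprod (n + 1)
  set P := ∏ j ∈ Finset.range (n + 1), ((1 / 4 + I * t / 2 : ℂ) + j) with hP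
  rw [GammaSeq, ← hP, norm_div, norm_mul, eulerPhase]
  have hfac : ‖((n.factorial : ℕ) : ℂ)‖ = n.factorial := by simp
  rw [hfac]
  conv_lhs => rw [hp, hpow]
  rw [ofReal_sub, sub_mul, Complex.exp_sub]
  push_cast
  ring

/-- Both the logarithm and the arctangent increments are `t/(2n)` up to `O(n^(-2))`, locally
uniformly in `t`; this feeds the Weierstrass M-test. The index starts at `1`, away from `log 0`. -/
theorem abs_eulerPhase_succ_sub_le {T t : ℝ} (ht : |t| ≤ T) (n : ℕ) :
    |eulerPhase (n + 2) t - eulerPhase (n + 1) t| ≤ (T + T ^ 3) * (1 / ((n : ℝ) + 1) ^ 2) := by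
  have hT : 0 ≤ T := (abs_nonneg t).trans ht
  have hn : (0 : ℝ) < (n : ℝ) + 1 := by positivity
  have hd : eulerPhase (n + 2) t - eulerPhase (n + 1) t =
      t / 2 * (Real.log (1 + 1 / ((n : ℝ) + 1)) - 1 / (1 / 4 + (n + 2))) -
      (Real.arctan (t / 2 / (1 / 4 + (n + 2))) - t / 2 / (1 / 4 + (n + 2))) := by
    have h1 : Real.log (1 + 1 / ((n : ℝ) + 1)) = Real.log ((n : ℝ) + 2) - Real.log (n + 1) := by
      rw [← Real.log_div (by positivity) (by positivity)]
      congr 1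
      field_simp
      ring
    rw [eulerPhase, eulerPhase, Finset.sum_range_succ, h1]
    push_cast
    ring
  have hlog : |Real.log (1 + 1 / ((n : ℝ) + 1)) - 1 / (1 / 4 + (n + 2))| ≤
      2 * (1 / ((n : ℝ) + 1) ^ 2) := by
    have hu : Real.log (1 + 1 / ((n : ℝ) + 1)) ≤ 1 / ((n : ℝ) + 1) := by
      have := Real.log_le_sub_one_of_pos (x := 1 + 1 / ((n : ℝ) + 1)) (by positivity)
      linarith
    have hl : 1 / ((n : ℝ) + 2) ≤ Real.log (1 + 1 / ((n : ℝ) + 1)) := by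
      have := Real.one_sub_inv_le_log_of_pos (x := 1 + 1 / ((n : ℝ) + 1)) (by positivity)
      refine le_trans (le_of_eq ?_) this
      field_simp
      ring
    have h3 : 1 / (1 / 4 + ((n : ℝ) + 2)) ≤ 1 / ((n : ℝ) + 2) :=
      one_div_le_one_div_of_le (by positivity) (by linarith)
    have h4 : 1 / ((n : ℝ) + 1) - 1 / (1 / 4 + (n + 2)) ≤ 2 * (1 / ((n : ℝ) + 1) ^ 2) := by
      rw [div_sub_div _ _ (by positivity) (by positivity), mul_one_div,
        div_le_div_iff₀ (by positivity) (by positivity)]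
      nlinarith [mul_pos hn hn, mul_pos (mul_pos hn hn) hn]
    rw [abs_le]
    constructor
    · have : (0 : ℝ) ≤ 2 * (1 / ((n : ℝ) + 1) ^ 2) := by positivity
      linarith
    · linarith
  have hat := abs_arctan_sub_le (t / 2 / (1 / 4 + ((n : ℝ) + 2)))
  have hx : |t / 2 / (1 / 4 + ((n : ℝ) + 2))| ^ 3 ≤ T ^ 3 * (1 / ((n : ℝ) + 1) ^ 2) := by
    rw [abs_div, abs_div, abs_of_pos (by positivity : (0 : ℝ) < 1 / 4 + ((n : ℝ) + 2)), abs_two,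
      div_pow]
    calc (|t| / 2) ^ 3 / (1 / 4 + ((n : ℝ) + 2)) ^ 3 ≤ T ^ 3 / ((n : ℝ) + 1) ^ 2 := by
          gcongr
          · linarith [abs_nonneg t]
          · calc ((n : ℝ) + 1) ^ 2 ≤ (1 / 4 + ((n : ℝ) + 2)) ^ 2 :=
                  pow_le_pow_left₀ (by positivity) (by linarith) 2
              _ ≤ (1 / 4 + ((n : ℝ) + 2)) ^ 3 := by
                refine pow_le_pow_right₀ ?_ (by norm_num)
                have : (0 : ℝ) ≤ n := Nat.cast_nonneg n
                linarith
      _ = _ := by ring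
  rw [hd]
  calc _ ≤ |t / 2 * (Real.log (1 + 1 / ((n : ℝ) + 1)) - 1 / (1 / 4 + (n + 2)))| +
        |Real.arctan (t / 2 / (1 / 4 + (n + 2))) - t / 2 / (1 / 4 + (n + 2))| := abs_sub _ _
    _ ≤ T / 2 * (2 * (1 / ((n : ℝ) + 1) ^ 2)) + T ^ 3 * (1 / ((n : ℝ) + 1) ^ 2) := by
        refine add_le_add ?_ (hat.trans hx)
        rw [abs_mul, abs_div, abs_two]
        gcongr
    _ = _ := by ring

theorem summable_one_div_succ_sq : Summable fun n : ℕ => 1 / ((n : ℝ) + 1) ^ 2 := by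
  have := (summable_nat_add_iff 1).2 (Real.summable_one_div_nat_pow.2 (by norm_num : 1 < 2))
  exact_mod_cast this

theorem continuous_eulerPhase (n : ℕ) : Continuous (eulerPhase n) := by
  unfold eulerPhase
  refine Continuous.sub (by fun_prop) (continuous_finsetSum _ fun k _ => ?_)
  exact Real.continuous_arctan.comp (by fun_prop)

/-- The limit of the phases of Euler's product is continuous. -/
theorem exists_continuous_tendsto_eulerPhase :
    ∃ θ : ℝ → ℝ, Continuous θ ∧ ∀ t, Tendsto (fun n => eulerPhase (n + 1) t) atTop (𝓝 (θ t)) := by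
  refine ⟨fun t => (∑' n : ℕ, (eulerPhase (n + 2) t - eulerPhase (n + 1) t)) + eulerPhase 1 t,
    Continuous.add ?_ (continuous_eulerPhase 1), fun t => ?_⟩
  · rw [continuous_iff_continuousAt]
    intro t
    have h : ContinuousOn (fun t => ∑' n : ℕ, (eulerPhase (n + 2) t - eulerPhase (n + 1) t))
        (Icc (-(|t| + 1)) (|t| + 1)) :=
      continuousOn_tsum
        (fun n => ((continuous_eulerPhase _).sub (continuous_eulerPhase _)).continuousOn)
        (summable_one_div_succ_sq.mul_left ((|t| + 1) + (|t| + 1) ^ 3))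
        (fun n x hx => abs_eulerPhase_succ_sub_le (abs_le.2 hx) n)
    exact h.continuousAt (Icc_mem_nhds (by linarith [neg_abs_le t]) (by linarith [le_abs_self t]))
  · have hs : Summable fun n : ℕ => eulerPhase (n + 2) t - eulerPhase (n + 1) t :=
      Summable.of_norm_bounded (summable_one_div_succ_sq.mul_left (|t| + |t| ^ 3))
        fun n => abs_eulerPhase_succ_sub_le le_rfl n
    have h := (hs.hasSum.tendsto_sum_nat).add_const (eulerPhase 1 t)
    refine h.congr fun n => ?_
    rw [Finset.sum_range_sub (fun n => eulerPhase (n + 1) t)]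
    simp

theorem Gamma_eq_norm_mul_exp_of_tendsto {θ : ℝ → ℝ}
    (hθ : ∀ t, Tendsto (fun n => eulerPhase (n + 1) t) atTop (𝓝 (θ t))) (t : ℝ) :
    Gamma (1 / 4 + I * t / 2) = ‖Gamma (1 / 4 + I * t / 2)‖ * Complex.exp (θ t * I) := by
  have h1 : Tendsto (fun n : ℕ => GammaSeq (1 / 4 + I * t / 2) (n + 1)) atTop
      (𝓝 (Gamma (1 / 4 + I * t / 2))) :=
    (GammaSeq_tendsto_Gamma _).comp (tendsto_add_atTop_nat 1)
  have h2 : Tendsto (fun n : ℕ => (‖GammaSeq (1 / 4 + I * t / 2) (n + 1)‖ : ℂ) *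
      Complex.exp (eulerPhase (n + 1) t * I)) atTop
      (𝓝 (‖Gamma (1 / 4 + I * t / 2)‖ * Complex.exp (θ t * I))) := by
    refine Tendsto.mul ((continuous_ofReal.tendsto _).comp h1.norm) ?_
    have hc : Continuous fun x : ℝ => Complex.exp (x * I) := by fun_prop
    exact (hc.tendsto _).comp (hθ t)
  refine tendsto_nhds_unique h1 (h2.congr fun n => ?_)
  exact (GammaSeq_eq_norm_mul_exp t (Nat.succ_ne_zero n)).symm

theorem Gamma_quarter_ne_zero (t : ℝ) : Gamma (1 / 4 + I * t / 2) ≠ 0 :=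
  Gamma_ne_zero_of_re_pos (by simp)

theorem continuous_digamma_quarter :
    Continuous fun t : ℝ => digamma (1 / 4 + I * t / 2) := by
  rw [continuous_iff_continuousAt]
  intro t
  have hU : IsOpen {z : ℂ | 0 < z.re} := isOpen_lt continuous_const continuous_re
  have hd : DifferentiableOn ℂ Gamma {z : ℂ | 0 < z.re} := fun z hz =>
    (differentiableAt_Gamma z fun m h => by
      have hz' : 0 < z.re := hz
      rw [h] at hz'
      simp at hz'
      linarith [(Nat.cast_nonneg m : (0 : ℝ) ≤ m)]).differentiableWithinAt
  have hmem : (1 / 4 + I * t / 2 : ℂ) ∈ {z : ℂ | 0 < z.re} := by simp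
  have h1 : ContinuousAt (deriv Gamma) (1 / 4 + I * t / 2) :=
    ((hd.analyticOnNhd hU).deriv _ hmem).continuousAt
  have h2 : ContinuousAt Gamma (1 / 4 + I * t / 2) :=
    (hd.differentiableAt (hU.mem_nhds hmem)).continuousAt
  have h3 : ContinuousAt digamma (1 / 4 + I * t / 2) :=
    h1.div h2 (Gamma_quarter_ne_zero t)
  exact ContinuousAt.comp (f := fun t : ℝ => (1 / 4 + I * t / 2 : ℂ)) h3 (by fun_prop)

/-- The integral in the definition of the Riemann-Siegel theta function. -/
noncomputable def gammaPhase (t : ℝ) : ℝ :=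
  ∫ u in (0 : ℝ)..t, (digamma (1 / 4 + I * u / 2)).re / 2

theorem continuous_gammaPhase : Continuous gammaPhase :=
  intervalIntegral.continuous_primitive (fun a b => (Continuous.intervalIntegrable
    ((continuous_re.comp continuous_digamma_quarter).div_const 2) a b)) 0

/-- The function `f(t) = Γ(1/4 + it/2)` solves `f' = f·iψ/2`, with `ψ` the digamma value. Dividing
by the exponential of a primitive of `iψ/2` leaves a constant, the positive number `Γ(1/4)`. -/
theorem Gamma_eq_norm_mul_exp_gammaPhase (t : ℝ) :
    Gamma (1 / 4 + I * t / 2) =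
      ‖Gamma (1 / 4 + I * t / 2)‖ * Complex.exp (gammaPhase t * I) := by
  set f : ℝ → ℂ := fun t => Gamma (1 / 4 + I * t / 2) with hf
  set B : ℝ → ℝ := fun t => ∫ u in (0 : ℝ)..t, -(digamma (1 / 4 + I * u / 2)).im / 2 with hB
  have hA' : ∀ t : ℝ, HasDerivAt gammaPhase ((digamma (1 / 4 + I * t / 2)).re / 2) t := fun t =>
    ((continuous_re.comp continuous_digamma_quarter).div_const 2).integral_hasStrictDerivAt 0 t
      |>.hasDerivAt
  have hB' : ∀ t : ℝ, HasDerivAt B (-(digamma (1 / 4 + I * t / 2)).im / 2) t := fun t =>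
    ((continuous_im.comp continuous_digamma_quarter).neg.div_const 2).integral_hasStrictDerivAt 0 t
      |>.hasDerivAt
  have hf' : ∀ t : ℝ, HasDerivAt f (f t * (digamma (1 / 4 + I * t / 2) * (I / 2))) t := by
    intro t
    have h1 : DifferentiableAt ℂ Gamma (1 / 4 + I * t / 2) := by
      refine differentiableAt_Gamma _ fun m h => ?_
      have := congrArg re h
      simp at this
      linarith [(Nat.cast_nonneg m : (0 : ℝ) ≤ m)]
    have h2 : HasDerivAt (fun t : ℝ => (1 / 4 + I * t / 2 : ℂ)) (I / 2) t := by
      have := ((((hasDerivAt_id t).ofReal_comp).const_mul I).div_const 2).const_add (1 / 4 : ℂ)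
      simpa using this
    have h3 := h1.hasDerivAt.comp_of_eq t h2 rfl
    refine h3.congr_deriv ?_
    rw [digamma_def, logDeriv_apply, hf, ← mul_assoc, mul_div_cancel₀ _ (Gamma_quarter_ne_zero t)]
  set g : ℝ → ℂ := fun t => f t * Complex.exp (-((B t : ℂ) + gammaPhase t * I)) with hg
  have hg' : ∀ t, HasDerivAt g 0 t := by
    intro t
    have h1 := ((hB' t).ofReal_comp.add ((hA' t).ofReal_comp.mul_const I)).neg.cexp
    refine ((hf' t).mul h1).congr_deriv ?_
    have h2 := re_add_im (digamma (1 / 4 + I * t / 2))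
    set ψ := digamma (1 / 4 + I * t / 2) with hψ
    simp only [Pi.add_apply, Pi.neg_apply]
    push_cast
    linear_combination (-(f t * Complex.exp (-((B t : ℂ) + gammaPhase t * I)) * I / 2)) * h2 +
      (f t * Complex.exp (-((B t : ℂ) + gammaPhase t * I)) * (ψ.im : ℂ) / 2) * I_sq
  have hconst : g t = g 0 :=
    is_const_of_deriv_eq_zero (fun t => (hg' t).differentiableAt) (fun t => (hg' t).deriv) t 0
  have h0 : g 0 = ((Real.Gamma (1 / 4) : ℝ) : ℂ) := by
    simp only [hg, hf, hB, gammaPhase]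
    rw [← Gamma_ofReal]
    simp
  have hft : f t = ((Real.Gamma (1 / 4) * Real.exp (B t) : ℝ) : ℂ) *
      Complex.exp (gammaPhase t * I) := by
    rw [h0] at hconst
    have h1 : f t = g t * Complex.exp ((B t : ℂ) + gammaPhase t * I) := by
      rw [hg, mul_assoc, ← Complex.exp_add, neg_add_cancel, Complex.exp_zero, mul_one]
    rw [h1, hconst, Complex.exp_add]
    push_cast
    ring
  have hpos : 0 < Real.Gamma (1 / 4) * Real.exp (B t) :=
    mul_pos (Real.Gamma_pos_of_pos (by norm_num)) (Real.exp_pos _)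
  have hnorm : ‖f t‖ = Real.Gamma (1 / 4) * Real.exp (B t) := by
    rw [hft, norm_mul, norm_exp_ofReal_mul_I, mul_one, norm_real, Real.norm_of_nonneg hpos.le]
  change f t = ‖f t‖ * _
  rw [hnorm]
  exact hft

/-- The digamma integral and the Euler limit are continuous arguments of the same nonvanishing
function, both zero at `t = 0`. Their difference takes values in `2πℤ`, so by the intermediate value
theorem it never leaves `0`. The explicit limit is what the numerical bounds on `ϑ` rest on. -/
theorem tendsto_eulerPhase (t : ℝ) :
    Tendsto (fun n => eulerPhase (n + 1) t) atTop (𝓝 (gammaPhase t)) := by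
  obtain ⟨θ, hc, hθ⟩ := exists_continuous_tendsto_eulerPhase
  suffices h : ∀ t, gammaPhase t - θ t = 0 by
    rw [sub_eq_zero.1 (h t)]; exact hθ t
  have hexp : ∀ t, Complex.exp (((gammaPhase t - θ t : ℝ) : ℂ) * I) = 1 := by
    intro t
    have h1 := Gamma_eq_norm_mul_exp_of_tendsto hθ t
    have h2 := Gamma_eq_norm_mul_exp_gammaPhase t
    have hne : (‖Gamma (1 / 4 + I * t / 2)‖ : ℂ) ≠ 0 :=
      ofReal_ne_zero.2 (norm_ne_zero_iff.2 (Gamma_quarter_ne_zero t))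
    have h3 := mul_left_cancel₀ hne (h2.symm.trans h1)
    rw [ofReal_sub, sub_mul, Complex.exp_sub, h3, div_self (Complex.exp_ne_zero _)]
  have hcd : Continuous fun t => gammaPhase t - θ t := continuous_gammaPhase.sub hc
  have h0 : gammaPhase 0 - θ 0 = 0 := by
    have h1 : θ 0 = 0 := by
      refine tendsto_nhds_unique (hθ 0) ?_
      simp [eulerPhase]
    rw [h1, gammaPhase, intervalIntegral.integral_same, sub_zero]
  have hnot : ∀ t, |gammaPhase t - θ t| ≠ Real.pi := by
    intro t h
    have h1 := hexp t
    rcases (abs_eq Real.pi_pos.le).1 h with h2 | h2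
    · rw [h2, Complex.exp_pi_mul_I] at h1
      norm_num at h1
    · rw [h2, ofReal_neg, neg_mul, Complex.exp_neg_pi_mul_I] at h1
      norm_num at h1
  intro t
  have hlt : |gammaPhase t - θ t| < Real.pi := by
    by_contra hge
    push Not at hge
    obtain ⟨t', ht'⟩ := mem_range_of_exists_le_of_exists_ge hcd.abs (c := Real.pi)
      ⟨0, by rw [h0, abs_zero]; exact Real.pi_pos.le⟩ ⟨t, hge⟩
    exact hnot t' ht'
  obtain ⟨m, hm⟩ := Complex.exp_eq_one_iff.1 (hexp t)
  have hm' : gammaPhase t - θ t = m * (2 * Real.pi) := by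
    have h1 := congrArg im hm
    simpa using h1
  have hm0 : m = 0 := by
    rw [hm', abs_mul, abs_of_pos (by positivity : (0 : ℝ) < 2 * Real.pi)] at hlt
    have : |(m : ℝ)| < 1 := by nlinarith [Real.pi_pos]
    have h2 : |m| < 1 := by exact_mod_cast this
    exact Int.abs_lt_one_iff.1 h2
  rw [hm', hm0]
  simp

/-! ### The Riemann-Siegel theta function -/

theorem siegelTheta_eq (t : ℝ) : siegelTheta t = gammaPhase t - t / 2 * Real.log Real.pi := rfl

/-- The primitive `x arctan (y / x) + (y / 2) log (x ^ 2 + y ^ 2)` of `arctan (y / x)`. -/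
noncomputable def arctanDivPrimitive (y x : ℝ) : ℝ :=
  x * Real.arctan (y / x) + y / 2 * Real.log (x ^ 2 + y ^ 2)

theorem hasDerivAt_arctanDivPrimitive (y : ℝ) {x : ℝ} (hx : 0 < x) :
    HasDerivAt (arctanDivPrimitive y) (Real.arctan (y / x)) x := by
  have h1 : HasDerivAt (fun x : ℝ => y / x) (-y / x ^ 2) x := by
    simpa [div_eq_mul_inv] using (hasDerivAt_inv hx.ne').const_mul y
  have h2 := (hasDerivAt_id x).mul h1.arctan
  have h3 : HasDerivAt (fun x : ℝ => x ^ 2 + y ^ 2) (2 * x) x := by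
    simpa using (hasDerivAt_pow 2 x).add_const (y ^ 2)
  have hne : x ^ 2 + y ^ 2 ≠ 0 := by positivity
  have h4 := (h3.log hne).const_mul (y / 2)
  refine (h2.add h4).congr_deriv ?_
  have hne' : (1 : ℝ) + (y / x) ^ 2 ≠ 0 := by positivity
  simp only [id]
  field_simp
  ring

theorem arctanDivPrimitive_sub_mem {y x : ℝ} (hy : 0 ≤ y) (hx : 0 < x) :
    arctanDivPrimitive y (x + 1) - arctanDivPrimitive y x ∈
      Icc (Real.arctan (y / (x + 1))) (Real.arctan (y / x)) := by
  obtain ⟨z, hz, h⟩ := exists_hasDerivAt_eq_slope (arctanDivPrimitive y)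
    (fun z => Real.arctan (y / z)) (show x < x + 1 by linarith)
    (fun z hz => (hasDerivAt_arctanDivPrimitive y (hx.trans_le hz.1)).continuousAt.continuousWithinAt)
    (fun z hz => hasDerivAt_arctanDivPrimitive y (hx.trans hz.1))
  rw [add_sub_cancel_left, div_one] at h
  rw [← h]
  have hz0 : 0 < z := hx.trans hz.1
  refine ⟨Real.arctan_mono ?_, Real.arctan_mono ?_⟩
  · exact div_le_div_of_nonneg_left hy hz0 hz.2.le
  · exact div_le_div_of_nonneg_left hy hx hz.1.le

theorem sum_arctan_ge {y : ℝ} (hy : 0 ≤ y) (n : ℕ) :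
    arctanDivPrimitive y (1 / 4 + n) - arctanDivPrimitive y (1 / 4) ≤
      ∑ k ∈ Finset.range n, Real.arctan (y / (1 / 4 + k)) := by
  induction n with
  | zero => simp
  | succ n ih =>
    have h := (arctanDivPrimitive_sub_mem hy (x := 1 / 4 + n) (by positivity)).2
    rw [Finset.sum_range_succ]
    push_cast
    rw [← add_assoc]
    linarith

/-- Comparison of a decreasing summand with its integral; `π/2` covers the term `k = 0`. -/
theorem sum_arctan_le {y : ℝ} (hy : 0 ≤ y) (n : ℕ) :
    ∑ k ∈ Finset.range (n + 1), Real.arctan (y / (1 / 4 + k)) ≤ Real.pi / 2 +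
      (arctanDivPrimitive y (1 / 4 + n) - arctanDivPrimitive y (1 / 4)) := by
  induction n with
  | zero => simpa using (Real.arctan_lt_pi_div_two _).le
  | succ n ih =>
    have h := (arctanDivPrimitive_sub_mem hy (x := 1 / 4 + n) (by positivity)).1
    rw [Finset.sum_range_succ]
    push_cast
    rw [← add_assoc]
    linarith

theorem arctan_le_self {x : ℝ} (hx : 0 ≤ x) : Real.arctan x ≤ x := by
  have := Real.le_tan (Real.arctan_nonneg.2 hx) (Real.arctan_lt_pi_div_two x)
  rwa [Real.tan_arctan] at this

/-- At the upper end `X` of the comparison integral, `X arctan(y/X)` tends to `y` and `(y/2) log(X²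
+ y²)` cancels `y log n`. The multiple of `1/(n+1)` is an explicit error that vanishes in the limit.
-/
theorem gammaPhase_le {t : ℝ} (ht : 0 < t) :
    gammaPhase t ≤ arctanDivPrimitive (t / 2) (1 / 4) - t / 2 := by
  set y := t / 2 with hy
  have hy0 : 0 < y := by positivity
  have hlim : Tendsto (fun n : ℕ => arctanDivPrimitive y (1 / 4) - y + y ^ 3 * (1 / ((n : ℝ) + 1)))
      atTop (𝓝 (arctanDivPrimitive y (1 / 4) - y)) := by
    simpa using (tendsto_one_div_add_atTop_nhds_zero_nat (𝕜 := ℝ)).const_mul (y ^ 3) |>.const_add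
      (arctanDivPrimitive y (1 / 4) - y)
  refine le_of_tendsto_of_tendsto' (tendsto_eulerPhase t) hlim fun n => ?_
  have h1 := sum_arctan_ge hy0.le (n + 1 + 1)
  rw [eulerPhase, ← hy]
  set X : ℝ := 1 / 4 + ((n + 1 + 1 : ℕ) : ℝ) with hX
  have hX1 : (n : ℝ) + 1 ≤ X := by rw [hX]; push_cast; linarith
  have hn1 : (0 : ℝ) < (n : ℝ) + 1 := by positivity
  have hX0 : 0 < X := hn1.trans_le hX1
  have h2 : y * Real.log ((n + 1 : ℕ) : ℝ) ≤ y / 2 * Real.log (X ^ 2 + y ^ 2) := by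
    have h3 : Real.log (((n + 1 : ℕ) : ℝ) ^ 2) ≤ Real.log (X ^ 2 + y ^ 2) := by
      push_cast
      exact Real.log_le_log (by positivity) (by nlinarith [sq_nonneg y])
    rw [Real.log_pow] at h3
    push_cast at h3 ⊢
    nlinarith
  have h4 : y - y ^ 3 * (1 / ((n : ℝ) + 1)) ≤ X * Real.arctan (y / X) := by
    have h5 := (abs_le.1 (abs_arctan_sub_le (y / X))).1
    rw [abs_of_pos (by positivity)] at h5
    have h6 : X * (y / X - (y / X) ^ 3) ≤ X * Real.arctan (y / X) := by gcongr; linarith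
    have h7 : X * (y / X - (y / X) ^ 3) = y - y ^ 3 * (1 / X ^ 2) := by field_simp
    have h8 : 1 / X ^ 2 ≤ 1 / ((n : ℝ) + 1) := by
      refine one_div_le_one_div_of_le hn1 ?_
      have : (0 : ℝ) ≤ n := Nat.cast_nonneg n
      nlinarith
    have h9 : y ^ 3 * (1 / X ^ 2) ≤ y ^ 3 * (1 / ((n : ℝ) + 1)) := by gcongr
    linarith
  rw [arctanDivPrimitive] at h1
  linarith

theorem le_gammaPhase {t : ℝ} (ht : 0 < t) :
    arctanDivPrimitive (t / 2) (1 / 4) - t / 2 - Real.pi / 2 ≤ gammaPhase t := by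
  set y := t / 2 with hy
  have hy0 : 0 < y := by positivity
  have hlim : Tendsto (fun n : ℕ => arctanDivPrimitive y (1 / 4) - y - Real.pi / 2 -
      y / 2 * (1 + y ^ 2) * (1 / ((n : ℝ) + 1)))
      atTop (𝓝 (arctanDivPrimitive y (1 / 4) - y - Real.pi / 2)) := by
    simpa using (tendsto_one_div_add_atTop_nhds_zero_nat (𝕜 := ℝ)).const_mul (y / 2 * (1 + y ^ 2))
      |>.const_sub (arctanDivPrimitive y (1 / 4) - y - Real.pi / 2)
  refine le_of_tendsto_of_tendsto' hlim (tendsto_eulerPhase t) fun n => ?_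
  have h1 := sum_arctan_le hy0.le (n + 1)
  rw [eulerPhase, ← hy]
  have hn1 : (1 : ℝ) ≤ (n : ℝ) + 1 := by
    have : (0 : ℝ) ≤ n := Nat.cast_nonneg n
    linarith
  have hm0 : (0 : ℝ) < (n : ℝ) + 1 := by linarith
  have h1' : ((n + 1 : ℕ) : ℝ) = (n : ℝ) + 1 := by push_cast; ring
  rw [h1'] at h1 ⊢
  set m : ℝ := (n : ℝ) + 1 with hm
  have hX0 : 0 < 1 / 4 + m := by linarith
  have h2 : (1 / 4 + m) * Real.arctan (y / (1 / 4 + m)) ≤ y := by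
    have : Real.arctan (y / (1 / 4 + m)) ≤ y / (1 / 4 + m) := arctan_le_self (by positivity)
    calc _ ≤ (1 / 4 + m) * (y / (1 / 4 + m)) := by gcongr
      _ = y := by field_simp
  have h3 : Real.log ((1 / 4 + m) ^ 2 + y ^ 2) - 2 * Real.log m ≤ (1 + y ^ 2) * (1 / m) := by
    have h4 : 2 * Real.log m = Real.log (m ^ 2) := by rw [Real.log_pow]; push_cast; ring
    rw [h4, ← Real.log_div (by positivity) (by positivity)]
    refine (Real.log_le_sub_one_of_pos (by positivity)).trans ?_
    rw [div_sub_one (by positivity), mul_one_div, div_le_div_iff₀ (by positivity) (by positivity)]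
    nlinarith [sq_nonneg y, mul_nonneg (sq_nonneg y) (by nlinarith : 0 ≤ m * (m - 1)),
      mul_nonneg hm0.le (by nlinarith : 0 ≤ m * (m - 1)), mul_pos hm0 hm0]
  have h5 : y / 2 * (Real.log ((1 / 4 + m) ^ 2 + y ^ 2) - 2 * Real.log m) ≤
      y / 2 * ((1 + y ^ 2) * (1 / m)) := by gcongr
  rw [arctanDivPrimitive] at h1
  nlinarith

/-- With `y = t/2` the main term is `y log y - y - y log π = πτ(log τ - 1)`. The `2/5` covers `π/8 +
1/768`. The loss of `π/2` in the lower bound does no harm, since the main term is positive and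
exceeds `24`. -/
theorem abs_siegelTheta_le {t : ℝ} (ht : 16 * Real.pi < t) :
    |siegelTheta t| ≤
      Real.pi * (t / (2 * Real.pi)) * (Real.log (t / (2 * Real.pi)) - 1) + 2 / 5 := by
  have hpi := Real.pi_pos
  have hpi3 := Real.pi_gt_three
  have hpi4 : Real.pi < 3.15 := Real.pi_lt_d2
  have ht0 : 0 < t := by linarith
  set y := t / 2 with hy
  have hy24 : 24 < y := by rw [hy]; linarith
  have hτ : Real.pi * (t / (2 * Real.pi)) = y := by rw [hy]; field_simp
  have hτ' : t / (2 * Real.pi) = y / Real.pi := by rw [hy]; field_simp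
  have hL : Real.log (t / (2 * Real.pi)) = Real.log y - Real.log Real.pi := by
    rw [hτ', Real.log_div (by positivity) (by positivity)]
  have hL2 : 2 ≤ Real.log (t / (2 * Real.pi)) := by
    have h8 : (8 : ℝ) ≤ t / (2 * Real.pi) := by
      rw [le_div_iff₀ (by positivity)]; linarith
    have h9 : Real.log 8 = 3 * Real.log 2 := by
      rw [show (8 : ℝ) = 2 ^ 3 by norm_num, Real.log_pow]; push_cast; ring
    have := Real.log_le_log (by norm_num) h8
    linarith [Real.log_two_gt_d9]
  have hlow : y * Real.log y ≤ arctanDivPrimitive y (1 / 4) := by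
    rw [arctanDivPrimitive]
    have h1 : 2 * Real.log y ≤ Real.log ((1 / 4) ^ 2 + y ^ 2) := by
      have : 2 * Real.log y = Real.log (y ^ 2) := by rw [Real.log_pow]; push_cast; ring
      rw [this]
      exact Real.log_le_log (by positivity) (by norm_num)
    have h2 : 0 ≤ Real.arctan (y / (1 / 4)) := Real.arctan_nonneg.2 (by positivity)
    nlinarith
  have hup : arctanDivPrimitive y (1 / 4) ≤ y * Real.log y + 2 / 5 := by
    rw [arctanDivPrimitive]
    have h1 : Real.log ((1 / 4) ^ 2 + y ^ 2) - 2 * Real.log y ≤ 1 / (16 * y ^ 2) := by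
      have : 2 * Real.log y = Real.log (y ^ 2) := by rw [Real.log_pow]; push_cast; ring
      rw [this, ← Real.log_div (by positivity) (by positivity)]
      refine (Real.log_le_sub_one_of_pos (by positivity)).trans (le_of_eq ?_)
      field_simp
      ring
    have h2 := Real.arctan_lt_pi_div_two (y / (1 / 4))
    have h3 : y / 2 * (Real.log ((1 / 4) ^ 2 + y ^ 2) - 2 * Real.log y) ≤
        y / 2 * (1 / (16 * y ^ 2)) := by gcongr
    have h4 : y / 2 * (1 / (16 * y ^ 2)) = 1 / (32 * y) := by field_simp; ring
    have h5 : 1 / (32 * y) ≤ 1 / 768 := by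
      refine one_div_le_one_div_of_le (by norm_num) (by linarith)
    linarith
  have hg1 := gammaPhase_le ht0
  have hg2 := le_gammaPhase ht0
  rw [← hy] at hg1 hg2
  rw [siegelTheta_eq, ← hy, hτ, abs_le]
  have hyL : 2 * y ≤ y * Real.log (t / (2 * Real.pi)) := by nlinarith
  rw [hL] at hyL ⊢
  constructor <;> nlinarith

theorem exp_two_siegelTheta (t : ℝ) :
    Gammaℝ (1 / 2 + I * t) / Gammaℝ (1 - (1 / 2 + I * t)) =
      Complex.exp (2 * (I * siegelTheta t)) := by
  have hpi : (Real.pi : ℂ) ≠ 0 := ofReal_ne_zero.2 Real.pi_ne_zero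
  have hG := Gamma_eq_norm_mul_exp_gammaPhase t
  have hne : (‖Gamma (1 / 4 + I * t / 2)‖ : ℂ) ≠ 0 :=
    ofReal_ne_zero.2 (norm_ne_zero_iff.2 (Gamma_quarter_ne_zero t))
  have hconj : Gamma ((1 - (1 / 2 + I * t)) / 2) =
      ‖Gamma (1 / 4 + I * t / 2)‖ * Complex.exp (-(gammaPhase t * I)) := by
    have h1 : (1 - (1 / 2 + I * t)) / 2 = conj (1 / 4 + I * t / 2 : ℂ) := by
      simp only [map_add, map_div₀, map_mul, conj_I, conj_ofReal, map_one, map_ofNat]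
      ring
    rw [h1, Gamma_conj, hG, map_mul, ← exp_conj, conj_ofReal, map_mul, conj_I, conj_ofReal,
      norm_mul, norm_exp_ofReal_mul_I, norm_real, norm_norm, mul_one, mul_neg]
  rw [Gammaℝ_def, Gammaℝ_def, hconj, show (1 / 2 + I * t : ℂ) / 2 = 1 / 4 + I * t / 2 by ring, hG,
    norm_mul, norm_exp_ofReal_mul_I, norm_real, norm_norm, mul_one, cpow_def_of_ne_zero hpi,
    cpow_def_of_ne_zero hpi, ← ofReal_log Real.pi_pos.le, mul_left_comm, mul_left_comm (Complex.exp _),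
    mul_div_mul_left _ _ hne, ← Complex.exp_add, ← Complex.exp_add, ← Complex.exp_sub,
    siegelTheta_eq]
  congr 1
  push_cast
  ring

/-- The Riemann-Siegel formula for Hardy's function. -/
theorem hardyZ_eq {t : ℝ} (ht : 0 < t) :
    hardyZ t = ((2 * (Complex.exp (I * siegelTheta t) * rsR (1 / 2 + I * t)).re : ℝ) : ℂ) := by
  set s : ℂ := 1 / 2 + I * t with hs
  have him : s.im = t := by simp [hs]
  have h := riemann_siegel (s := s) (by rw [him]; exact ht)
  -- Here the Riemann-Siegel formula reads `e^(2iϑ)(ζ - ℛ) = conj ℛ`; multiplying by `e^(-iϑ)`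
  -- exhibits `Z` as a number plus its conjugate.
  have h1 : 1 - conj s = s := by
    simp only [hs, map_add, map_div₀, map_mul, conj_I, conj_ofReal, map_one, map_ofNat]
    ring
  rw [h1, ← Gammaℝ_div_Gammaℝ_one_sub (fun n hn => by
    rw [hn] at him
    simp at him
    exact ht.ne him), hs, exp_two_siegelTheta, ← hs] at h
  have h2 : Complex.exp (I * siegelTheta t) * Complex.exp (-(I * siegelTheta t)) = 1 := by
    rw [← Complex.exp_add, add_neg_cancel, Complex.exp_zero]
  have h3 : conj (Complex.exp (I * siegelTheta t)) = Complex.exp (-(I * siegelTheta t)) := by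
    rw [← exp_conj, map_mul, conj_I, conj_ofReal, neg_mul]
  have h4 : Complex.exp (2 * (I * siegelTheta t)) =
      Complex.exp (I * siegelTheta t) * Complex.exp (I * siegelTheta t) := by
    rw [← Complex.exp_add, two_mul]
  rw [← add_conj, map_mul, h3, hardyZ, ← hs]
  rw [h4] at h
  linear_combination Complex.exp (-(I * siegelTheta t)) * h -
    (Complex.exp (I * siegelTheta t) * (riemannZeta s - rsR s)) * h2

/-! ### Size of the auxiliary function on the critical line -/

theorem sq_norm_rsDenom (x : ℂ) :
    ‖rsDenom x‖ ^ 2 = 4 * (Real.sin (Real.pi * x.re) ^ 2 + Real.sinh (Real.pi * x.im) ^ 2) := by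
  have h : (Real.pi : ℂ) * x = ((Real.pi * x.re : ℝ) : ℂ) + ((Real.pi * x.im : ℝ) : ℂ) * I := by
    conv_lhs => rw [← re_add_im x]
    push_cast
    ring
  have hs : Complex.sin (Real.pi * x) =
      ((Real.sin (Real.pi * x.re) * Real.cosh (Real.pi * x.im) : ℝ) : ℂ) +
      ((Real.cos (Real.pi * x.re) * Real.sinh (Real.pi * x.im) : ℝ) : ℂ) * I := by
    rw [h, Complex.sin_add_mul_I]
    push_cast
    rfl
  rw [rsDenom_eq_sin, norm_mul, norm_mul, norm_I, mul_one, hs, mul_pow, Complex.norm_two,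
    Complex.sq_norm, normSq_add_mul_I]
  have h1 := Real.cosh_sq (Real.pi * x.im)
  have h2 := Real.sin_sq_add_cos_sq (Real.pi * x.re)
  linear_combination 4 * Real.sin (Real.pi * x.re) ^ 2 * h1 +
    4 * Real.sinh (Real.pi * x.im) ^ 2 * h2

/-- Below the threshold `28/5`, `sinh² ≥ sin²` makes the right side at least `4`. Above it, `4 sinh²
≥ e^(2|a|) - 2` suffices, because `28/5` exceeds `50/9`. -/
theorem four_cos_sq_add_sinh_sq_ge (a : ℝ) :
    16 / 25 * Real.exp (2 * |a|) ≤ 4 * (Real.cos a ^ 2 + Real.sinh a ^ 2) := by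
  rcases le_total (Real.exp (2 * |a|)) (28 / 5) with h | h
  · have h1 : a ^ 2 ≤ Real.sinh a ^ 2 := by
      rw [← sq_abs a, ← sq_abs (Real.sinh a), Real.abs_sinh]
      exact pow_le_pow_left₀ (abs_nonneg a) (Real.self_le_sinh_iff.2 (abs_nonneg a)) 2
    have h2 : Real.sin a ^ 2 ≤ a ^ 2 := by
      rw [← sq_abs a, ← sq_abs (Real.sin a)]
      exact pow_le_pow_left₀ (abs_nonneg _) Real.abs_sin_le_abs 2
    have h3 := Real.sin_sq_add_cos_sq a
    linarith
  · have h1 : 4 * Real.sinh a ^ 2 = Real.exp (2 * |a|) - 2 + Real.exp (-(2 * |a|)) := by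
      rw [← sq_abs (Real.sinh a), Real.abs_sinh, Real.sinh_eq]
      have e1 : Real.exp (2 * |a|) = Real.exp |a| ^ 2 := by
        rw [← Real.exp_nat_mul]; push_cast; rfl
      have e2 : Real.exp (-(2 * |a|)) = Real.exp (-|a|) ^ 2 := by
        rw [← Real.exp_nat_mul]; congr 1; push_cast; ring
      have e3 : Real.exp |a| * Real.exp (-|a|) = 1 := by
        rw [← Real.exp_add, add_neg_cancel, Real.exp_zero]
      rw [e1, e2]
      linear_combination -2 * e3
    have h2 := Real.exp_pos (-(2 * |a|))
    nlinarith [sq_nonneg (Real.cos a)]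

theorem norm_rsDenom_half_integer_ge {N : ℕ} {x : ℂ} (hx : x.re - x.im = N + 1 / 2) :
    4 / 5 * Real.exp (Real.pi * |x.im|) ≤ ‖rsDenom x‖ := by
  refine le_of_sq_le_sq ?_ (norm_nonneg _)
  have h1 : Real.sin (Real.pi * x.re) ^ 2 = Real.cos (Real.pi * x.im) ^ 2 := by
    have : Real.pi * x.re = (Real.pi * x.im + Real.pi / 2) + N * Real.pi := by
      rw [show x.re = x.im + (N + 1 / 2) by linarith]; ring
    rw [this, Real.sin_add_nat_mul_pi, Real.sin_add_pi_div_two, mul_pow, ← pow_mul, mul_comm N 2,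
      pow_mul]
    norm_num
  have h2 := four_cos_sq_add_sinh_sq_ge (Real.pi * x.im)
  rw [sq_norm_rsDenom, h1]
  refine le_trans (le_of_eq ?_) h2
  rw [mul_pow, ← Real.exp_nat_mul, abs_mul, abs_of_pos Real.pi_pos]
  norm_num

/-- The bound is the linearisation of the argument at the real point `c` of the line. Below the axis
it reduces to `tan w ≤ w/(1-w)`, that is, to `cos w ≥ 1 - w`. -/
theorem arg_le_div {c : ℝ} (hc : 0 < c) {x : ℂ} (hx : x.re - x.im = c) (hre : 0 < x.re) :
    x.arg ≤ x.im / c := by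
  have harg : x.arg = Real.arctan (x.im / x.re) := by
    have h := abs_lt.1 (abs_arg_lt_pi_div_two_iff.2 (Or.inl hre))
    rw [← Complex.tan_arg, Real.arctan_tan h.1 h.2]
  rw [harg]
  rcases le_total 0 x.im with h | h
  · refine (arctan_le_self (by positivity)).trans ?_
    exact div_le_div_of_nonneg_left h hc (by linarith)
  · set w : ℝ := -x.im / c with hw
    have hw0 : 0 ≤ w := div_nonneg (by linarith) hc.le
    have hw1 : w < 1 := by rw [hw, div_lt_one hc]; linarith
    have hwpi : w < Real.pi / 2 := by linarith [Real.pi_gt_three]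
    have hcos : 0 < Real.cos w := Real.cos_pos_of_mem_Ioo ⟨by linarith, hwpi⟩
    have him : x.im = -(c * w) := by rw [hw]; field_simp
    have hre' : x.re = c * (1 - w) := by rw [mul_sub, mul_one]; linarith
    have e1 : x.im / x.re = -(w / (1 - w)) := by
      rw [him, hre', neg_div, mul_div_mul_left _ _ hc.ne']
    have e2 : x.im / c = -w := by rw [him, neg_div, mul_div_cancel_left₀ _ hc.ne']
    rw [e1, e2, Real.arctan_neg, neg_le_neg_iff]
    have htan : Real.tan w ≤ w / (1 - w) := by
      rw [Real.tan_eq_sin_div_cos, div_le_div_iff₀ hcos (by linarith)]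
      have h1 := Real.sin_le hw0
      have h2 := Real.one_sub_sq_div_two_le_cos (x := w)
      have h3 : Real.sin w * (1 - w) ≤ w * (1 - w) :=
        mul_le_mul_of_nonneg_right h1 (by linarith)
      have h4 : w * (1 - w) ≤ w * Real.cos w := mul_le_mul_of_nonneg_left (by nlinarith) hw0
      linarith
    calc w = Real.arctan (Real.tan w) := (Real.arctan_tan (by linarith) hwpi).symm
      _ ≤ _ := Real.arctan_mono htan

theorem arg_le_neg_pi_div_two {x : ℂ} (hre : x.re ≤ 0) (him : x.im < 0) :
    x.arg ≤ -(Real.pi / 2) := by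
  rcases hre.lt_or_eq with h | h
  · by_contra hcon
    push Not at hcon
    rcases neg_pi_div_two_le_arg_iff.1 hcon.le with h1 | h1 <;> linarith
  · rw [arg_eq_neg_pi_div_two_iff.2 ⟨h, him⟩]

/-- Truncating a slope by one half. -/
theorem exists_slope {D : ℝ} (h1 : -(11 / 10) ≤ D) (h2 : D ≤ 11 / 10) :
    ∃ E : ℝ, E ^ 2 ≤ 9 / 25 ∧ ∀ p : ℝ, D * p - |p| / 2 ≤ E * p := by
  rcases le_total (1 / 2) D with h | h
  · refine ⟨D - 1 / 2, by nlinarith, fun p => ?_⟩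
    linarith [le_abs_self p]
  rcases le_total D (-1 / 2) with h' | h'
  · refine ⟨D + 1 / 2, by nlinarith, fun p => ?_⟩
    linarith [neg_abs_le p]
  · refine ⟨0, by norm_num, fun p => ?_⟩
    have : D * p ≤ |D| * |p| := by rw [← abs_mul]; exact le_abs_self _
    have h3 : |D| ≤ 1 / 2 := abs_le.2 ⟨by linarith, h⟩
    nlinarith [abs_nonneg p]

theorem norm_rsIntegrand_eq (t : ℝ) {x : ℂ} (hx : x ≠ 0) :
    ‖x ^ (-(1 / 2 + I * t)) * rsKernel x‖ =
      (√‖x‖)⁻¹ * Real.exp (t * x.arg - 2 * Real.pi * x.re * x.im) / ‖rsDenom x‖ := by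
  have hpos : 0 < ‖x‖ := norm_pos_iff.2 hx
  rw [norm_mul, norm_cpow_of_ne_zero hx, rsKernel, norm_div, norm_exp_pi_sq]
  have e1 : (-(1 / 2 + I * t) : ℂ).re = -(1 / 2) := by simp
  have e2 : (-(1 / 2 + I * t) : ℂ).im = -t := by simp
  rw [e1, e2, Real.rpow_neg hpos.le, ← Real.sqrt_eq_rpow, mul_neg, Real.exp_neg, div_inv_eq_mul,
    sub_eq_add_neg, Real.exp_add, mul_comm t]
  ring

/-- The line stays at distance `c/√2 ≥ 5/(2√2) > 1.7663` from the origin. -/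
theorem inv_sqrt_norm_le {c : ℝ} (hc : 5 / 2 ≤ c) {x : ℂ} (hx : x.re - x.im = c) :
    (√‖x‖)⁻¹ ≤ 753 / 1000 := by
  have h1 : (1.7663 : ℝ) ≤ ‖x‖ := by
    refine le_of_sq_le_sq ?_ (norm_nonneg _)
    rw [Complex.sq_norm, normSq_apply]
    nlinarith [sq_nonneg (x.re + x.im)]
  have h2 : (1.329 : ℝ) ≤ √‖x‖ := Real.le_sqrt_of_sq_le (by norm_num at h1 ⊢; linarith)
  rw [inv_le_comm₀ (by linarith) (by norm_num)]
  refine le_trans ?_ h2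
  norm_num

theorem exp_neg_seven_le : Real.exp (-7) ≤ 1 / 1000 := by
  have h := Real.exp_one_gt_d9
  rw [show (-7 : ℝ) = ((7 : ℕ) : ℝ) * (-1) by norm_num, Real.exp_nat_mul, Real.exp_neg, inv_pow,
    ← one_div]
  refine one_div_le_one_div_of_le (by norm_num) ?_
  calc (1000 : ℝ) ≤ 2.7182818283 ^ 7 := by norm_num
    _ ≤ _ := by gcongr

/-- Pointwise estimate on the line through `N + 1/2`, near the saddle point. -/
theorem norm_rsIntegrand_le {t τ : ℝ} (htτ : t = 2 * Real.pi * τ) (hτ : 8 < τ) {N : ℕ}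
    (hN : (N : ℝ) ≤ √τ) (hN' : √τ < N + 1) {E : ℝ}
    (hE : ∀ p : ℝ, (τ / (N + 1 / 2) - (N + 1 / 2)) * p - |p| / 2 ≤ E * p) {x : ℂ}
    (hx : x.re - x.im = N + 1 / 2) :
    ‖x ^ (-(1 / 2 + I * t)) * rsKernel x‖ ≤ 753 / 800 *
      (Real.exp (2 * Real.pi * (E * x.im - x.im ^ 2)) + 1 / 1000 * Real.exp (-Real.pi * x.im ^ 2)) := by
  have hpi := Real.pi_pos
  have hpi3 := Real.pi_gt_three
  have hr2 : √τ ^ 2 = τ := Real.sq_sqrt (by linarith)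
  have hr : (2.82 : ℝ) ≤ √τ := Real.le_sqrt_of_sq_le (by norm_num; linarith)
  have hN2 : (2 : ℝ) ≤ N := by
    have h1 : (1 : ℝ) < N := by linarith
    have h2 : 1 < N := by exact_mod_cast h1
    exact_mod_cast h2
  set c : ℝ := (N : ℝ) + 1 / 2 with hc
  have hc0 : 0 < c := by positivity
  have hx0 : x ≠ 0 := by
    rintro rfl
    simp at hx
    linarith
  set p := x.im with hp
  have hre : x.re = c + p := by linarith
  have hden := norm_rsDenom_half_integer_ge hx
  have hdpos : 0 < 4 / 5 * Real.exp (Real.pi * |p|) := by positivity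
  have hsq := inv_sqrt_norm_le (by rw [hc]; linarith) hx
  rw [norm_rsIntegrand_eq t hx0]
  have hstep : (√‖x‖)⁻¹ * Real.exp (t * x.arg - 2 * Real.pi * x.re * p) / ‖rsDenom x‖ ≤
      753 / 1000 * Real.exp (t * x.arg - 2 * Real.pi * x.re * p) /
        (4 / 5 * Real.exp (Real.pi * |p|)) := by gcongr
  refine hstep.trans ?_
  have heq : 753 / 1000 * Real.exp (t * x.arg - 2 * Real.pi * x.re * p) /
        (4 / 5 * Real.exp (Real.pi * |p|)) =
      753 / 800 * Real.exp (t * x.arg - 2 * Real.pi * x.re * p - Real.pi * |p|) := by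
    rw [Real.exp_sub _ (Real.pi * |p|)]
    field_simp
    ring
  rw [heq]
  refine mul_le_mul_of_nonneg_left ?_ (by norm_num)
  -- For `x.re > 0` the phase is linearised, and the decay `e^(-π|p|)` of the denominator reduces
  -- the slope to `E`. For `x.re ≤ 0` one has `p < 0` and `arg x ≤ -π/2`, so `e^(t arg x)` is tiny
  -- and the point falls under the tail term.
  rcases lt_or_ge 0 x.re with h | h
  · have harg := arg_le_div hc0 hx h
    have h1 : t * x.arg ≤ 2 * Real.pi * (τ / c * p) := by
      rw [htτ]
      calc 2 * Real.pi * τ * x.arg ≤ 2 * Real.pi * τ * (p / c) := by gcongr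
        _ = _ := by ring
    have h2 := hE p
    have h3 : t * x.arg - 2 * Real.pi * x.re * p - Real.pi * |p| ≤
        2 * Real.pi * (E * p - p ^ 2) := by
      rw [hre]
      have h4 : 2 * Real.pi * ((τ / c - c) * p - |p| / 2) ≤ 2 * Real.pi * (E * p) := by gcongr
      linarith
    have h5 := Real.exp_le_exp.2 h3
    have h6 := Real.exp_pos (-Real.pi * p ^ 2)
    linarith
  · have hpneg : p < 0 := by linarith
    have harg := arg_le_neg_pi_div_two h hpneg
    have hcτ : c ^ 2 ≤ 1.4 * τ := by
      rw [← hr2]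
      have : c ≤ √τ + 1 / 2 := by rw [hc]; linarith
      nlinarith
    have h1 : t * x.arg ≤ 2 * Real.pi * (-(τ * (3 / 2))) := by
      rw [htτ]
      have : x.arg ≤ -(3 / 2) := by linarith
      calc 2 * Real.pi * τ * x.arg ≤ 2 * Real.pi * τ * (-(3 / 2)) := by gcongr
        _ = _ := by ring
    have h3 : t * x.arg - 2 * Real.pi * x.re * p - Real.pi * |p| ≤ -7 + -Real.pi * p ^ 2 := by
      -- Completing the square, `-cp - p²/2 ≤ c²/2 ≤ 0.7τ`, and `1.5τ - 6 ≥ 0.7τ` since `τ > 8`.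
      have h4 : -(τ * (3 / 2)) - (c + p) * p ≤ -(p ^ 2 / 2) - 6 := by
        nlinarith [sq_nonneg (c + p)]
      have h5 : 2 * Real.pi * (-(τ * (3 / 2)) - (c + p) * p) ≤
        2 * Real.pi * (-(p ^ 2 / 2) - 6) := by gcongr
      rw [hre]
      have h6 : 0 ≤ Real.pi * |p| := by positivity
      linarith
    have h5 := Real.exp_le_exp.2 h3
    rw [Real.exp_add] at h5
    have h6 := Real.exp_pos (2 * Real.pi * (E * p - p ^ 2))
    have h7 : Real.exp (-7) * Real.exp (-Real.pi * p ^ 2) ≤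
        1 / 1000 * Real.exp (-Real.pi * p ^ 2) := by gcongr; exact exp_neg_seven_le
    linarith

/-! ### Integrating the pointwise bound, and the main sum. -/

theorem integral_exp_quadratic_slope (E : ℝ) :
    (Integrable fun u : ℝ => Real.exp (2 * Real.pi * (E * (-(√2 / 2 * u)) - (-(√2 / 2 * u)) ^ 2))) ∧
    ∫ u : ℝ, Real.exp (2 * Real.pi * (E * (-(√2 / 2 * u)) - (-(√2 / 2 * u)) ^ 2)) =
      Real.exp (Real.pi * E ^ 2 / 2) := by
  have hr2 : √2 ^ 2 = 2 := Real.sq_sqrt (by norm_num)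
  have h : ∀ u : ℝ, Real.exp (2 * Real.pi * (E * (-(√2 / 2 * u)) - (-(√2 / 2 * u)) ^ 2)) =
      Real.exp (Real.pi * E ^ 2 / 2) * Real.exp (-Real.pi * (u + √2 / 2 * E) ^ 2) := by
    intro u
    rw [← Real.exp_add]
    congr 1
    linear_combination (-Real.pi * u ^ 2 / 2 + Real.pi * E ^ 2 / 4) * hr2
  simp_rw [h]
  constructor
  · exact ((integrable_exp_neg_mul_sq Real.pi_pos).comp_add_right (√2 / 2 * E)).const_mul _
  · rw [integral_const_mul, integral_add_right_eq_self fun u : ℝ => Real.exp (-Real.pi * u ^ 2),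
      integral_gaussian, div_self Real.pi_ne_zero, Real.sqrt_one, mul_one]

theorem integral_exp_tail :
    (Integrable fun u : ℝ => Real.exp (-Real.pi * (-(√2 / 2 * u)) ^ 2)) ∧
    ∫ u : ℝ, Real.exp (-Real.pi * (-(√2 / 2 * u)) ^ 2) = √2 := by
  have hr2 : √2 ^ 2 = 2 := Real.sq_sqrt (by norm_num)
  have h : ∀ u : ℝ, Real.exp (-Real.pi * (-(√2 / 2 * u)) ^ 2) =
      Real.exp (-(Real.pi / 2) * u ^ 2) := by
    intro u
    congr 1
    linear_combination (-Real.pi * u ^ 2 / 4) * hr2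
  simp_rw [h]
  refine ⟨integrable_exp_neg_mul_sq (by positivity), ?_⟩
  rw [integral_gaussian]
  congr 1
  field_simp

theorem exp_le_of_sq_le {E : ℝ} (hE : E ^ 2 ≤ 9 / 25) : Real.exp (Real.pi * E ^ 2 / 2) ≤ 1.78 := by
  have h1 : Real.pi * E ^ 2 / 2 ≤ 0.5672 := by
    have := Real.pi_lt_d2
    nlinarith [sq_nonneg E]
  refine (Real.exp_le_exp.2 h1).trans ?_
  have h2 : Real.exp 0.5672 = Real.exp 1 * Real.exp (-0.4328) := by
    rw [← Real.exp_add]; norm_num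
  have h3 := Real.exp_one_lt_d9
  have h4 : Real.exp (-0.4328) ≤ 0.654 := by
    rw [Real.exp_neg]
    rw [inv_le_comm₀ (Real.exp_pos _) (by norm_num)]
    have h7 := Real.sum_le_exp_of_nonneg (x := (0.4328 : ℝ)) (by norm_num) 5
    refine le_trans ?_ h7
    norm_num [Finset.sum_range_succ, Nat.factorial]
  rw [h2]
  nlinarith [Real.exp_pos (-0.4328)]

theorem sum_rpow_le {N : ℕ} (hN : 1 ≤ N) (t : ℝ) :
    ‖∑ n ∈ Finset.range N, ((n + 1 : ℕ) : ℂ) ^ (-(1 / 2 + I * t))‖ ≤ 2 * √N - 1 := by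
  have hterm : ∀ n : ℕ, ‖((n + 1 : ℕ) : ℂ) ^ (-(1 / 2 + I * t))‖ = 1 / √((n + 1 : ℕ) : ℝ) := by
    intro n
    have hpos : (0 : ℝ) < ((n + 1 : ℕ) : ℝ) := by positivity
    rw [← ofReal_natCast, norm_cpow_eq_rpow_re_of_pos hpos]
    have e1 : (-(1 / 2 + I * t) : ℂ).re = -(1 / 2) := by simp
    rw [e1, Real.rpow_neg hpos.le, ← Real.sqrt_eq_rpow, one_div]
  refine (norm_sum_le _ _).trans ?_
  simp_rw [hterm]
  induction N, hN using Nat.le_induction with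
  | base => norm_num
  | succ N hN ih =>
    rw [Finset.sum_range_succ]
    have h1 : 1 / √((N + 1 : ℕ) : ℝ) ≤ 2 * (√((N + 1 : ℕ) : ℝ) - √N) := by
      have ha : 0 < √((N + 1 : ℕ) : ℝ) := Real.sqrt_pos.2 (by positivity)
      have hb : √((N + 1 : ℕ) : ℝ) ^ 2 = N + 1 := by
        rw [Real.sq_sqrt (by positivity)]; push_cast; ring
      have hc : √(N : ℝ) ^ 2 = N := Real.sq_sqrt (by positivity)
      rw [div_le_iff₀ ha]
      nlinarith [sq_nonneg (√((N + 1 : ℕ) : ℝ) - √N)]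
    linarith

/-- The exponent `-it log x + πix²` has its saddle point at `√τ`, and `N = ⌊√τ⌋` keeps the line
through `N + 1/2` within `1/2` of it. The remainder is then at most `17/10`, and the main sum is at
most `2√N - 1`. -/
theorem norm_rsR_le {t τ : ℝ} (htτ : t = 2 * Real.pi * τ) (hτ : 8 < τ) :
    ‖rsR (1 / 2 + I * t)‖ ≤ 2 * √(√τ) + 7 / 10 := by
  set N : ℕ := ⌊√τ⌋₊ with hNdef
  have hN : (N : ℝ) ≤ √τ := Nat.floor_le (Real.sqrt_nonneg _)
  have hN' : √τ < N + 1 := Nat.lt_floor_add_one _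
  have hr2 : √τ ^ 2 = τ := Real.sq_sqrt (by linarith)
  have hr : (2.82 : ℝ) ≤ √τ := Real.le_sqrt_of_sq_le (by norm_num; linarith)
  have hN2 : (2 : ℝ) ≤ N := by
    have h1 : (1 : ℝ) < N := by linarith
    have h2 : 1 < N := by exact_mod_cast h1
    exact_mod_cast h2
  have hc0 : (0 : ℝ) < N + 1 / 2 := by linarith
  have hD : τ / ((N : ℝ) + 1 / 2) - (N + 1 / 2) = (τ - (N + 1 / 2) ^ 2) / (N + 1 / 2) := by
    field_simp
  -- With `c = N + 1/2 ≥ 5/2` and `|√τ - c| ≤ 1/2`, the slope satisfies `|D| ≤ 1 + 1/(4c) ≤ 11/10`.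
  obtain ⟨E, hE2, hE⟩ := exists_slope (D := τ / ((N : ℝ) + 1 / 2) - (N + 1 / 2))
    (by rw [hD, le_div_iff₀ hc0]; nlinarith) (by rw [hD, div_le_iff₀ hc0]; nlinarith)
  have hrem : ‖diagInt (fun x => x ^ (-(1 / 2 + I * t)) * rsKernel x) (N + 1 / 2)‖ ≤ 17 / 10 := by
    obtain ⟨hi1, hv1⟩ := integral_exp_quadratic_slope E
    obtain ⟨hi2, hv2⟩ := integral_exp_tail
    have hb := norm_integral_le_of_norm_le
      (f := fun u : ℝ => ((((N : ℝ) + 1 / 2 : ℝ) : ℂ) - diagDir * u) ^ (-(1 / 2 + I * t)) *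
        rsKernel ((((N : ℝ) + 1 / 2 : ℝ) : ℂ) - diagDir * u) * (-diagDir))
      ((hi1.add (hi2.const_mul (1 / 1000))).const_mul (753 / 800))
      (Eventually.of_forall fun u => by
        rw [norm_mul, norm_neg, norm_diagDir, mul_one]
        have h := norm_rsIntegrand_le htτ hτ hN hN' hE
          (x := (((N : ℝ) + 1 / 2 : ℝ) : ℂ) - diagDir * u)
          (by rw [diagPoint_re, diagPoint_im]; ring)
        rw [diagPoint_im] at h
        exact h)
    rw [diagInt]
    refine hb.trans ?_
    simp only [Pi.add_apply]
    rw [integral_const_mul, integral_add hi1 (hi2.const_mul _), hv1, integral_const_mul, hv2]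
    have h1 := exp_le_of_sq_le hE2
    have h2 : √2 ≤ 2 := by rw [Real.sqrt_le_left (by norm_num)]; norm_num
    linarith
  have hsum := sum_rpow_le (N := N) (by exact_mod_cast (by linarith : (1 : ℝ) ≤ N)) t
  have hsq : √(N : ℝ) ≤ √(√τ) := Real.sqrt_le_sqrt hN
  rw [rsR_eq_sum_add_diagInt _ N]
  refine (norm_add_le _ _).trans ?_
  linarith

/-! ### Error analysis -/

/-- The quotient `(L-1)e^(-L/4)/L` is largest at `L = (1+√17)/2 ≈ 2.56`, so the exponential is
replaced by its tangent at `0.64 = 2.56/4`. -/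
theorem sub_one_le_mul_exp_quarter {L : ℝ} (hL : 2 ≤ L) :
    L - 1 ≤ 0.322 * Real.exp (L / 4) * L := by
  have h1 : (1.896 : ℝ) ≤ Real.exp 0.64 := by
    refine le_trans ?_ (Real.sum_le_exp_of_nonneg (x := (0.64 : ℝ)) (by norm_num) 6)
    norm_num [Finset.sum_range_succ, Nat.factorial]
  have h2 : Real.exp (L / 4) = Real.exp 0.64 * Real.exp (L / 4 - 0.64) := by
    rw [← Real.exp_add]; ring_nf
  have h3 := Real.add_one_le_exp (L / 4 - 0.64)
  have h4 : 1.896 * (L / 4 - 0.64 + 1) ≤ Real.exp (L / 4) := by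
    rw [h2]
    exact mul_le_mul h1 h3 (by linarith) (Real.exp_pos _).le
  have h5 : 0.322 * (1.896 * (L / 4 - 0.64 + 1)) * L ≤ 0.322 * Real.exp (L / 4) * L := by
    gcongr
  nlinarith [sq_nonneg (L - 2.56)]

/-- The precisions suffice: in terms of `q = (t / 2π) ^ (1/4)` and `L = log (t / 2π)`. -/
theorem error_budget {q L R Θ : ℝ} (hq : 8 < q ^ 4) (hq0 : 0 < q) (hL : 2.079 ≤ L)
    (hqL : Real.exp (L / 4) = q) (hR0 : 0 ≤ R) (hR : R ≤ 2 * q + 7 / 10)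
    (hΘ : Θ ≤ Real.pi * q ^ 4 * (L - 1) + 2 / 5) :
    (6.1 * R + 1.1) / (12 * q ^ 4 * L) + Θ * R / (3 * q ^ 6 * L) < 1 := by
  have hL0 : 0 < L := by linarith
  have hpi : Real.pi < 3.1416 := Real.pi_lt_d4
  have hpi0 := Real.pi_pos
  have hq1 : 1.68 < q := by
    by_contra h
    push Not at h
    have : q ^ 4 ≤ 1.68 ^ 4 := by gcongr
    norm_num at this
    linarith
  have hK := sub_one_le_mul_exp_quarter (L := L) (by linarith)
  rw [hqL] at hK
  have hq3 : 4.74 ≤ q ^ 3 := by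
    have : (1.68 : ℝ) ^ 3 ≤ q ^ 3 := by gcongr
    norm_num at this
    linarith
  have h1 : (6.1 * R + 1.1) / (12 * q ^ 4 * L) ≤ 0.132 := by
    rw [div_le_iff₀ (by positivity)]
    have e1 : 8 * 2.079 ≤ q ^ 4 * L := by nlinarith
    have e2 : 4.74 * 2.079 * q ≤ q ^ 4 * L := by
      have : q ^ 4 * L = q ^ 3 * L * q := by ring
      rw [this]
      have : 4.74 * 2.079 ≤ q ^ 3 * L := by nlinarith
      nlinarith
    nlinarith
  -- From `q > 1.68`, just below `8^(1/4)`. The shares are then `0.132` for the product and `0.835`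
  -- for the error of `θ`.
  have hlin : 2 * q + 7 / 10 ≤ 2.417 * q := by nlinarith
  have hR' : R ≤ 2.417 * q := hR.trans hlin
  have h2 : Θ * R ≤ (Real.pi * q ^ 4 * (L - 1) + 2 / 5) * (2.417 * q) := by
    have hnn : 0 ≤ Real.pi * q ^ 4 * (L - 1) + 2 / 5 := by
      have : 0 ≤ L - 1 := by linarith
      positivity
    exact mul_le_mul hΘ hR' hR0 hnn
  have h3 : Θ * R / (3 * q ^ 6 * L) ≤ 0.835 := by
    rw [div_le_iff₀ (by positivity)]
    refine h2.trans ?_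
    have e1 : Real.pi * q ^ 4 * (L - 1) * (2.417 * q) ≤ 2.446 * (q ^ 6 * L) := by
      calc Real.pi * q ^ 4 * (L - 1) * (2.417 * q)
          ≤ 3.1416 * q ^ 4 * (0.322 * q * L) * (2.417 * q) := by
            gcongr
            linarith
        _ = (3.1416 * 0.322 * 2.417) * (q ^ 6 * L) := by ring
        _ ≤ _ := by gcongr; norm_num
    have e2 : 2 / 5 * (2.417 * q) ≤ 0.05 * (q ^ 6 * L) := by
      have e3 : q ^ 6 * L = q * (q * q ^ 4 * L) := by ring
      have e4 : 20 ≤ q * q ^ 4 * L := by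
        have : 12 ≤ q * q ^ 4 := by nlinarith
        nlinarith
      rw [e3]
      nlinarith
    nlinarith
  linarith

/-- The extra bit in the working precision pays for the factor `2` of `2 Re z`. -/
theorem two_zpow_neg_mul_lt {w d : ℕ} {A : ℝ} (hA : 0 < A) (hd : (d : ℤ) = (w : ℤ) + 1 + mag A) :
    2 * (2 : ℝ) ^ (-(d : ℤ)) * A < (2 : ℝ) ^ (-(w : ℤ)) := by
  have h := lt_two_zpow_mag A
  rw [abs_of_pos hA] at h
  have e : (2 : ℝ) ^ (-(w : ℤ)) = 2 * (2 : ℝ) ^ (-(d : ℤ)) * 2 ^ mag A := by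
    rw [hd, show -((w : ℤ) + 1 + mag A) = -(w : ℤ) + -1 + -mag A by ring,
      zpow_add₀ two_ne_zero, zpow_add₀ two_ne_zero, zpow_neg 2 (mag A)]
    field_simp
  rw [e]
  gcongr

theorem norm_exp_I_mul_sub_le (a b : ℝ) :
    ‖Complex.exp (I * a) - Complex.exp (I * b)‖ ≤ |a - b| := by
  have h : Complex.exp (I * a) - Complex.exp (I * b) =
      Complex.exp (I * b) * (Complex.exp (I * ((a - b : ℝ) : ℂ)) - 1) := by
    rw [mul_sub, ← Complex.exp_add, mul_one]
    congr 2
    push_cast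
    ring
  rw [h, norm_mul, mul_comm I (b : ℂ), norm_exp_ofReal_mul_I, one_mul]
  exact Real.norm_exp_I_mul_ofReal_sub_one_le

/-- Error of the floating point product of approximations of `e ^ (i θ)` and `r`. -/
theorem abs_re_fpCMul_sub_re_le {d : ℕ} {ε : ℝ} (hε : ε = (2 : ℝ) ^ (-(d : ℤ)))
    (hε1 : ε ≤ 1 / 500) {a b r : ℂ} {θ φ δ : ℝ} (ha : ‖a - Complex.exp (I * φ)‖ ≤ ε)
    (hb : ‖b - r‖ ≤ ε) (hφ : |φ - θ| ≤ δ) :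
    |(fpCMul d a b).re - (Complex.exp (I * θ) * r).re| ≤
      ε * (6.1 * ‖r‖ + 1.1) + δ * ‖r‖ := by
  have hε0 : 0 < ε := by rw [hε]; positivity
  have hfp := abs_re_fpCMul_sub_le d a b
  rw [← hε] at hfp
  have hEφ : ‖Complex.exp (I * φ)‖ = 1 := by rw [mul_comm, norm_exp_ofReal_mul_I]
  have hna : ‖a‖ ≤ 1 + ε := by
    have := norm_sub_norm_le a (Complex.exp (I * φ))
    linarith
  have hnb : ‖b‖ ≤ ‖r‖ + ε := by
    have := norm_sub_norm_le b r
    linarith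
  have hpow : (1 + ε) ^ 5 - 1 ≤ 5.03 * ε := by
    have h2 : ε ^ 2 ≤ ε * (1 / 500) := by nlinarith
    have h3 : ε ^ 3 ≤ ε * (1 / 500) := by nlinarith
    have h4 : ε ^ 4 ≤ ε * (1 / 500) ^ 2 := by nlinarith
    have h5 : ε ^ 5 ≤ ε * (1 / 500) ^ 2 := by nlinarith
    nlinarith
  have hpow0 : 0 ≤ (1 + ε) ^ 5 - 1 := by
    have : (1 : ℝ) ≤ (1 + ε) ^ 5 := one_le_pow₀ (by linarith)
    linarith
  have hfirst : |(fpCMul d a b).re - (a * b).re| ≤ 5.05 * ε * (‖r‖ + ε) := by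
    refine hfp.trans ?_
    calc ((1 + ε) ^ 5 - 1) * (‖a‖ * ‖b‖) ≤ (5.03 * ε) * ((1 + ε) * (‖r‖ + ε)) := by gcongr
      _ = (5.03 * (1 + ε)) * (ε * (‖r‖ + ε)) := by ring
      _ ≤ 5.05 * (ε * (‖r‖ + ε)) := by gcongr; linarith
      _ = _ := by ring
  have hsecond : ‖a * b - Complex.exp (I * θ) * r‖ ≤ ε * (‖r‖ + ε) + ε + δ * ‖r‖ := by
    have e : a * b - Complex.exp (I * θ) * r = (a - Complex.exp (I * φ)) * b +
        Complex.exp (I * φ) * (b - r) + (Complex.exp (I * φ) - Complex.exp (I * θ)) * r := by ring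
    rw [e]
    refine (norm_add₃_le).trans ?_
    rw [norm_mul, norm_mul, norm_mul, hEφ, one_mul]
    have := (norm_exp_I_mul_sub_le φ θ).trans hφ
    gcongr
  have hre : |(a * b).re - (Complex.exp (I * θ) * r).re| ≤ ε * (‖r‖ + ε) + ε + δ * ‖r‖ := by
    rw [← sub_re]
    exact (abs_re_le_norm _).trans hsecond
  -- Apart from `δ‖r‖` the total is `ε(6.05‖r‖ + 1 + 6.05ε)`, and `6.05ε < 0.1`.
  have htri := abs_sub_le (fpCMul d a b).re (a * b).re (Complex.exp (I * θ) * r).re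
  have hr0 := norm_nonneg r
  nlinarith [mul_nonneg hε0.le hr0]

theorem abs_two_mul_re_fpCMul_sub_lt {t : ℝ} (ht : 16 * Real.pi < t)
    {wpinitial wptheta wpz : ℕ} (hwp : 1 ≤ wpinitial)
    (hwptheta : (wptheta : ℤ) = (wpinitial : ℤ) + 1 +
      mag (3 * (t / (2 * Real.pi)) ^ (3 / 2 : ℝ) * Real.log (t / (2 * Real.pi))))
    (hwpz : (wpz : ℤ) = (wpinitial : ℤ) + 1 +
      mag (12 * (t / (2 * Real.pi)) * Real.log (t / (2 * Real.pi))))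
    {theta : ℝ} (htheta : |theta - siegelTheta t| ≤ (2 : ℝ) ^ (-(wptheta : ℤ)) * |siegelTheta t|)
    {rzeta : ℂ} (hrzeta : ‖rzeta - rsR (1 / 2 + I * t)‖ ≤ (2 : ℝ) ^ (-(wpz : ℤ)))
    {etheta : ℂ} (hetheta : ‖etheta - Complex.exp (I * theta)‖ ≤ (2 : ℝ) ^ (-(wpz : ℤ))) :
    |2 * (fpCMul wpz etheta rzeta).re -
        2 * (Complex.exp (I * siegelTheta t) * rsR (1 / 2 + I * t)).re|
      < (2 : ℝ) ^ (-(wpinitial : ℤ)) := by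
  have hpi := Real.pi_pos
  have hΘ := abs_siegelTheta_le ht
  set τ : ℝ := t / (2 * Real.pi) with hτdef
  have htτ : t = 2 * Real.pi * τ := by rw [hτdef]; field_simp
  have hτ : 8 < τ := by rw [hτdef, lt_div_iff₀ (by positivity)]; linarith
  have hR := norm_rsR_le htτ hτ
  set q : ℝ := √(√τ) with hq
  have hq0 : 0 < q := Real.sqrt_pos.2 (Real.sqrt_pos.2 (by linarith))
  have hq4 : q ^ 4 = τ := by
    rw [show q ^ 4 = (q ^ 2) ^ 2 by ring, hq, Real.sq_sqrt (Real.sqrt_nonneg _),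
      Real.sq_sqrt (by linarith)]
  have hq6 : τ ^ (3 / 2 : ℝ) = q ^ 6 := by
    rw [← hq4, ← Real.rpow_natCast, ← Real.rpow_natCast, ← Real.rpow_mul hq0.le]
    norm_num
  set L : ℝ := Real.log τ with hLdef
  have hL : 2.079 ≤ L := by
    have h8 : Real.log 8 = 3 * Real.log 2 := by
      rw [show (8 : ℝ) = 2 ^ 3 by norm_num, Real.log_pow]; push_cast; ring
    have h9 := Real.log_le_log (by norm_num) hτ.le
    have h10 := Real.log_two_gt_d9
    rw [← hLdef] at h9
    norm_num at h10 ⊢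
    linarith
  have hqL : Real.exp (L / 4) = q := by
    rw [hLdef, ← hq4, Real.log_pow]
    push_cast
    rw [mul_div_cancel_left₀ _ (by norm_num), Real.exp_log hq0]
  have hL0 : 0 < L := by linarith
  set r := rsR (1 / 2 + I * t) with hr
  set W : ℝ := (2 : ℝ) ^ (-(wpinitial : ℤ)) with hW
  have hW0 : 0 < W := by positivity
  have hε := two_zpow_neg_mul_lt (A := 12 * τ * L) (by positivity) hwpz
  have hε' := two_zpow_neg_mul_lt (A := 3 * τ ^ (3 / 2 : ℝ) * L) (by positivity) hwptheta
  rw [← hW] at hε hε'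
  rw [hq6] at hε'
  rw [← hq4] at hε hΘ
  set ε : ℝ := (2 : ℝ) ^ (-(wpz : ℤ)) with hεdef
  set ε' : ℝ := (2 : ℝ) ^ (-(wptheta : ℤ)) with hεdef'
  have hε0 : 0 < ε := by positivity
  have hε0' : 0 < ε' := by positivity
  have hq48 : 8 < q ^ 4 := by rw [hq4]; exact hτ
  -- At least one bit of initial precision gives `2ε·192 < 1/2`, hence `ε < 1/768`.
  have hε1 : ε ≤ 1 / 500 := by
    have hW2 : W ≤ 1 / 2 := by
      calc W ≤ (2 : ℝ) ^ (-1 : ℤ) := zpow_le_zpow_right₀ (by norm_num) (by omega)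
        _ = 1 / 2 := by norm_num
    have : (192 : ℝ) ≤ 12 * q ^ 4 * L := by nlinarith
    nlinarith
  have hmain := abs_re_fpCMul_sub_re_le hεdef hε1 hetheta hrzeta htheta
  have hbudget := error_budget hq48 hq0 hL hqL (norm_nonneg r) hR hΘ
  rw [← mul_sub, abs_mul, abs_two]
  set Θ := |siegelTheta t| with hΘdef
  have hΘ0 : 0 ≤ Θ := abs_nonneg _
  have hr0 := norm_nonneg r
  have h1 : 2 * ε ≤ W / (12 * q ^ 4 * L) := by
    rw [le_div_iff₀ (by positivity)]; exact hε.le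
  have h2 : 2 * ε' ≤ W / (3 * q ^ 6 * L) := by
    rw [le_div_iff₀ (by positivity)]; exact hε'.le
  calc 2 * |(fpCMul wpz etheta rzeta).re - (Complex.exp (I * siegelTheta t) * r).re|
      ≤ 2 * (ε * (6.1 * ‖r‖ + 1.1) + ε' * Θ * ‖r‖) := by gcongr
    _ = (2 * ε) * (6.1 * ‖r‖ + 1.1) + (2 * ε') * (Θ * ‖r‖) := by ring
    _ ≤ W / (12 * q ^ 4 * L) * (6.1 * ‖r‖ + 1.1) + W / (3 * q ^ 6 * L) * (Θ * ‖r‖) := by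
        gcongr
    _ = W * ((6.1 * ‖r‖ + 1.1) / (12 * q ^ 4 * L) + Θ * ‖r‖ / (3 * q ^ 6 * L)) := by ring
    _ < W * 1 := by gcongr
    _ = W := mul_one W

theorem mainTheorem3 (t : ℝ) (ht : 16 * Real.pi < t)
    (wpinitial wptheta wpz : ℕ) (hwp : 1 ≤ wpinitial)
    (hwptheta : (wptheta : ℤ) = (wpinitial : ℤ) + 1 +
      mag (3 * (t / (2 * Real.pi)) ^ (3 / 2 : ℝ) * Real.log (t / (2 * Real.pi))))
    (hwpz : (wpz : ℤ) = (wpinitial : ℤ) + 1 +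
      mag (12 * (t / (2 * Real.pi)) * Real.log (t / (2 * Real.pi))))
    -- `theta`: the value of `ϑ(t)` computed at precision `wptheta` (relative error)
    (theta : ℝ) (htheta : |theta - siegelTheta t| ≤ (2 : ℝ) ^ (-(wptheta : ℤ)) * |siegelTheta t|)
    -- `rzeta`: the value of `ℛ(1/2 + i t)` computed at precision `wpz`
    (rzeta : ℂ) (hrzeta : ‖rzeta - rsR (1 / 2 + Complex.I * t)‖ ≤ (2 : ℝ) ^ (-(wpz : ℤ)))
    -- `etheta`: the value of `e ^ (i theta)` computed at precision `wpz`
    (etheta : ℂ)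
    (hetheta : ‖etheta - Complex.exp (Complex.I * theta)‖ ≤ (2 : ℝ) ^ (-(wpz : ℤ)))
    -- `z`: the floating point product of the two at precision `wpz`
    (z : ℂ) (hz : z = fpCMul wpz etheta rzeta) :
    |2 * z.re -
        2 * (Complex.exp (Complex.I * siegelTheta t) * rsR (1 / 2 + Complex.I * t)).re|
      < (2 : ℝ) ^ (-(wpinitial : ℤ)) ∧
    ‖((2 * z.re : ℝ) : ℂ) - hardyZ t‖ < (2 : ℝ) ^ (-(wpinitial : ℤ)) ∧
    ‖((fpRound wpinitial (2 * z.re) : ℝ) : ℂ) - hardyZ t‖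
      < (2 : ℝ) ^ (-(wpinitial : ℤ)) * (1 + |2 * z.re|) := by
  have h := abs_two_mul_re_fpCMul_sub_lt ht hwp hwptheta hwpz htheta hrzeta hetheta
  rw [← hz] at h
  have ht0 : 0 < t := by linarith [Real.pi_pos]
  rw [hardyZ_eq ht0, ← ofReal_sub, ← ofReal_sub, norm_real, norm_real, Real.norm_eq_abs,
    Real.norm_eq_abs]
  refine ⟨h, h, ?_⟩
  -- The final rounding adds a relative error `2^(-w)` of `2 Re z` to the absolute error `2^(-w)`.
  have h1 := abs_fpRound_sub_le wpinitial (2 * z.re)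
  have h2 := abs_sub_le (fpRound wpinitial (2 * z.re)) (2 * z.re)
    (2 * (Complex.exp (I * siegelTheta t) * rsR (1 / 2 + I * t)).re)
  linarith
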